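/- Let $\alpha>0$. For $\phi\in\mathcal S(\mathbb R^d)$ and $(x,\xi)\in\mathbb R^d\times(\mathbb R^d\setminus\{0\})$ put $$\phi_{x,\xi}(t)=|\xi|^{\frac d2(1-\alpha)}\,\phi\bigl(|\xi|^{1-\alpha}(t-x)\bigr)\,e^{i t\cdot\xi},$$ and, for $u\in\mathcal S'(\mathbb R^d)$, $V_\phi u(x,\xi)=\langle u,\phi_{x,\xi}\rangle$ (antilinear in $\phi_{x,\xi}$). A lattice is a family $\Omega=\{(x_j^k,\xi_k): j\in\mathbb Z^d,\ k\in\mathbb N\}$ with $\xi_k\neq0$. It is $\alpha$-admissible if $|\xi_k|^\alpha\ge1$ for all but finitely many $k$ and if, for some constant $C>0$, the blocks $\{(y,\eta): |y-x_j^k|\le C|\xi_k|^{\alpha-1},\ |\eta-\xi_k|\le C|\xi_k|^{1-\alpha}\}$ have finite overlap (every point of $\mathbb R^{2d}$ lies in at most $N_0$ of them, $N_0$ a constant) and cover $\{(y,\eta):|\eta|^\alpha\ge1\}$. A window $\phi\in\mathcal S(\mathbb R^d)$ and a lattice $\Omega$ form an $\alpha$-admissible pair if $\widehat\phi$ is supported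 in an annulus $\{c_1\le|\zeta|\le c_2\}$, $0<c_1<c_2<\infty$, $\Omega$ is $\alpha$-admissible, and $\{\phi_{x_j^k,\xi_k}\}_{j,k}$ is a frame of $L^2(\mathbb R^d)$. A window is $\alpha$-admissible if it belongs to some $\alpha$-admissible pair. Given an $\alpha$-admissible pair $(\phi,\Omega)$, $1\le p,q\le\infty$ and $\beta\in\mathbb R$, the space $M^{p,q}_{\alpha,\beta}$ consists of all $u\in\mathcal S'(\mathbb R^d)$ with $$\|u\|_{M^{p,q}_{\alpha,\beta}}=\Bigl(\sum_k\Bigl(\sum_{j}|V_\phi u(x_j^k,\xi_k)|^p\Bigr)^{q/p}(1+|\xi_k|)^{\beta q}\Bigr)^{1/q}<\infty$$ (suprema replacing the sums when $p$ or $q$ is infinite). Given an $\alpha$-admissible window $\psi$, the subdyadic Gabor wavefront set $WF^{\mathrm G}_\alpha(u)$ is the set of all $(x_0,\xi_0)\in\mathbb R^d\times(\mathbb R^d\setminus\{0\})$ at which $u$ is not Gabor-microlocally regular, where $u$ is called regular at $(x_0,\xi_0)$ if there are $\chi\in C_c^\infty(\mathbb R^d)$ with $\chi(x_0)\ne0$,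 an open neighbourhood $U$ of $x_0$, an open cone $\Gamma\subset\mathbb R^d\setminus\{0\}$ containing $\xi_0$, with $|\xi|^\alpha\ge1$ for all sufficiently large $\xi\in\Gamma$, and $R>0$ such that for every $N\in\mathbb N$ there is $C_N$ with $$|V_\psi(\chi u)(x,\xi)|\le C_N(1+|\xi|)^{-N}\qquad\text{for all }x\in U,\ \xi\in\Gamma,\ |\xi|\ge R.$$ **Proposition.** Let $\alpha>0$, let $(\phi,\Omega)$ be an $\alpha$-admissible pair, let $\psi$ be an $\alpha$-admissible window, and let $u\in\mathcal S'(\mathbb R^d)$. If, for some $1\le p,q\le\infty$, $u\in M^{p,q}_{\alpha,\beta}$ for all sufficiently large $\beta$ (that is, there is $\beta_0$ such that $u\in M^{p,q}_{\alpha,\beta}$ for every $\beta\ge\beta_0$), then $WF^{\mathrm G}_\alpha(u)=\emptyset$. -/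

import Mathlib

open MeasureTheory Filter Topology
open scoped SchwartzMap ENNReal ContDiff FourierTransform

namespace Subdyadic

/-- The Euclidean space `ℝ^d`. -/
abbrev E (d : ℕ) : Type := EuclideanSpace ℝ (Fin d)

/-! ## Wave packets and the dispersive short-time Fourier transform -/

theorem hasTemperateGrowth_cexp_I :
    Function.HasTemperateGrowth (fun s : ℝ => Complex.exp (Complex.I * (s : ℂ))) := by
  have hd : ∀ s : ℝ, HasDerivAt (fun s : ℝ => Complex.exp (Complex.I * (s : ℂ)))
      (Complex.I * Complex.exp (Complex.I * (s : ℂ))) s := by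
    intro s
    have h := ((Complex.ofRealCLM.hasDerivAt (x := s)).const_mul Complex.I).cexp
    simp only [Complex.ofRealCLM_apply, Complex.ofReal_one, mul_one] at h
    rw [mul_comm]
    exact h
  have hi : ∀ n : ℕ, iteratedDeriv n (fun s : ℝ => Complex.exp (Complex.I * (s : ℂ)))
      = fun s : ℝ => Complex.I ^ n * Complex.exp (Complex.I * (s : ℂ)) := by
    intro n
    induction n with
    | zero => simp
    | succ n ih =>
      rw [iteratedDeriv_succ, ih]
      funext s
      rw [((hd s).const_mul (Complex.I ^ n)).deriv]
      ring
  refine ⟨(contDiff_const.mul Complex.ofRealCLM.contDiff).cexp, fun n => ⟨0, 1, fun s => ?_⟩⟩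
  rw [norm_iteratedFDeriv_eq_norm_iteratedDeriv, hi n, norm_mul, norm_pow, Complex.norm_I,
    mul_comm Complex.I, Complex.norm_exp_ofReal_mul_I]
  simp

theorem hasTemperateGrowth_modulation {d : ℕ} (ξ : E d) :
    Function.HasTemperateGrowth
      (fun t : E d => Complex.exp (Complex.I * ((inner ℝ t ξ : ℝ) : ℂ))) :=
  hasTemperateGrowth_cexp_I.comp (Function.hasTemperateGrowth_inner_left ξ)

/-- The wave packet attached to `(x, ξ)`, `ξ ≠ 0`, as a Schwartz function:
`φ_{x,ξ}(t) = |ξ|^{(d/2)(1-α)} φ(|ξ|^{1-α} (t - x)) e^{i t·ξ}` (see `packet_apply`).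
For `ξ = 0`, which is never used, it is `0`. -/
noncomputable def packet {d : ℕ} (α : ℝ) (φ : 𝓢(E d, ℂ)) (x ξ : E d) : 𝓢(E d, ℂ) :=
  if h : ξ = 0 then 0 else
    ((‖ξ‖ ^ ((d : ℝ) / 2 * (1 - α)) : ℝ) : ℂ) •
      SchwartzMap.smulLeftCLM ℂ
        (fun t : E d => Complex.exp (Complex.I * ((inner ℝ t ξ : ℝ) : ℂ)))
        (SchwartzMap.compSubConstCLM ℂ x
          (SchwartzMap.compCLMOfContinuousLinearEquiv ℂ
            (ContinuousLinearEquiv.smulLeft (R₁ := ℝ) (M₁ := E d)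
              (Units.mk0 (‖ξ‖ ^ (1 - α))
                (Real.rpow_pos_of_pos (norm_pos_iff.mpr h) (1 - α)).ne')) φ))

theorem packet_apply {d : ℕ} (α : ℝ) (φ : 𝓢(E d, ℂ)) (x ξ : E d) (hξ : ξ ≠ 0) (t : E d) :
    packet α φ x ξ t =
      ((‖ξ‖ ^ ((d : ℝ) / 2 * (1 - α)) : ℝ) : ℂ) * φ (‖ξ‖ ^ (1 - α) • (t - x)) *
        Complex.exp (Complex.I * ((inner ℝ t ξ : ℝ) : ℂ)) := by
  simp only [packet, dif_neg hξ, smul_apply, smul_eq_mul,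
    SchwartzMap.smulLeftCLM_apply_apply (hasTemperateGrowth_modulation ξ),
    SchwartzMap.compSubConstCLM_apply, SchwartzMap.compCLMOfContinuousLinearEquiv_apply,
    Function.comp_apply]
  rw [mul_comm (Complex.exp _), ← mul_assoc]
  rfl

/-- Complex conjugation of a Schwartz function. -/
noncomputable def conjSchwartz {d : ℕ} (f : 𝓢(E d, ℂ)) : 𝓢(E d, ℂ) :=
  SchwartzMap.postcompCLM (𝕜 := ℝ) (Complex.conjCLE : ℂ →L[ℝ] ℂ) f

theorem conjSchwartz_apply {d : ℕ} (f : 𝓢(E d, ℂ)) (t : E d) :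
    conjSchwartz f t = (starRingEnd ℂ) (f t) := rfl

/-- The dispersive short-time Fourier transform `V_φ u(x, ξ) = ⟨u, φ_{x,ξ}⟩` of a tempered
distribution; the pairing is antilinear in the packet, so that it is
`∫ u(t) conj(φ_{x,ξ}(t)) dt` when `u` is a function. -/
noncomputable def stft {d : ℕ} (α : ℝ) (φ : 𝓢(E d, ℂ)) (u : 𝓢'(E d, ℂ)) (x ξ : E d) : ℂ :=
  u (conjSchwartz (packet α φ x ξ))

/-! ## Admissible lattices and windows -/

/-- A family of phase-space points `(x_j^k, ξ_k)`, `k ∈ ℕ`, `j ∈ ℤ^d`, with `ξ_k ≠ 0`. -/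
structure Lattice (d : ℕ) where
  /-- the frequency centres `ξ_k` -/
  freq : ℕ → E d
  /-- the spatial nodes `x_j^k` -/
  node : (Fin d → ℤ) → ℕ → E d
  /-- frequency centres do not vanish -/
  freq_ne_zero : ∀ k, freq k ≠ 0

/-- The block `Q_α(x, ξ; 1)`, where `C` is the structural constant of the blocks. -/
def block {d : ℕ} (α C : ℝ) (x ξ : E d) : Set (E d × E d) :=
  {w | ‖w.1 - x‖ ≤ C * ‖ξ‖ ^ (α - 1) ∧ ‖w.2 - ξ‖ ≤ C * ‖ξ‖ ^ (1 - α)}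

/-- `α`-admissible lattices: only finitely many frequency centres lie in the low frequency region
`|ξ|^α < 1`, and the blocks around the lattice points have finite overlap and cover
`{(x, ξ) : |ξ|^α ≥ 1}`. -/
def IsAdmissibleLattice {d : ℕ} (α : ℝ) (Ω : Lattice d) : Prop :=
  {k | ‖Ω.freq k‖ ^ α < 1}.Finite ∧
  ∃ C : ℝ, 0 < C ∧
    (∃ N₀ : ℕ, ∀ w : E d × E d,
      {z : (Fin d → ℤ) × ℕ | w ∈ block α C (Ω.node z.1 z.2) (Ω.freq z.2)}.encard ≤ N₀) ∧
    ∀ w : E d × E d, 1 ≤ ‖w.2‖ ^ α → ∃ j k, w ∈ block α C (Ω.node j k) (Ω.freq k)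

/-- The packets `φ_{x_j^k, ξ_k}` form a frame of `L²(ℝ^d)`. -/
def IsGaborFrame {d : ℕ} (α : ℝ) (φ : 𝓢(E d, ℂ)) (Ω : Lattice d) : Prop :=
  ∃ A B : ℝ, 0 < A ∧ ∀ f : Lp ℂ 2 (volume : Measure (E d)),
    ENNReal.ofReal (A * ‖f‖ ^ 2) ≤
      ∑' z : (Fin d → ℤ) × ℕ,
        ‖inner ℂ ((packet α φ (Ω.node z.1 z.2) (Ω.freq z.2)).toLp 2 volume) f‖ₑ ^ 2 ∧
    ∑' z : (Fin d → ℤ) × ℕ,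
        ‖inner ℂ ((packet α φ (Ω.node z.1 z.2) (Ω.freq z.2)).toLp 2 volume) f‖ₑ ^ 2
      ≤ ENNReal.ofReal (B * ‖f‖ ^ 2)

/-- The Fourier transform of `φ` is supported in an annulus away from the origin. (The
normalisation of the Fourier transform only rescales the radii.) -/
def HasAnnularSpectrum {d : ℕ} (φ : 𝓢(E d, ℂ)) : Prop :=
  ∃ c₁ c₂ : ℝ, 0 < c₁ ∧ c₁ < c₂ ∧ ∀ ζ : E d, 𝓕 φ ζ ≠ 0 → c₁ ≤ ‖ζ‖ ∧ ‖ζ‖ ≤ c₂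

/-- An `α`-admissible pair of a window and a lattice. The uniform localization of the packets of
`φ` in the blocks is automatic, since `φ` is a Schwartz function with annular spectrum and the
packets are obtained from it by the dilations, translations and modulations in `packet_apply`. -/
def IsAdmissiblePair {d : ℕ} (α : ℝ) (φ : 𝓢(E d, ℂ)) (Ω : Lattice d) : Prop :=
  HasAnnularSpectrum φ ∧ IsAdmissibleLattice α Ω ∧ IsGaborFrame α φ Ω

/-- `α`-admissible windows: those that generate a frame over some admissible lattice. -/
def IsAdmissibleWindow {d : ℕ} (α : ℝ) (φ : 𝓢(E d, ℂ)) : Prop :=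
  ∃ Ω : Lattice d, IsAdmissiblePair α φ Ω

/-! ## Dispersive modulation spaces -/

/-- The `ℓ^p` norm of a family of extended nonnegative numbers, `1 ≤ p ≤ ∞`. -/
noncomputable def ellNorm {ι : Type} (p : ℝ≥0∞) (a : ι → ℝ≥0∞) : ℝ≥0∞ :=
  if p = ⊤ then ⨆ i, a i else (∑' i, a i ^ p.toReal) ^ (1 / p.toReal)

/-- The norm `‖u‖_{M^{p,q}_{α,β}}`, computed with the window `φ` and the lattice `Ω`:
the `ℓ^q` norm in `k` of `(1 + |ξ_k|)^β` times the `ℓ^p` norm in `j` of `⟨u, φ_{x_j^k, ξ_k}⟩`. -/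
noncomputable def modulationNorm {d : ℕ} (α β : ℝ) (p q : ℝ≥0∞) (φ : 𝓢(E d, ℂ)) (Ω : Lattice d)
    (u : 𝓢'(E d, ℂ)) : ℝ≥0∞ :=
  ellNorm q fun k : ℕ =>
    ellNorm p (fun j : Fin d → ℤ => ‖stft α φ u (Ω.node j k) (Ω.freq k)‖ₑ) *
      ENNReal.ofReal ((1 + ‖Ω.freq k‖) ^ β)

/-- The dispersive modulation space `M^{p,q}_{α,β}`, a set of tempered distributions. -/
def modulationSpace {d : ℕ} (α β : ℝ) (p q : ℝ≥0∞) (φ : 𝓢(E d, ℂ)) (Ω : Lattice d) :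
    Set 𝓢'(E d, ℂ) :=
  {u | modulationNorm α β p q φ Ω u < ⊤}

/-! ## The subdyadic Gabor wavefront set -/

/-- Gabor-microlocal regularity of type `α` at `(x₀, ξ₀)`, tested with the window `φ`.
Here `χ u` is `TemperedDistribution.smulLeftCLM ℂ χ u`, that is `f ↦ u (χ f)`. -/
def IsGaborRegularAt {d : ℕ} (α : ℝ) (φ : 𝓢(E d, ℂ)) (u : 𝓢'(E d, ℂ)) (x₀ ξ₀ : E d) : Prop :=
  ∃ χ : E d → ℂ, ContDiff ℝ ∞ χ ∧ HasCompactSupport χ ∧ χ x₀ ≠ 0 ∧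
  ∃ U : Set (E d), IsOpen U ∧ x₀ ∈ U ∧
  ∃ Γ : Set (E d), IsOpen Γ ∧ 0 ∉ Γ ∧ (∀ ξ ∈ Γ, ∀ c : ℝ, 0 < c → c • ξ ∈ Γ) ∧ ξ₀ ∈ Γ ∧
    (∃ R₀ : ℝ, ∀ ξ ∈ Γ, R₀ ≤ ‖ξ‖ → 1 ≤ ‖ξ‖ ^ α) ∧
  ∃ R : ℝ, 0 < R ∧ ∀ N : ℕ, ∃ CN : ℝ, ∀ x ∈ U, ∀ ξ ∈ Γ, R ≤ ‖ξ‖ →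
    ‖stft α φ (TemperedDistribution.smulLeftCLM ℂ χ u) x ξ‖ ≤ CN * (1 + ‖ξ‖) ^ (-(N : ℝ))

/-- The subdyadic Gabor wavefront set of `u`: the points `(x₀, ξ₀)`, `ξ₀ ≠ 0`, at which `u` is not
Gabor-microlocally regular of type `α`. -/
def gaborWF {d : ℕ} (α : ℝ) (φ : 𝓢(E d, ℂ)) (u : 𝓢'(E d, ℂ)) : Set (E d × E d) :=
  {w | w.2 ≠ 0 ∧ ¬ IsGaborRegularAt α φ u w.1 w.2}

end Subdyadic

namespace Subdyadic

/-! ## Absolutely convergent series of Schwartz functions -/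

/-! Membership in the modulation spaces for all large β makes the frame coefficients ⟨u,
φ_{x_j^k,ξ_k}⟩ decay faster than any power of |ξ_k|, whatever p and q are
(`exists_coefficient_decay`). This decay has to be transferred to V_ψ(χu)(x,ξ), which is u paired
with χψ_{x,ξ} (for real χ). No dual frame is constructed; the frame operator is inverted
approximately, by finitely many Richardson steps.

The spectrum of χψ_{x,ξ} is concentrated around ξ at scale max(1, |ξ|^{1-α}), which is much smaller
than |ξ| because α > 0. A smooth cut at distance comparable to |ξ| therefore leaves a tail whose
Schwartz seminorms are O(|ξ|^{-N}) for every N, and continuity of u handles it. There remain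
functions f with spectrum within |ξ|/8 of ξ (`exists_band_decay`).

Such an f sees only packets with |ξ_k| comparable to |ξ|. If S is the frame operator of these
packets and B an upper frame bound, then f ↦ f - B⁻¹Sf contracts the L² norm by a factor independent
of ξ (`nrm_sub_smul_frameOp_le`). The pairing of u with Sf involves only small coefficients. Each
step widens the band by O(|ξ|^{1-α}) (`Band.frameOp_near`), so about |ξ|^α steps fit before the band
reaches |ξ|/4; the remainder is then exponentially small in |ξ|^α and beats every polynomial loss
(`exists_richardson_estimate`).

The difficulty is that u is controlled by weighted norms, not by the L² norm, and S does not commute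
with multiplication by coordinates. The commutators are again frame-type operators (`pos_frameOp`),
bounded by powers of |ξ|, and they involve only strictly lower moments. Weighting the m-th moment by
κ^m, with κ a small negative power of |ξ|, makes them a small perturbation and preserves the
contraction (`wnrm_sub_smul_le`). -/

theorem exists_schwartz_tsum {ι V F : Type*} [NormedAddCommGroup V] [NormedSpace ℝ V]
    [NormedAddCommGroup F] [NormedSpace ℝ F] [CompleteSpace F] (g : ι → 𝓢(V, F))
    (hg : ∀ k n : ℕ, Summable fun z => SchwartzMap.seminorm ℝ k n (g z)) :
    ∃ G : 𝓢(V, F), (∀ x, HasSum (fun z => g z x) (G x)) ∧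
      ∀ k n : ℕ, SchwartzMap.seminorm ℝ k n G ≤ ∑' z, SchwartzMap.seminorm ℝ k n (g z) := by
  have hsm : ∀ i, ContDiff ℝ ∞ (g i) := fun i => (g i).smooth _
  have hbd : ∀ (k : ℕ) (i : ι) (x : V), (k : ℕ∞) ≤ (⊤ : ℕ∞) →
      ‖iteratedFDeriv ℝ k (g i) x‖ ≤ SchwartzMap.seminorm ℝ 0 k (g i) :=
    fun k i x _ => SchwartzMap.norm_iteratedFDeriv_le_seminorm ℝ (g i) k x
  have hv : ∀ k : ℕ, (k : ℕ∞) ≤ (⊤ : ℕ∞) → Summable fun z => SchwartzMap.seminorm ℝ 0 k (g z) :=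
    fun k _ => hg 0 k
  have hdec : ∀ (k n : ℕ) (x : V), ‖x‖ ^ k * ‖iteratedFDeriv ℝ n (fun y => ∑' z, g z y) x‖ ≤
      ∑' z, SchwartzMap.seminorm ℝ k n (g z) := by
    intro k n x
    rw [iteratedFDeriv_tsum_apply hsm hv hbd le_top x]
    have hs : Summable fun z => ‖iteratedFDeriv ℝ n (g z) x‖ :=
      Summable.of_nonneg_of_le (fun _ => norm_nonneg _) (fun z => hbd n z x le_top) (hg 0 n)
    calc ‖x‖ ^ k * ‖∑' z, iteratedFDeriv ℝ n (g z) x‖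
        ≤ ‖x‖ ^ k * ∑' z, ‖iteratedFDeriv ℝ n (g z) x‖ := by
          gcongr
          exact norm_tsum_le_tsum_norm hs
      _ = ∑' z, ‖x‖ ^ k * ‖iteratedFDeriv ℝ n (g z) x‖ := tsum_mul_left.symm
      _ ≤ _ := (hs.mul_left _).tsum_le_tsum
          (fun z => SchwartzMap.le_seminorm ℝ k n (g z) x) (hg k n)
  refine ⟨⟨fun y => ∑' z, g z y, contDiff_tsum hsm hv hbd, fun k n => ⟨_, hdec k n⟩⟩, ?_, ?_⟩
  · intro x
    refine Summable.hasSum ?_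
    exact Summable.of_norm_bounded (hg 0 0) fun z => SchwartzMap.norm_le_seminorm ℝ (g z) x
  · intro k n
    exact SchwartzMap.seminorm_le_bound ℝ k n _
      (tsum_nonneg fun z => apply_nonneg _ _) (hdec k n)

/-- A partial sum differs from the limit by the sum of the complementary family, whose seminorms are
bounded by tails of convergent numerical series. -/
theorem summable_schwartz {ι V F : Type*} [NormedAddCommGroup V] [NormedSpace ℝ V]
    [NormedAddCommGroup F] [NormedSpace ℝ F] [CompleteSpace F] (g : ι → 𝓢(V, F))
    (hg : ∀ k n : ℕ, Summable fun z => SchwartzMap.seminorm ℝ k n (g z)) : Summable g := by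
  classical
  obtain ⟨G, hG, -⟩ := exists_schwartz_tsum g hg
  refine ⟨G, ?_⟩
  have key : ∀ (s : Finset ι) (k n : ℕ), SchwartzMap.seminorm ℝ k n (∑ z ∈ s, g z - G) ≤
      ∑' z : {z // z ∉ s}, SchwartzMap.seminorm ℝ k n (g z) := by
    intro s k n
    obtain ⟨H, hH, hHn⟩ := exists_schwartz_tsum (fun z : {z // z ∉ s} => g z)
      (fun k n => (hg k n).subtype _)
    have : ∑ z ∈ s, g z - G = -H := by
      ext x
      have h1 := (hG x).summable.sum_add_tsum_subtype_compl s
      rw [(hG x).tsum_eq] at h1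
      have h2 := (hH x).tsum_eq
      have h3 : ∑' z : {z // z ∉ s}, g z x = H x := h2
      simp only [sub_apply, neg_apply, sum_apply]
      rw [← h1, ← h3]
      abel
    rw [this, map_neg_eq_map]
    exact hHn k n
  change Tendsto (fun s : Finset ι => ∑ z ∈ s, g z) atTop (𝓝 G)
  rw [(schwartz_withSeminorms ℝ V F).tendsto_nhds]
  rintro ⟨k, n⟩ ε hε
  have ht := tendsto_tsum_compl_atTop_zero fun z => SchwartzMap.seminorm ℝ k n (g z)
  filter_upwards [ht.eventually (gt_mem_nhds hε)] with s hs
  exact (key s k n).trans_lt hs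

/-! ## Band-limited Schwartz functions -/

variable {d : ℕ}

/-- The spectrum of `f` (in angular frequency) lies in the closed ball of radius `r` around `ξ`. -/
def Band (ξ : E d) (r : ℝ) (f : 𝓢(E d, ℂ)) : Prop :=
  ∀ ζ, 𝓕 f ζ ≠ 0 → ‖(2 * Real.pi) • ζ - ξ‖ ≤ r

theorem fourier_add' (f g : 𝓢(E d, ℂ)) : 𝓕 (f + g) = 𝓕 f + 𝓕 g :=
  map_add (SchwartzMap.fourierTransformCLM ℂ) f g

theorem fourier_smul' (c : ℂ) (f : 𝓢(E d, ℂ)) : 𝓕 (c • f) = c • 𝓕 f :=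
  map_smul (SchwartzMap.fourierTransformCLM ℂ) c f

theorem Band.mono {ξ : E d} {r s : ℝ} {f : 𝓢(E d, ℂ)} (h : Band ξ r f) (hrs : r ≤ s) :
    Band ξ s f := fun ζ hζ => (h ζ hζ).trans hrs

theorem Band.recenter {ξ η : E d} {r : ℝ} {f : 𝓢(E d, ℂ)} (h : Band ξ r f) :
    Band η (r + ‖ξ - η‖) f := fun ζ hζ => by
  calc ‖(2 * Real.pi) • ζ - η‖ = ‖((2 * Real.pi) • ζ - ξ) + (ξ - η)‖ := by congr 1; abel
    _ ≤ _ := (norm_add_le _ _).trans (by gcongr; exact h ζ hζ)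

theorem Band.add {ξ : E d} {r : ℝ} {f g : 𝓢(E d, ℂ)} (hf : Band ξ r f) (hg : Band ξ r g) :
    Band ξ r (f + g) := by
  intro ζ hζ
  by_contra hc
  have h1 : 𝓕 f ζ = 0 := by by_contra h; exact hc (hf ζ h)
  have h2 : 𝓕 g ζ = 0 := by by_contra h; exact hc (hg ζ h)
  apply hζ
  rw [fourier_add', add_apply, h1, h2, add_zero]

theorem Band.smul {ξ : E d} {r : ℝ} {f : 𝓢(E d, ℂ)} (c : ℂ) (hf : Band ξ r f) :
    Band ξ r (c • f) := by
  intro ζ hζ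
  refine hf ζ fun h => hζ ?_
  rw [fourier_smul', smul_apply, h, smul_zero]

theorem Band.sub {ξ : E d} {r : ℝ} {f g : 𝓢(E d, ℂ)} (hf : Band ξ r f) (hg : Band ξ r g) :
    Band ξ r (f - g) := by
  have := hf.add (hg.smul (-1))
  rwa [neg_one_smul, ← sub_eq_add_neg] at this

/-- Evaluating the Fourier transform at a point is continuous on Schwartz functions, so it passes
through the sum. Summability need not be assumed: a divergent `tsum` is zero, and zero has every
band. -/
theorem Band.tsum {ι : Type*} {ξ : E d} {r : ℝ} {g : ι → 𝓢(E d, ℂ)} (hg : ∀ z, Band ξ r (g z)) :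
    Band ξ r (∑' z, g z) := by
  intro ζ hζ
  by_contra hc
  apply hζ
  by_cases hs : Summable g
  · have h1 := hs.hasSum.mapL (SchwartzMap.fourierTransformCLM ℂ)
    have h2 := h1.mapL ((BoundedContinuousFunction.evalCLM ℂ ζ).comp
      (SchwartzMap.toBoundedContinuousFunctionCLM ℂ (E d) ℂ))
    have h3 : HasSum (fun z => 𝓕 (g z) ζ) (𝓕 (∑' z, g z) ζ) := h2
    have h4 : (fun z => 𝓕 (g z) ζ) = fun _ => 0 := by
      funext z
      by_contra h
      exact hc (hg z ζ h)
    rw [h4] at h3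
    exact h3.unique hasSum_zero
  · rw [tsum_eq_zero_of_not_summable hs]
    have : 𝓕 (0 : 𝓢(E d, ℂ)) = 0 := map_zero (SchwartzMap.fourierTransformCLM ℂ)
    rw [this]; rfl

/-- The `L²` inner product of Schwartz functions. -/
noncomputable def ip (f g : 𝓢(E d, ℂ)) : ℂ := inner ℂ (f.toLp 2 volume) (g.toLp 2 volume)

/-- The `L²` norm of a Schwartz function. -/
noncomputable def nrm (f : 𝓢(E d, ℂ)) : ℝ := ‖f.toLp 2 (volume : Measure (E d))‖

theorem ip_eq_integral (f g : 𝓢(E d, ℂ)) : ip f g = ∫ t, (starRingEnd ℂ) (f t) * g t := by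
  refine (SchwartzMap.inner_toL2_toL2_eq f g volume).trans ?_
  refine integral_congr_ae (Eventually.of_forall fun t => ?_)
  simp [mul_comm]

/-- By Plancherel, since the two spectra are disjoint. This orthogonality is what confines the frame
operator to comparable frequencies. -/
theorem Band.ip_eq_zero {ξ η : E d} {r s : ℝ} {f g : 𝓢(E d, ℂ)} (hf : Band ξ r f)
    (hg : Band η s g) (h : r + s < ‖ξ - η‖) : ip f g = 0 := by
  rw [ip, ← SchwartzMap.inner_fourier_toL2_eq, ← ip, ip_eq_integral]
  refine integral_eq_zero_of_ae (Eventually.of_forall fun ζ => ?_)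
  by_contra hne
  have hne' : (starRingEnd ℂ) (𝓕 f ζ) * 𝓕 g ζ ≠ 0 := hne
  have h1 : 𝓕 f ζ ≠ 0 := fun h0 => hne' (by simp [h0])
  have h2 : 𝓕 g ζ ≠ 0 := fun h0 => hne' (by simp [h0])
  have h3 := hf ζ h1
  have h4 := hg ζ h2
  have h5 : ‖ξ - η‖ ≤ ‖(2 * Real.pi) • ζ - ξ‖ + ‖(2 * Real.pi) • ζ - η‖ := by
    rw [show ξ - η = ((2 * Real.pi) • ζ - η) - ((2 * Real.pi) • ζ - ξ) by abel, add_comm]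
    exact norm_sub_le _ _
  linarith

/-! ## Multiplication by a coordinate -/

theorem hasTemperateGrowth_coord (i : Fin d) :
    Function.HasTemperateGrowth (fun t : E d => ((t i : ℝ) : ℂ)) :=
  (Complex.ofRealCLM.comp (EuclideanSpace.proj (𝕜 := ℝ) i)).hasTemperateGrowth

/-- Multiplication by the `i`-th coordinate. -/
noncomputable def pos (i : Fin d) : 𝓢(E d, ℂ) →L[ℂ] 𝓢(E d, ℂ) :=
  SchwartzMap.smulLeftCLM ℂ (fun t : E d => ((t i : ℝ) : ℂ))

theorem pos_apply (i : Fin d) (f : 𝓢(E d, ℂ)) (t : E d) : pos i f t = (t i : ℂ) * f t := by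
  rw [pos, SchwartzMap.smulLeftCLM_apply_apply (hasTemperateGrowth_coord i), smul_eq_mul]

theorem pos_iterate_apply (i : Fin d) (m : ℕ) (f : 𝓢(E d, ℂ)) (t : E d) :
    (pos i)^[m] f t = (t i : ℂ) ^ m * f t := by
  induction m with
  | zero => simp
  | succ m ih => rw [Function.iterate_succ_apply', pos_apply, ih, pow_succ]; ring

open LineDeriv in
theorem lineDeriv_fourier_eq_pos (i : Fin d) (f : 𝓢(E d, ℂ)) :
    ∂_{EuclideanSpace.single i (1 : ℝ)} (𝓕 f) = (-(2 * Real.pi * Complex.I)) • 𝓕 (pos i f) := by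
  rw [SchwartzMap.lineDerivOp_fourier_eq, ← fourier_smul']
  congr 2
  ext t
  have h := ((innerSL ℝ (E := E d)).flip (EuclideanSpace.single i (1 : ℝ))).hasTemperateGrowth
  have h' : Function.HasTemperateGrowth
    (fun t : E d => inner ℝ t (EuclideanSpace.single i (1 : ℝ))) := h
  rw [SchwartzMap.smulLeftCLM_apply_apply h', pos_apply]
  simp [EuclideanSpace.inner_single_right]

theorem isClosed_bandSet (ξ : E d) (r : ℝ) :
    IsClosed {ζ : E d | ‖(2 * Real.pi) • ζ - ξ‖ ≤ r} :=
  isClosed_le (by fun_prop) continuous_const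

theorem Band.tsupport_subset {ξ : E d} {r : ℝ} {f : 𝓢(E d, ℂ)} (hf : Band ξ r f) :
    tsupport (𝓕 f : 𝓢(E d, ℂ)) ⊆ {ζ | ‖(2 * Real.pi) • ζ - ξ‖ ≤ r} :=
  closure_minimal (fun ζ hζ => hf ζ hζ) (isClosed_bandSet ξ r)

open LineDeriv in
-- Multiplication by a coordinate is differentiation on the Fourier side, which does not enlarge the
-- closed support; bands are closed balls, so they contain that closure.
theorem Band.pos {ξ : E d} {r : ℝ} {f : 𝓢(E d, ℂ)} (hf : Band ξ r f) (i : Fin d) :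
    Band ξ r (pos i f) := by
  intro ζ hζ
  apply hf.tsupport_subset
  apply SchwartzMap.tsupport_lineDerivOp_subset (EuclideanSpace.single i (1 : ℝ)) (𝓕 f)
  apply subset_tsupport
  rw [Function.mem_support, lineDeriv_fourier_eq_pos, smul_apply]
  exact smul_ne_zero (by simp [Real.pi_ne_zero]) hζ

theorem Band.pos_iterate {ξ : E d} {r : ℝ} {f : 𝓢(E d, ℂ)} (hf : Band ξ r f) (i : Fin d) (m : ℕ) :
    Band ξ r ((Subdyadic.pos i)^[m] f) := by
  induction m with
  | zero => exact hf
  | succ m ih => rw [Function.iterate_succ_apply']; exact ih.pos i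

/-! ## `L²` norms of Schwartz functions and an integrable weight -/

theorem nrm_eq_norm_toLpCLM (f : 𝓢(E d, ℂ)) :
    nrm f = ‖SchwartzMap.toLpCLM ℂ ℂ 2 (volume : Measure (E d)) f‖ := rfl

theorem nrm_nonneg (f : 𝓢(E d, ℂ)) : 0 ≤ nrm f := norm_nonneg _

theorem nrm_add_le (f g : 𝓢(E d, ℂ)) : nrm (f + g) ≤ nrm f + nrm g := by
  simp only [nrm_eq_norm_toLpCLM, map_add]
  exact norm_add_le _ _

theorem nrm_sub_le (f g : 𝓢(E d, ℂ)) : nrm (f - g) ≤ nrm f + nrm g := by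
  simp only [nrm_eq_norm_toLpCLM, map_sub]
  exact norm_sub_le _ _

theorem nrm_smul (c : ℂ) (f : 𝓢(E d, ℂ)) : nrm (c • f) = ‖c‖ * nrm f := by
  simp only [nrm_eq_norm_toLpCLM, map_smul, norm_smul]

theorem nrm_sq_eq_integral (f : 𝓢(E d, ℂ)) : nrm f ^ 2 = ∫ t, ‖f t‖ ^ 2 := by
  have h : ((nrm f ^ 2 : ℝ) : ℂ) = ((∫ t, ‖f t‖ ^ 2 : ℝ) : ℂ) := by
    have h1 : ip f f = ((nrm f ^ 2 : ℝ) : ℂ) := by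
      rw [ip, inner_self_eq_norm_sq_to_K, nrm]; simp
    rw [← h1, ip_eq_integral, ← integral_complex_ofReal]
    refine integral_congr_ae (Eventually.of_forall fun t => ?_)
    simp only [mul_comm, Complex.mul_conj, Complex.normSq_eq_norm_sq]
  exact_mod_cast h

/-- The integrable weight `(1 + |t|)^{-(d+1)}`. -/
noncomputable def wt (t : E d) : ℝ := ((1 + ‖t‖) ^ (d + 1))⁻¹

theorem wt_pos (t : E d) : 0 < wt t := by unfold wt; positivity

theorem wt_le_one (t : E d) : wt t ≤ 1 := by
  unfold wt
  apply inv_le_one_of_one_le₀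
  exact one_le_pow₀ (by linarith [norm_nonneg t])

theorem continuous_wt : Continuous (wt : E d → ℝ) := by
  unfold wt
  exact Continuous.inv₀ (by fun_prop) fun t => by positivity

theorem integrable_wt : Integrable (wt : E d → ℝ) := by
  have h := integrable_one_add_norm (E := E d) (μ := volume) (r := (d : ℝ) + 1)
    (by simp)
  refine h.congr (Eventually.of_forall fun t => ?_)
  simp only [wt]
  rw [Real.rpow_neg (by positivity), ← Nat.cast_one, ← Nat.cast_add, Real.rpow_natCast]

/-- The mass of the weight `wt`. -/
noncomputable def wtMass (d : ℕ) : ℝ := ∫ t : E d, wt t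

theorem wtMass_nonneg : 0 ≤ wtMass d := integral_nonneg fun t => (wt_pos t).le

theorem integral_wt_sub (x : E d) : ∫ t, wt (t - x) = wtMass d :=
  integral_sub_right_eq_self (wt : E d → ℝ) x

theorem integrable_wt_mul {x : E d} {g : E d → ℝ} (hg : Integrable g) :
    Integrable fun t => wt (t - x) * g t := by
  refine hg.bdd_mul (c := 1) (continuous_wt.comp (by fun_prop)).aestronglyMeasurable ?_
  refine Eventually.of_forall fun t => ?_
  rw [Real.norm_of_nonneg (wt_pos _).le]
  exact wt_le_one _

theorem integrable_norm_sq (f : 𝓢(E d, ℂ)) : Integrable fun t => ‖f t‖ ^ 2 :=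
  (memLp_two_iff_integrable_sq_norm f.continuous.aestronglyMeasurable).1 (f.memLp 2)

/-- Cauchy–Schwarz for the finite measure with density `wt (t - x)`, read off from the discriminant
of the nonnegative quadratic s ↦ ∫ wt(t - x)(|f(t)| - s)² dt. -/
theorem sq_integral_wt_mul_le (x : E d) (f : 𝓢(E d, ℂ)) :
    (∫ t, wt (t - x) * ‖f t‖) ^ 2 ≤ wtMass d * ∫ t, wt (t - x) * ‖f t‖ ^ 2 := by
  have h1 : Integrable fun t => wt (t - x) * ‖f t‖ := integrable_wt_mul f.integrable.norm
  have h2 : Integrable fun t => wt (t - x) * ‖f t‖ ^ 2 := integrable_wt_mul (integrable_norm_sq f)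
  have h0 : Integrable fun t => wt (t - x) := integrable_wt.comp_sub_right x
  have key : ∀ s : ℝ, 0 ≤ wtMass d * (s * s) + (-2 * ∫ t, wt (t - x) * ‖f t‖) * s
      + ∫ t, wt (t - x) * ‖f t‖ ^ 2 := by
    intro s
    have : 0 ≤ ∫ t, wt (t - x) * (‖f t‖ - s) ^ 2 :=
      integral_nonneg fun t => mul_nonneg (wt_pos _).le (sq_nonneg _)
    have e : (fun t => wt (t - x) * (‖f t‖ - s) ^ 2) = fun t =>
        (s * s) * wt (t - x) + (-2 * s) * (wt (t - x) * ‖f t‖) + wt (t - x) * ‖f t‖ ^ 2 := by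
      funext t; ring
    have h01 : Integrable fun t => (s * s) * wt (t - x) + (-2 * s) * (wt (t - x) * ‖f t‖) :=
      (h0.const_mul _).add (h1.const_mul _)
    rw [e, integral_add h01 h2,
      integral_add (h0.const_mul _) (h1.const_mul _), integral_const_mul, integral_const_mul,
      integral_wt_sub] at this
    linarith
  have := discrim_le_zero key
  rw [discrim] at this
  nlinarith

theorem integral_wt_mul_le (x : E d) (f : 𝓢(E d, ℂ)) :
    ∫ t, wt (t - x) * ‖f t‖ ≤ √(wtMass d) * nrm f := by
  apply le_of_sq_le_sq _ (mul_nonneg (Real.sqrt_nonneg _) (nrm_nonneg f))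
  rw [mul_pow, Real.sq_sqrt wtMass_nonneg, nrm_sq_eq_integral]
  refine (sq_integral_wt_mul_le x f).trans ?_
  refine mul_le_mul_of_nonneg_left ?_ wtMass_nonneg
  refine integral_mono (integrable_wt_mul (integrable_norm_sq f)) (integrable_norm_sq f) fun t => ?_
  exact mul_le_of_le_one_left (sq_nonneg _) (wt_le_one _)

theorem ip_pos_left (i : Fin d) (f g : 𝓢(E d, ℂ)) : ip (pos i f) g = ip f (pos i g) := by
  rw [ip_eq_integral, ip_eq_integral]
  refine integral_congr_ae (Eventually.of_forall fun t => ?_)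
  simp only [pos_apply, map_mul, Complex.conj_ofReal]
  ring

theorem ip_sub_left (f g h : 𝓢(E d, ℂ)) : ip (f - g) h = ip f h - ip g h := by
  have : (f - g).toLp 2 (volume : Measure (E d)) = f.toLp 2 volume - g.toLp 2 volume :=
    map_sub (SchwartzMap.toLpCLM ℂ ℂ 2 (volume : Measure (E d))) f g
  rw [ip, this, inner_sub_left]; rfl

theorem ip_smul_left (c : ℂ) (f h : 𝓢(E d, ℂ)) : ip (c • f) h = (starRingEnd ℂ) c * ip f h := by
  have : (c • f).toLp 2 (volume : Measure (E d)) = c • f.toLp 2 volume :=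
    map_smul (SchwartzMap.toLpCLM ℂ ℂ 2 (volume : Measure (E d))) c f
  rw [ip, this, inner_smul_left]; rfl

theorem conj_ip (f g : 𝓢(E d, ℂ)) : (starRingEnd ℂ) (ip f g) = ip g f := inner_conj_symm _ _

theorem ip_self (f : 𝓢(E d, ℂ)) : ip f f = ((nrm f ^ 2 : ℝ) : ℂ) := by
  rw [ip, inner_self_eq_norm_sq_to_K, nrm]; simp

theorem hasSum_ip {ι : Type*} {g : ι → 𝓢(E d, ℂ)} {G : 𝓢(E d, ℂ)} (h : HasSum g G)
    (f : 𝓢(E d, ℂ)) : HasSum (fun z => ip f (g z)) (ip f G) :=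
  (h.mapL (SchwartzMap.toLpCLM ℂ ℂ 2 (volume : Measure (E d)))).mapL
    (innerSL ℂ (f.toLp 2 (volume : Measure (E d))))

theorem pos_iterate_sub (i : Fin d) (m : ℕ) (f g : 𝓢(E d, ℂ)) :
    (pos i)^[m] (f - g) = (pos i)^[m] f - (pos i)^[m] g := by
  ext t; simp [pos_iterate_apply]

theorem pos_iterate_add (i : Fin d) (m : ℕ) (f g : 𝓢(E d, ℂ)) :
    (pos i)^[m] (f + g) = (pos i)^[m] f + (pos i)^[m] g := by
  ext t; simp [pos_iterate_apply]

theorem pos_iterate_smul (i : Fin d) (m : ℕ) (c : ℂ) (f : 𝓢(E d, ℂ)) :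
    (pos i)^[m] (c • f) = c • (pos i)^[m] f := by
  ext t; simp [pos_iterate_apply]; ring

/-! ### Polynomial weights and coordinate moments -/

theorem integrable_pow_mul_norm (n : ℕ) (f : 𝓢(E d, ℂ)) :
    Integrable fun t => (1 + ‖t‖) ^ n * ‖f t‖ := by
  have e : (fun t => (1 + ‖t‖) ^ n * ‖f t‖) = fun t => ∑ k ∈ Finset.range (n + 1),
      (n.choose k : ℝ) * (‖t‖ ^ k * ‖f t‖) := by
    funext t
    rw [add_comm, add_pow, Finset.sum_mul]
    exact Finset.sum_congr rfl fun k _ => by rw [one_pow]; ring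
  rw [e]
  exact integrable_finsetSum _ fun k _ => (f.integrable_pow_mul volume k).const_mul _

/-- The largest coordinate satisfies ‖t‖ ≤ d |t_i|; positive dimension guarantees that there is one.
-/
theorem one_add_norm_pow_le (hd : 0 < d) (M : ℕ) (t : E d) :
    (1 + ‖t‖) ^ M ≤ (1 + d : ℝ) ^ M * ∑ i : Fin d, (1 + |t i| ^ M) := by
  obtain ⟨i, -, hi⟩ := Finset.exists_max_image (Finset.univ : Finset (Fin d)) (fun i => |t i|)
    ⟨⟨0, hd⟩, Finset.mem_univ _⟩
  have h1 : ‖t‖ ≤ d * |t i| := by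
    have h2 : ‖t‖ ^ 2 ≤ (d * |t i|) ^ 2 := by
      rw [EuclideanSpace.norm_sq_eq]
      calc ∑ j, ‖t j‖ ^ 2 ≤ ∑ _j : Fin d, |t i| ^ 2 := by
            refine Finset.sum_le_sum fun j hj => ?_
            rw [Real.norm_eq_abs]
            exact pow_le_pow_left₀ (abs_nonneg _) (hi j hj) 2
        _ = d * |t i| ^ 2 := by simp
        _ ≤ (d * |t i|) ^ 2 := by
            rw [mul_pow]
            refine mul_le_mul_of_nonneg_right ?_ (by positivity)
            have : (1 : ℝ) ≤ d := by exact_mod_cast hd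
            nlinarith
    exact le_of_sq_le_sq h2 (by positivity)
  have h3 : 1 + ‖t‖ ≤ (1 + d) * max 1 |t i| := by
    have := le_max_left 1 |t i|
    have := le_max_right 1 |t i|
    have : (0 : ℝ) ≤ d := by positivity
    nlinarith
  calc (1 + ‖t‖) ^ M ≤ ((1 + d) * max 1 |t i|) ^ M := by gcongr
    _ = (1 + d : ℝ) ^ M * (max 1 |t i|) ^ M := mul_pow _ _ _
    _ ≤ (1 + d : ℝ) ^ M * (1 + |t i| ^ M) := by
        gcongr
        rcases max_choice 1 |t i| with h | h <;> rw [h]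
        · rw [one_pow]; linarith [pow_nonneg (abs_nonneg (t i)) M]
        · linarith
    _ ≤ _ := by
        gcongr
        exact Finset.single_le_sum (f := fun j => 1 + |t j| ^ M)
          (fun j _ => by positivity) (Finset.mem_univ i)

/-- The weighted norm `∑ κ^m ‖t_i^m f‖₂` over the coordinates `i` and the powers `m ≤ M`. -/
noncomputable def wnrm (κ : ℝ) (M : ℕ) (f : 𝓢(E d, ℂ)) : ℝ :=
  ∑ i : Fin d, ∑ m ∈ Finset.range (M + 1), κ ^ m * nrm ((pos i)^[m] f)

/-- The d + 1 extra moments pay for the integrable weight `wt`, and Cauchy–Schwarz against it passes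
from L¹ to L². Only the moments 0 and M enter, so undoing the damping in `wnrm` costs κ^{-M}. -/
theorem integral_one_add_norm_pow_mul_le (hd : 0 < d) (n M : ℕ) (hM : M = n + (d + 1))
    {κ : ℝ} (hκ : 0 < κ) (hκ1 : κ ≤ 1) (f : 𝓢(E d, ℂ)) :
    ∫ t, (1 + ‖t‖) ^ n * ‖f t‖ ≤
      (1 + d : ℝ) ^ M * √(wtMass d) * 2 * (κ ^ M)⁻¹ * wnrm κ M f := by
  have hI : ∀ (i : Fin d) (m : ℕ),
      Integrable fun t : E d => wt (t - 0) * ‖((pos i)^[m] f) t‖ :=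
    fun i m => integrable_wt_mul ((pos i)^[m] f).integrable.norm
  have hpt : ∀ t : E d, (1 + ‖t‖) ^ n * ‖f t‖ ≤ (1 + d : ℝ) ^ M * ∑ i : Fin d,
      (wt (t - 0) * ‖((pos i)^[0] f) t‖ + wt (t - 0) * ‖((pos i)^[M] f) t‖) := by
    intro t
    have e : (1 + ‖t‖) ^ n = (1 + ‖t‖) ^ M * wt (t - 0) := by
      rw [sub_zero, wt, hM, pow_add, mul_inv_cancel_right₀ (by positivity)]
    rw [e]
    calc (1 + ‖t‖) ^ M * wt (t - 0) * ‖f t‖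
        ≤ ((1 + d : ℝ) ^ M * ∑ i : Fin d, (1 + |t i| ^ M)) * wt (t - 0) * ‖f t‖ := by
          have := (wt_pos (t - 0)).le
          gcongr
          exact one_add_norm_pow_le hd M t
      _ = _ := by
          rw [mul_assoc, mul_assoc, Finset.sum_mul]
          congr 1
          refine Finset.sum_congr rfl fun i _ => ?_
          rw [pos_iterate_apply, pos_iterate_apply]
          simp only [pow_zero, one_mul, norm_mul, norm_pow, Complex.norm_real, Real.norm_eq_abs]
          ring
  have hκM : 1 ≤ (κ ^ M)⁻¹ := (one_le_inv₀ (by positivity)).2 (pow_le_one₀ hκ.le hκ1)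
  calc ∫ t, (1 + ‖t‖) ^ n * ‖f t‖
      ≤ ∫ t, (1 + d : ℝ) ^ M * ∑ i : Fin d,
        (wt (t - 0) * ‖((pos i)^[0] f) t‖ + wt (t - 0) * ‖((pos i)^[M] f) t‖) := by
        refine integral_mono (integrable_pow_mul_norm n f) ?_ hpt
        exact (integrable_finsetSum _ fun i _ => (hI i 0).add (hI i M)).const_mul _
    _ = (1 + d : ℝ) ^ M * ∑ i : Fin d, ((∫ t, wt (t - 0) * ‖((pos i)^[0] f) t‖)
        + ∫ t, wt (t - 0) * ‖((pos i)^[M] f) t‖) := by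
        have h0M : ∀ i ∈ (Finset.univ : Finset (Fin d)), Integrable fun t : E d =>
            wt (t - 0) * ‖((pos i)^[0] f) t‖ + wt (t - 0) * ‖((pos i)^[M] f) t‖ :=
          fun i _ => (hI i 0).add (hI i M)
        rw [integral_const_mul, integral_finsetSum _ h0M]
        congr 1
        exact Finset.sum_congr rfl fun i _ => integral_add (hI i 0) (hI i M)
    _ ≤ (1 + d : ℝ) ^ M * ∑ i : Fin d, (√(wtMass d) * 2 * (κ ^ M)⁻¹ *
        ∑ m ∈ Finset.range (M + 1), κ ^ m * nrm ((pos i)^[m] f)) := by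
        gcongr with i _
        have h0 : κ ^ 0 * nrm ((pos i)^[0] f) ≤
            ∑ m ∈ Finset.range (M + 1), κ ^ m * nrm ((pos i)^[m] f) :=
          Finset.single_le_sum (f := fun m => κ ^ m * nrm ((pos i)^[m] f))
            (fun m _ => mul_nonneg (by positivity) (nrm_nonneg _)) (by simp)
        have h1 : κ ^ M * nrm ((pos i)^[M] f) ≤
            ∑ m ∈ Finset.range (M + 1), κ ^ m * nrm ((pos i)^[m] f) :=
          Finset.single_le_sum (f := fun m => κ ^ m * nrm ((pos i)^[m] f))
            (fun m _ => mul_nonneg (by positivity) (nrm_nonneg _)) (by simp)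
        set T := ∑ m ∈ Finset.range (M + 1), κ ^ m * nrm ((pos i)^[m] f)
        have hT : 0 ≤ T := (mul_nonneg (by positivity) (nrm_nonneg _)).trans h0
        have h0' : nrm ((pos i)^[0] f) ≤ (κ ^ M)⁻¹ * T := by
          rw [pow_zero, one_mul] at h0
          exact h0.trans (le_mul_of_one_le_left hT hκM)
        have h1' : nrm ((pos i)^[M] f) ≤ (κ ^ M)⁻¹ * T := by
          rw [inv_mul_eq_div, le_div_iff₀ (by positivity), mul_comm]; exact h1
        have hs := Real.sqrt_nonneg (wtMass d)
        calc _ ≤ √(wtMass d) * nrm ((pos i)^[0] f) + √(wtMass d) * nrm ((pos i)^[M] f) :=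
              add_le_add (integral_wt_mul_le _ _) (integral_wt_mul_le _ _)
          _ ≤ √(wtMass d) * ((κ ^ M)⁻¹ * T) + √(wtMass d) * ((κ ^ M)⁻¹ * T) := by gcongr
          _ = _ := by ring
    _ = _ := by rw [← Finset.mul_sum, wnrm]; ring

/-! ## Localized families of Schwartz functions -/

variable {ι : Type*}

/-- The centres `x` are sparse: weighted counts of centres are at most `P`. -/
def Sparse (x : ι → E d) (P : ℝ) : Prop := ∀ (t : E d) (s : Finset ι), ∑ z ∈ s, wt (t - x z) ≤ P

/-- The functions `θ z` decay around the centres `x z` to the order `m`. -/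
def LocBound (x : ι → E d) (m : ℕ) (Q : ℝ) (θ : ι → 𝓢(E d, ℂ)) : Prop :=
  ∀ z t, ‖θ z t‖ * (1 + ‖t - x z‖) ^ m ≤ Q

/-- Uniformly localized families with spectra in a common ball. -/
structure LocalizedFamily (x : ι → E d) (ρ : ℝ) (θ : ι → 𝓢(E d, ℂ)) : Prop where
  loc : ∀ m, ∃ Q, LocBound x m Q θ
  band : ∀ z, Band 0 ρ (θ z)

theorem LocBound.mono {x : ι → E d} {m n : ℕ} {Q : ℝ} {θ : ι → 𝓢(E d, ℂ)}
    (h : LocBound x n Q θ) (hmn : m ≤ n) : LocBound x m Q θ := fun z t =>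
  (mul_le_mul_of_nonneg_left (pow_le_pow_right₀ (by linarith [norm_nonneg (t - x z)]) hmn)
    (norm_nonneg _)).trans (h z t)

/-- Of the available orders of decay, d + 1 are converted into the integrable weight `wt`. -/
theorem LocBound.norm_le {x : ι → E d} {n : ℕ} {Q : ℝ} {θ : ι → 𝓢(E d, ℂ)}
    (h : LocBound x (n + (d + 1)) Q θ) (z : ι) (t : E d) :
    (1 + ‖t - x z‖) ^ n * ‖θ z t‖ ≤ Q * wt (t - x z) := by
  rw [wt, ← div_eq_mul_inv, le_div_iff₀ (by positivity)]
  refine le_trans (le_of_eq ?_) (h z t)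
  rw [pow_add]; ring

theorem LocBound.norm_le' {x : ι → E d} {Q : ℝ} {θ : ι → 𝓢(E d, ℂ)}
    (h : LocBound x (d + 1) Q θ) (z : ι) (t : E d) : ‖θ z t‖ ≤ Q * wt (t - x z) := by
  have h' : LocBound x (0 + (d + 1)) Q θ := by rwa [zero_add]
  simpa using h'.norm_le z t

theorem norm_ip_le_integral (f g : 𝓢(E d, ℂ)) : ‖ip f g‖ ≤ ∫ t, ‖f t‖ * ‖g t‖ := by
  rw [ip_eq_integral]
  refine (norm_integral_le_integral_norm _).trans (le_of_eq ?_)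
  simp

theorem LocBound.norm_ip_le {x : ι → E d} {Q : ℝ} {θ : ι → 𝓢(E d, ℂ)}
    (h : LocBound x (d + 1) Q θ) (z : ι) (f : 𝓢(E d, ℂ)) :
    ‖ip (θ z) f‖ ≤ Q * ∫ t, wt (t - x z) * ‖f t‖ := by
  refine (norm_ip_le_integral _ _).trans ?_
  rw [← integral_const_mul]
  refine integral_mono_of_nonneg (Eventually.of_forall fun t => by positivity)
    ((integrable_wt_mul f.integrable.norm).const_mul _) (Eventually.of_forall fun t => ?_)
  change ‖θ z t‖ * ‖f t‖ ≤ Q * (wt (t - x z) * ‖f t‖)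
  rw [← mul_assoc]
  exact mul_le_mul_of_nonneg_right (h.norm_le' z t) (norm_nonneg _)

theorem Sparse.nonneg {x : ι → E d} {P : ℝ} (h : Sparse x P) : 0 ≤ P := by
  simpa using h 0 ∅

theorem Sparse.sum_integral_le {x : ι → E d} {P : ℝ} (hP : Sparse x P) (s : Finset ι)
    {g : E d → ℝ} (hg : Integrable g) (hg0 : ∀ t, 0 ≤ g t) :
    ∑ z ∈ s, ∫ t, wt (t - x z) * g t ≤ P * ∫ t, g t := by
  rw [← integral_finsetSum _ fun z _ => integrable_wt_mul hg, ← integral_const_mul]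
  refine integral_mono (integrable_finsetSum _ fun z _ => integrable_wt_mul hg)
    (hg.const_mul _) fun t => ?_
  change ∑ z ∈ s, wt (t - x z) * g t ≤ P * g t
  rw [← Finset.sum_mul]
  exact mul_le_mul_of_nonneg_right (hP t s) (hg0 t)

/-- A Bessel inequality from localization and sparsity alone: Cauchy–Schwarz against `wt`, then
summation over the centres under the integral. Since no frame property enters, it also serves the
shifted families produced by commutators. -/
theorem sum_norm_ip_sq_le {x : ι → E d} {P Q : ℝ} {θ : ι → 𝓢(E d, ℂ)} (hP : Sparse x P)
    (h : LocBound x (d + 1) Q θ) (s : Finset ι) (f : 𝓢(E d, ℂ)) :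
    ∑ z ∈ s, ‖ip (θ z) f‖ ^ 2 ≤ Q ^ 2 * wtMass d * P * nrm f ^ 2 := by
  calc ∑ z ∈ s, ‖ip (θ z) f‖ ^ 2
      ≤ ∑ z ∈ s, Q ^ 2 * wtMass d * ∫ t, wt (t - x z) * ‖f t‖ ^ 2 := by
        refine Finset.sum_le_sum fun z _ => ?_
        calc ‖ip (θ z) f‖ ^ 2 ≤ (Q * ∫ t, wt (t - x z) * ‖f t‖) ^ 2 := by
              gcongr; exact h.norm_ip_le z f
          _ ≤ Q ^ 2 * (wtMass d * ∫ t, wt (t - x z) * ‖f t‖ ^ 2) := by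
              rw [mul_pow]; gcongr; exact sq_integral_wt_mul_le _ _
          _ = _ := by ring
    _ ≤ Q ^ 2 * wtMass d * (P * ∫ t, ‖f t‖ ^ 2) := by
        rw [← Finset.mul_sum]
        have := wtMass_nonneg (d := d)
        gcongr
        exact hP.sum_integral_le s (integrable_norm_sq f) fun t => sq_nonneg _
    _ = _ := by rw [nrm_sq_eq_integral]; ring

/-- The inequality 1 + |x_z| ≤ (1 + |t - x_z|)(1 + |t|) moves the weight from the nodes to f, at the
cost of n orders of decay of `θ z`. -/
theorem sum_norm_ip_mul_le {x : ι → E d} {P Q : ℝ} {θ : ι → 𝓢(E d, ℂ)} (hP : Sparse x P) {n : ℕ}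
    (hQ : 0 ≤ Q) (h : LocBound x (n + (d + 1)) Q θ) (s : Finset ι) (f : 𝓢(E d, ℂ)) :
    ∑ z ∈ s, ‖ip (θ z) f‖ * (1 + ‖x z‖) ^ n ≤ Q * P * ∫ t, (1 + ‖t‖) ^ n * ‖f t‖ := by
  calc ∑ z ∈ s, ‖ip (θ z) f‖ * (1 + ‖x z‖) ^ n
      ≤ ∑ z ∈ s, Q * ∫ t, wt (t - x z) * ((1 + ‖t‖) ^ n * ‖f t‖) := by
        refine Finset.sum_le_sum fun z _ => ?_
        refine (mul_le_mul_of_nonneg_right (norm_ip_le_integral (θ z) f) (by positivity)).trans ?_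
        rw [← integral_mul_const, ← integral_const_mul]
        refine integral_mono_of_nonneg (Eventually.of_forall fun t => by positivity)
          ((integrable_wt_mul (integrable_pow_mul_norm n f)).const_mul _)
          (Eventually.of_forall fun t => ?_)
        change ‖θ z t‖ * ‖f t‖ * (1 + ‖x z‖) ^ n ≤
          Q * (wt (t - x z) * ((1 + ‖t‖) ^ n * ‖f t‖))
        have h1 : 1 + ‖x z‖ ≤ (1 + ‖t - x z‖) * (1 + ‖t‖) := by
          have : ‖x z‖ ≤ ‖t - x z‖ + ‖t‖ := by
            calc ‖x z‖ = ‖t - (t - x z)‖ := by congr 1; abel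
              _ ≤ _ := by rw [add_comm]; exact norm_sub_le _ _
          nlinarith [norm_nonneg (t - x z), norm_nonneg t]
        calc ‖θ z t‖ * ‖f t‖ * (1 + ‖x z‖) ^ n
            ≤ ‖θ z t‖ * ‖f t‖ * ((1 + ‖t - x z‖) * (1 + ‖t‖)) ^ n := by gcongr
          _ = ((1 + ‖t - x z‖) ^ n * ‖θ z t‖) * ((1 + ‖t‖) ^ n * ‖f t‖) := by
              rw [mul_pow]; ring
          _ ≤ (Q * wt (t - x z)) * ((1 + ‖t‖) ^ n * ‖f t‖) := by
              exact mul_le_mul_of_nonneg_right (h.norm_le z t) (by positivity)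
          _ = _ := by ring
    _ ≤ Q * (P * ∫ t, (1 + ‖t‖) ^ n * ‖f t‖) := by
        rw [← Finset.mul_sum]
        gcongr
        exact hP.sum_integral_le s (integrable_pow_mul_norm n f) fun t => by positivity
    _ = _ := by ring

/-! ## Schwartz seminorms of the Fourier transform of band-limited functions -/

/-- Powers of ζ are bounded by ρ^k on the spectrum, and derivatives of the transform are moments of
f. Hence seminorms of 𝓕 f reduce to one weighted L¹ norm, with polynomial loss in ρ. -/
theorem Band.seminorm_fourier_le {ρ : ℝ} (hρ : 0 ≤ ρ) {f : 𝓢(E d, ℂ)} (hf : Band 0 ρ f) (k n : ℕ) :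
    SchwartzMap.seminorm ℝ k n (𝓕 f) ≤
      ρ ^ k * ((2 * Real.pi) ^ n * ((n + 1 : ℕ) * ∫ t, (1 + ‖t‖) ^ n * ‖f t‖)) := by
  have hint : 0 ≤ ∫ t, (1 + ‖t‖) ^ n * ‖f t‖ := integral_nonneg fun t => by positivity
  have hpi := Real.pi_pos
  refine SchwartzMap.seminorm_le_bound ℝ k n _ (by positivity) fun ζ => ?_
  by_cases hζ : iteratedFDeriv ℝ n (𝓕 f : 𝓢(E d, ℂ)) ζ = 0
  · rw [hζ, norm_zero, mul_zero]; positivity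
  have h1 : ‖ζ‖ ≤ ρ := by
    have h2 : ζ ∈ {ζ : E d | ‖(2 * Real.pi) • ζ - 0‖ ≤ ρ} :=
      hf.tsupport_subset (support_iteratedFDeriv_subset n hζ)
    rw [Set.mem_ofPred_eq, sub_zero, norm_smul, Real.norm_of_nonneg (by positivity)] at h2
    have : (1 : ℝ) ≤ 2 * Real.pi := by linarith [Real.pi_gt_three]
    nlinarith [norm_nonneg ζ]
  gcongr
  rw [SchwartzMap.fourier_coe]
  have h3 := Real.pow_mul_norm_iteratedFDeriv_fourier_le (f := (f : E d → ℂ)) (K := ⊤) (N := ⊤)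
    (f.smooth _) (fun k n _ _ => f.integrable_pow_mul_iteratedFDeriv volume k n)
    (k := n) (n := 0) le_top le_top ζ
  rw [pow_zero, one_mul, pow_zero, mul_one] at h3
  refine h3.trans ?_
  gcongr
  rw [zero_add, Finset.range_one, Finset.sum_product]
  calc ∑ x ∈ Finset.range (n + 1), ∑ y ∈ {0}, ∫ v, ‖v‖ ^ x * ‖iteratedFDeriv ℝ y f v‖
      ≤ ∑ x ∈ Finset.range (n + 1), ∫ t, (1 + ‖t‖) ^ n * ‖f t‖ := by
        refine Finset.sum_le_sum fun x hx => ?_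
        rw [Finset.sum_singleton]
        simp only [norm_iteratedFDeriv_zero]
        refine integral_mono (f.integrable_pow_mul volume x) (integrable_pow_mul_norm n f)
          fun t => ?_
        change ‖t‖ ^ x * ‖f t‖ ≤ (1 + ‖t‖) ^ n * ‖f t‖
        gcongr
        have hx' : x ≤ n := Nat.lt_succ_iff.1 (Finset.mem_range.1 hx)
        calc ‖t‖ ^ x ≤ (1 + ‖t‖) ^ x := by gcongr; linarith
          _ ≤ _ := pow_le_pow_right₀ (by linarith [norm_nonneg t]) hx'
    _ = _ := by simp

theorem LocalizedFamily.exists_bound {x : ι → E d} {ρ : ℝ} {θ : ι → 𝓢(E d, ℂ)}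
    (h : LocalizedFamily x ρ θ) (m : ℕ) : ∃ Q, 0 ≤ Q ∧ LocBound x m Q θ := by
  obtain ⟨Q, hQ⟩ := h.loc m
  exact ⟨max Q 0, le_max_right _ _, fun z t => (hQ z t).trans (le_max_left _ _)⟩

theorem seminorm_smul (k n : ℕ) (c : ℂ) (f : 𝓢(E d, ℂ)) :
    SchwartzMap.seminorm ℝ k n (c • f) = ‖c‖ * SchwartzMap.seminorm ℝ k n f :=
  map_smul_eq_mul (SchwartzMap.seminorm ℂ k n) c f

/-! ## Frame-type operators -/

/-- The operator `f ↦ ∑ ⟨θ_z, f⟩ θ'_z`. -/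
noncomputable def frameOp (θ θ' : ι → 𝓢(E d, ℂ)) (f : 𝓢(E d, ℂ)) : 𝓢(E d, ℂ) :=
  ∑' z, ip (θ z) f • θ' z

theorem LocBound.integral_le {x : ι → E d} {n : ℕ} {Q : ℝ} {θ : ι → 𝓢(E d, ℂ)}
    (h : LocBound x (n + (d + 1)) Q θ) (z : ι) :
    ∫ t, (1 + ‖t‖) ^ n * ‖θ z t‖ ≤ (1 + ‖x z‖) ^ n * (Q * wtMass d) := by
  rw [← integral_wt_sub (x z), ← integral_const_mul, ← integral_const_mul]
  refine integral_mono (integrable_pow_mul_norm n _)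
    (((integrable_wt.comp_sub_right (x z)).const_mul _).const_mul _) fun t => ?_
  change (1 + ‖t‖) ^ n * ‖θ z t‖ ≤ (1 + ‖x z‖) ^ n * (Q * wt (t - x z))
  have h1 : 1 + ‖t‖ ≤ (1 + ‖x z‖) * (1 + ‖t - x z‖) := by
    have : ‖t‖ ≤ ‖t - x z‖ + ‖x z‖ := by simpa using norm_add_le (t - x z) (x z)
    nlinarith [norm_nonneg (t - x z), norm_nonneg (x z)]
  calc (1 + ‖t‖) ^ n * ‖θ z t‖ ≤ ((1 + ‖x z‖) * (1 + ‖t - x z‖)) ^ n * ‖θ z t‖ := by gcongr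
    _ = (1 + ‖x z‖) ^ n * ((1 + ‖t - x z‖) ^ n * ‖θ z t‖) := by rw [mul_pow]; ring
    _ ≤ _ := mul_le_mul_of_nonneg_left (h.norm_le z t) (by positivity)

/-- Convergence is proved on the Fourier side, where the common band reduces seminorms to weighted
L¹ norms. These grow like (1 + |x_z|)^n, which the decay of the coefficients `ip (θ z) f` absorbs.
-/
theorem hasSum_frameOp {x : ι → E d} {P ρ ρ' : ℝ} (hρ' : 0 ≤ ρ') (hP : Sparse x P)
    {θ θ' : ι → 𝓢(E d, ℂ)}
    (hθ : LocalizedFamily x ρ θ) (hθ' : LocalizedFamily x ρ' θ') (f : 𝓢(E d, ℂ)) :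
    HasSum (fun z => ip (θ z) f • θ' z) (frameOp θ θ' f) := by
  refine Summable.hasSum ?_
  have key : Summable fun z => 𝓕 (ip (θ z) f • θ' z) := by
    refine summable_schwartz _ fun k n => ?_
    obtain ⟨Q, hQ0, hQ⟩ := hθ.exists_bound (n + (d + 1))
    obtain ⟨Q', hQ0', hQ'⟩ := hθ'.exists_bound (n + (d + 1))
    have hs : Summable fun z => ‖ip (θ z) f‖ * (1 + ‖x z‖) ^ n :=
      summable_of_sum_le (fun z => by positivity) fun s => sum_norm_ip_mul_le hP hQ0 hQ s f
    refine Summable.of_nonneg_of_le (fun z => apply_nonneg _ _) (fun z => ?_)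
      (hs.mul_left (ρ' ^ k * ((2 * Real.pi) ^ n * ((n + 1 : ℕ) * (Q' * wtMass d)))))
    rw [fourier_smul', seminorm_smul]
    have hpi := Real.pi_pos
    calc ‖ip (θ z) f‖ * SchwartzMap.seminorm ℝ k n (𝓕 (θ' z))
        ≤ ‖ip (θ z) f‖ * (ρ' ^ k * ((2 * Real.pi) ^ n * ((n + 1 : ℕ) *
            ((1 + ‖x z‖) ^ n * (Q' * wtMass d))))) := by
          gcongr
          refine ((hθ'.band z).seminorm_fourier_le hρ' k n).trans ?_
          gcongr
          exact hQ'.integral_le z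
      _ = _ := by ring
  have h2 := key.mapL (FourierTransform.fourierInvCLM ℂ 𝓢(E d, ℂ) : 𝓢(E d, ℂ) →L[ℂ] 𝓢(E d, ℂ))
  simpa [FourierTransform.fourierInvCLM_apply] using h2

theorem norm_sum_mul_le_of_sq {ι : Type*} {a b : ι → ℂ} {A B c : ℝ} {C : ℂ}
    (hA : ∀ s : Finset ι, ∑ z ∈ s, ‖a z‖ ^ 2 ≤ A ^ 2) (hB : ∀ s : Finset ι, ∑ z ∈ s, ‖b z‖ ^ 2 ≤ B ^ 2)
    (hA0 : 0 ≤ A) (hB0 : 0 ≤ B) (h : HasSum (fun z => a z * b z) C) (hc : A * B = c) :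
    ‖C‖ ≤ c := by
  refine le_of_tendsto h.norm (Eventually.of_forall fun s => ?_)
  refine (norm_sum_le _ _).trans ?_
  simp only [norm_mul]
  refine (Real.sum_mul_le_sqrt_mul_sqrt s _ _).trans ?_
  rw [← hc]
  exact mul_le_mul (Real.sqrt_le_iff.2 ⟨hA0, hA s⟩) (Real.sqrt_le_iff.2 ⟨hB0, hB s⟩)
    (Real.sqrt_nonneg _) hA0

theorem ip_smul_right (c : ℂ) (f g : 𝓢(E d, ℂ)) : ip f (c • g) = c * ip f g := by
  rw [← conj_ip, ip_smul_left, map_mul, Complex.conj_conj, conj_ip]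

theorem nrm_zero : nrm (0 : 𝓢(E d, ℂ)) = 0 := by
  rw [nrm_eq_norm_toLpCLM, map_zero, norm_zero]

/-- Pairing the series with its own sum h gives ‖h‖² ≤ A · B‖h‖, so an analysis bound yields a
synthesis bound. -/
theorem nrm_le_of_hasSum {a : ι → ℂ} {θ : ι → 𝓢(E d, ℂ)} {A B : ℝ} {h : 𝓢(E d, ℂ)}
    (hA : ∀ s : Finset ι, ∑ z ∈ s, ‖a z‖ ^ 2 ≤ A ^ 2)
    (hB : ∀ s : Finset ι, ∑ z ∈ s, ‖ip (θ z) h‖ ^ 2 ≤ (B * nrm h) ^ 2)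
    (hA0 : 0 ≤ A) (hB0 : 0 ≤ B) (hs : HasSum (fun z => a z • θ z) h) : nrm h ≤ A * B := by
  have h1 : HasSum (fun z => a z * ip h (θ z)) (ip h h) := by
    have h0 := hasSum_ip hs h
    simp only [ip_smul_right] at h0
    exact h0
  have h2 : ‖ip h h‖ ≤ A * (B * nrm h) :=
    norm_sum_mul_le_of_sq hA (fun s => by
      refine le_trans (le_of_eq ?_) (hB s)
      refine Finset.sum_congr rfl fun z _ => ?_
      rw [← conj_ip, RCLike.norm_conj]) hA0 (mul_nonneg hB0 (nrm_nonneg _)) h1 rfl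
  rw [ip_self, Complex.norm_real, Real.norm_of_nonneg (sq_nonneg _)] at h2
  rcases (nrm_nonneg h).eq_or_lt with h0 | h0
  · rw [← h0]; positivity
  · nlinarith

theorem nrm_frameOp_le {x : ι → E d} {P ρ ρ' Q : ℝ} (hρ' : 0 ≤ ρ') (hP : Sparse x P)
    {θ θ' : ι → 𝓢(E d, ℂ)} (hθ : LocalizedFamily x ρ θ) (hθ' : LocalizedFamily x ρ' θ')
    (hQ : LocBound x (d + 1) Q θ) (hQ' : LocBound x (d + 1) Q θ') (f : 𝓢(E d, ℂ)) :
    nrm (frameOp θ θ' f) ≤ Q ^ 2 * wtMass d * P * nrm f := by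
  have hw := wtMass_nonneg (d := d)
  have hP0 := hP.nonneg
  have hK : 0 ≤ Q ^ 2 * wtMass d * P := by positivity
  have hb : ∀ {θ : ι → 𝓢(E d, ℂ)}, LocBound x (d + 1) Q θ → ∀ (g : 𝓢(E d, ℂ)) (s : Finset ι),
      ∑ z ∈ s, ‖ip (θ z) g‖ ^ 2 ≤ (√(Q ^ 2 * wtMass d * P) * nrm g) ^ 2 := by
    intro θ hθ g s
    rw [mul_pow, Real.sq_sqrt hK]
    exact sum_norm_ip_sq_le hP hθ s g
  refine (nrm_le_of_hasSum (hb hQ f) (hb hQ' _) (mul_nonneg (Real.sqrt_nonneg _) (nrm_nonneg _))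
    (Real.sqrt_nonneg _) (hasSum_frameOp hρ' hP hθ hθ' f)).trans (le_of_eq ?_)
  calc _ = (√(Q ^ 2 * wtMass d * P) * √(Q ^ 2 * wtMass d * P)) * nrm f := by ring
    _ = _ := by rw [Real.mul_self_sqrt hK]

/-- The family `(t_i - (x_z)_i) θ_z`. -/
noncomputable def shiftPos (x : ι → E d) (i : Fin d) (θ : ι → 𝓢(E d, ℂ)) (z : ι) : 𝓢(E d, ℂ) :=
  pos i (θ z) - ((x z i : ℝ) : ℂ) • θ z

theorem shiftPos_apply (x : ι → E d) (i : Fin d) (θ : ι → 𝓢(E d, ℂ)) (z : ι) (t : E d) :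
    shiftPos x i θ z t = (((t - x z) i : ℝ) : ℂ) * θ z t := by
  simp [shiftPos, pos_apply, sub_mul]

theorem LocBound.shiftPos {x : ι → E d} {m : ℕ} {Q : ℝ} {θ : ι → 𝓢(E d, ℂ)}
    (h : LocBound x (m + 1) Q θ) (i : Fin d) : LocBound x m Q (shiftPos x i θ) := by
  intro z t
  rw [shiftPos_apply, norm_mul, Complex.norm_real]
  refine le_trans ?_ (h z t)
  have h1 : ‖(t - x z) i‖ ≤ 1 + ‖t - x z‖ :=
    (PiLp.norm_apply_le (t - x z) i).trans (by linarith)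
  calc ‖(t - x z) i‖ * ‖θ z t‖ * (1 + ‖t - x z‖) ^ m
      ≤ (1 + ‖t - x z‖) * ‖θ z t‖ * (1 + ‖t - x z‖) ^ m := by gcongr
    _ = _ := by rw [pow_succ]; ring

theorem LocalizedFamily.shiftPos {x : ι → E d} {ρ : ℝ} {θ : ι → 𝓢(E d, ℂ)}
    (h : LocalizedFamily x ρ θ) (i : Fin d) : LocalizedFamily x ρ (shiftPos x i θ) :=
  ⟨fun m => (h.loc (m + 1)).imp fun _ hQ => hQ.shiftPos i,
    fun z => ((h.band z).pos i).sub ((h.band z).smul _)⟩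

/-- Writing t_i = (t - x_z)_i + (x_z)_i on both sides, the real scalars (x_z)_i cancel. The
commutator thus consists of frame-type operators with bounds independent of where the nodes lie;
this is why `frameOp` carries two families. -/
theorem pos_frameOp {x : ι → E d} {P ρ : ℝ} (hρ : 0 ≤ ρ) (hP : Sparse x P)
    {θ θ' : ι → 𝓢(E d, ℂ)} (hθ : LocalizedFamily x ρ θ) (hθ' : LocalizedFamily x ρ θ')
    (i : Fin d) (f : 𝓢(E d, ℂ)) :
    pos i (frameOp θ θ' f) = frameOp θ θ' (pos i f) +
      (frameOp θ (shiftPos x i θ') f - frameOp (shiftPos x i θ) θ' f) := by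
  have h1 := (hasSum_frameOp hρ hP hθ hθ' f).mapL (pos i)
  have h2 := hasSum_frameOp hρ hP hθ hθ' (pos i f)
  have h3 := hasSum_frameOp hρ hP hθ (hθ'.shiftPos i) f
  have h4 := hasSum_frameOp hρ hP (hθ.shiftPos i) hθ' f
  refine h1.unique (Eq.mpr ?_ (h2.add (h3.sub h4)))
  congr 1
  funext z
  rw [map_smul, ← ip_pos_left, Subdyadic.shiftPos, Subdyadic.shiftPos, ip_sub_left, ip_smul_left,
    Complex.conj_ofReal]
  module

/-- Induction on m by `pos_frameOp`. The families are quantified inside because commutators alter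
them, and each commutator uses one order of decay. Only moments l < m appear on the right, which the
κ-weighting exploits later. -/
theorem nrm_pos_iterate_frameOp_sub_le {x : ι → E d} {P ρ Q : ℝ} (hρ : 0 ≤ ρ) (hP : Sparse x P)
    (i : Fin d) (m : ℕ) :
    ∀ (θ θ' : ι → 𝓢(E d, ℂ)), LocalizedFamily x ρ θ → LocalizedFamily x ρ θ' →
      LocBound x (m + (d + 1)) Q θ → LocBound x (m + (d + 1)) Q θ' → ∀ f : 𝓢(E d, ℂ),
      nrm ((pos i)^[m] (frameOp θ θ' f) - frameOp θ θ' ((pos i)^[m] f)) ≤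
        5 ^ m * (Q ^ 2 * wtMass d * P) * ∑ l ∈ Finset.range m, nrm ((pos i)^[l] f) := by
  have hw := wtMass_nonneg (d := d)
  have hP0 := hP.nonneg
  have hn := fun g : 𝓢(E d, ℂ) => nrm_nonneg g
  set K := Q ^ 2 * wtMass d * P with hK
  have hK0 : 0 ≤ K := by positivity
  induction m with
  | zero =>
    intro θ θ' _ _ _ _ f
    simp [nrm_zero]
  | succ m ih =>
    intro θ θ' hθ hθ' hQ hQ' f
    set S₀ := ∑ l ∈ Finset.range m, nrm ((pos i)^[l] f) with hS
    have hQm : m + 1 + (d + 1) = (m + (d + 1)) + 1 := by ring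
    have one : ∀ (η η' : ι → 𝓢(E d, ℂ)), LocalizedFamily x ρ η → LocalizedFamily x ρ η' →
        LocBound x (m + (d + 1)) Q η → LocBound x (m + (d + 1)) Q η' →
        nrm ((pos i)^[m] (frameOp η η' f)) ≤ 5 ^ m * K * S₀ + K * nrm ((pos i)^[m] f) := by
      intro η η' hη hη' hb hb'
      have e : (pos i)^[m] (frameOp η η' f) = ((pos i)^[m] (frameOp η η' f)
        - frameOp η η' ((pos i)^[m] f)) + frameOp η η' ((pos i)^[m] f) := by abel
      rw [e]
      exact (nrm_add_le _ _).trans (add_le_add (ih η η' hη hη' hb hb' f)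
        (nrm_frameOp_le hρ hP hη hη' (hb.mono (by omega)) (hb'.mono (by omega)) _))
    rw [hQm] at hQ hQ'
    have hQ1 : LocBound x (m + (d + 1)) Q θ := hQ.mono (by omega)
    have hQ1' : LocBound x (m + (d + 1)) Q θ' := hQ'.mono (by omega)
    have e1 : (pos i)^[m + 1] (frameOp θ θ' f) - frameOp θ θ' ((pos i)^[m + 1] f) =
        ((pos i)^[m] (frameOp θ θ' (pos i f)) - frameOp θ θ' ((pos i)^[m] (pos i f))) +
        ((pos i)^[m] (frameOp θ (shiftPos x i θ') f)
          - (pos i)^[m] (frameOp (shiftPos x i θ) θ' f)) := by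
      rw [Function.iterate_succ_apply, Function.iterate_succ_apply, pos_frameOp hρ hP hθ hθ',
        pos_iterate_add, pos_iterate_sub]
      abel
    rw [e1]
    have b1 := ih θ θ' hθ hθ' hQ1 hQ1' (pos i f)
    have b2 := one θ (shiftPos x i θ') hθ (hθ'.shiftPos i) hQ1 (hQ'.shiftPos i)
    have b3 := one (shiftPos x i θ) θ' (hθ.shiftPos i) hθ' (hQ.shiftPos i) hQ1'
    have b4 : ∑ l ∈ Finset.range m, nrm ((pos i)^[l] (pos i f)) ≤ S₀ + nrm ((pos i)^[m] f) := by
      rw [hS, ← Finset.sum_range_succ, Finset.sum_range_succ']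
      exact le_add_of_nonneg_right (hn _)
    rw [Finset.sum_range_succ, ← hS]
    -- The recursion multiplies the constant by at most three, one copy from each of `b1`, `b2`,
    -- `b3`; base 5 leaves room.
    have h5 : (1 : ℝ) ≤ 5 ^ m := one_le_pow₀ (by norm_num)
    have hS0 : 0 ≤ S₀ := Finset.sum_nonneg fun _ _ => hn _
    have hX := hn ((pos i)^[m] f)
    have b5 := b1.trans (mul_le_mul_of_nonneg_left b4 (by positivity))
    refine (nrm_add_le _ _).trans ((add_le_add b5
      ((nrm_sub_le _ _).trans (add_le_add b2 b3))).trans ?_)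
    generalize nrm ((pos i)^[m] f) = X at hX
    have h6 : K * X ≤ 5 ^ m * (K * X) := le_mul_of_one_le_left (mul_nonneg hK0 hX) h5
    have h7 : 0 ≤ 5 ^ m * (K * S₀) := by positivity
    have h8 : 0 ≤ 5 ^ m * (K * X) := by positivity
    rw [pow_succ]
    linarith

/-! ## The Richardson iteration of a frame operator -/

theorem nrm_sub_smul_sq (f h : 𝓢(E d, ℂ)) (τ : ℝ) :
    nrm (f - (τ : ℂ) • h) ^ 2 = nrm f ^ 2 - 2 * τ * (ip f h).re + τ ^ 2 * nrm h ^ 2 := by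
  have e : (f - (τ : ℂ) • h).toLp 2 (volume : Measure (E d)) =
      f.toLp 2 volume - (τ : ℂ) • h.toLp 2 volume := by
    have h1 := map_sub (SchwartzMap.toLpCLM ℂ ℂ 2 (volume : Measure (E d))) f ((τ : ℂ) • h)
    rw [map_smul] at h1
    exact h1
  rw [nrm, e, @norm_sub_sq ℂ, inner_smul_right, norm_smul, Complex.norm_real, mul_pow,
    Real.norm_eq_abs, sq_abs]
  have : RCLike.re ((τ : ℂ) * inner ℂ (f.toLp 2 (volume : Measure (E d))) (h.toLp 2 volume)) =
      τ * (ip f h).re := Complex.re_ofReal_mul _ _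
  rw [this, nrm, nrm]
  ring

/-- With σ = ⟨f, Sf⟩ = ∑|⟨θ_z, f⟩|², expanding the square with step 1/B and using ‖Sf‖² ≤ Bσ gives
at most ‖f‖² - σ/B, and σ ≥ A‖f‖². The lower bound is asked only of this f, because packets near ξ
form a frame only for band-limited functions. -/
theorem nrm_sub_smul_frameOp_le {A B : ℝ} (hA : 0 < A) (hAB : A ≤ B) {θ : ι → 𝓢(E d, ℂ)}
    {f : 𝓢(E d, ℂ)} (hup : ∀ (g : 𝓢(E d, ℂ)) (s : Finset ι),
      ∑ z ∈ s, ‖ip (θ z) g‖ ^ 2 ≤ B * nrm g ^ 2)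
    (hlow : A * nrm f ^ 2 ≤ ∑' z, ‖ip (θ z) f‖ ^ 2)
    (hS : HasSum (fun z => ip (θ z) f • θ z) (frameOp θ θ f)) :
    nrm (f - ((B⁻¹ : ℝ) : ℂ) • frameOp θ θ f) ≤ √(1 - A / B) * nrm f := by
  have hB : 0 < B := hA.trans_le hAB
  set h := frameOp θ θ f
  set σ := ∑' z, ‖ip (θ z) f‖ ^ 2
  have hsum : Summable fun z => ‖ip (θ z) f‖ ^ 2 :=
    summable_of_sum_le (fun z => sq_nonneg _) (hup f)
  have hσ0 : 0 ≤ σ := tsum_nonneg fun z => sq_nonneg _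
  have h1 : nrm h ≤ √σ * √B := by
    refine nrm_le_of_hasSum (fun s => ?_) (fun s => ?_) (Real.sqrt_nonneg _) (Real.sqrt_nonneg _) hS
    · rw [Real.sq_sqrt hσ0]
      exact hsum.sum_le_tsum s fun z _ => sq_nonneg _
    · rw [mul_pow, Real.sq_sqrt hB.le]
      exact hup h s
  have h2 : ip f h = (σ : ℂ) := by
    have h3 := hasSum_ip hS f
    have h4 : HasSum (fun z => ((‖ip (θ z) f‖ ^ 2 : ℝ) : ℂ)) (σ : ℂ) :=
      Complex.hasSum_ofReal.2 hsum.hasSum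
    refine h3.unique (Eq.mpr ?_ h4)
    congr 1
    funext z
    rw [ip_smul_right, ← conj_ip (θ z) f, Complex.mul_conj, Complex.normSq_eq_norm_sq]
  have h5 : nrm h ^ 2 ≤ σ * B := by
    calc nrm h ^ 2 ≤ (√σ * √B) ^ 2 := pow_le_pow_left₀ (nrm_nonneg _) h1 2
      _ = _ := by rw [mul_pow, Real.sq_sqrt hσ0, Real.sq_sqrt hB.le]
  have hAB' : 0 ≤ 1 - A / B := by
    rw [sub_nonneg, div_le_one hB]; exact hAB
  apply le_of_sq_le_sq _ (mul_nonneg (Real.sqrt_nonneg _) (nrm_nonneg f))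
  rw [mul_pow, Real.sq_sqrt hAB', nrm_sub_smul_sq, h2, Complex.ofReal_re]
  have h6 : (B⁻¹) ^ 2 * nrm h ^ 2 ≤ B⁻¹ * σ := by
    calc (B⁻¹) ^ 2 * nrm h ^ 2 ≤ (B⁻¹) ^ 2 * (σ * B) := by gcongr
      _ = B⁻¹ * σ := by field_simp
  have h7 : A / B * nrm f ^ 2 ≤ B⁻¹ * σ := by
    rw [div_eq_inv_mul, mul_assoc]
    gcongr
  nlinarith

/-- Moments of f keep its band, so the L² contraction applies to each of them. Commutator terms
contain strictly lower moments and so gain a factor κ; the M + 1 of them together cost at most half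
of the gap 1 - ρ. -/
theorem wnrm_sub_smul_le {S : 𝓢(E d, ℂ) → 𝓢(E d, ℂ)} {ξ : E d} {r τ ρ K κ : ℝ} {M : ℕ}
    (hτ : 0 ≤ τ) (hK : 0 ≤ K) (hκ : 0 < κ) (hκ1 : κ ≤ 1)
    (hsmall : (M + 1) * (τ * K * κ) ≤ (1 - ρ) / 2)
    (hcontr : ∀ f, Band ξ r f → nrm (f - (τ : ℂ) • S f) ≤ ρ * nrm f)
    (hcomm : ∀ (i : Fin d) (m : ℕ), m ≤ M → ∀ f : 𝓢(E d, ℂ),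
      nrm ((pos i)^[m] (S f) - S ((pos i)^[m] f)) ≤
        K * ∑ l ∈ Finset.range m, nrm ((pos i)^[l] f))
    {f : 𝓢(E d, ℂ)} (hf : Band ξ r f) :
    wnrm κ M (f - (τ : ℂ) • S f) ≤ (1 + ρ) / 2 * wnrm κ M f := by
  rw [wnrm, wnrm, Finset.mul_sum]
  refine Finset.sum_le_sum fun i _ => ?_
  set W := ∑ m ∈ Finset.range (M + 1), κ ^ m * nrm ((pos i)^[m] f) with hW
  have hW0 : 0 ≤ W := Finset.sum_nonneg fun m _ => mul_nonneg (by positivity) (nrm_nonneg _)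
  have step : ∀ m ∈ Finset.range (M + 1), κ ^ m * nrm ((pos i)^[m] (f - (τ : ℂ) • S f)) ≤
      ρ * (κ ^ m * nrm ((pos i)^[m] f)) + τ * K * κ * W := by
    intro m hm
    have hm' : m ≤ M := Nat.lt_succ_iff.1 (Finset.mem_range.1 hm)
    have e : (pos i)^[m] (f - (τ : ℂ) • S f) = ((pos i)^[m] f - (τ : ℂ) • S ((pos i)^[m] f)) -
        (τ : ℂ) • ((pos i)^[m] (S f) - S ((pos i)^[m] f)) := by
      rw [pos_iterate_sub, pos_iterate_smul, smul_sub]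
      abel
    have h1 : nrm ((pos i)^[m] (f - (τ : ℂ) • S f)) ≤ ρ * nrm ((pos i)^[m] f) +
        τ * (K * ∑ l ∈ Finset.range m, nrm ((pos i)^[l] f)) := by
      rw [e]
      refine (nrm_sub_le _ _).trans (add_le_add (hcontr _ (hf.pos_iterate i m)) ?_)
      rw [nrm_smul, Complex.norm_real, Real.norm_of_nonneg hτ]
      exact mul_le_mul_of_nonneg_left (hcomm i m hm' f) hτ
    have h2 : κ ^ m * ∑ l ∈ Finset.range m, nrm ((pos i)^[l] f) ≤ κ * W := by
      rw [Finset.mul_sum, hW, Finset.mul_sum]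
      calc ∑ l ∈ Finset.range m, κ ^ m * nrm ((pos i)^[l] f)
          ≤ ∑ l ∈ Finset.range m, κ * (κ ^ l * nrm ((pos i)^[l] f)) := by
            refine Finset.sum_le_sum fun l hl => ?_
            rw [← mul_assoc, ← pow_succ']
            exact mul_le_mul_of_nonneg_right
              (pow_le_pow_of_le_one hκ.le hκ1 (Finset.mem_range.1 hl)) (nrm_nonneg _)
        _ ≤ _ := by
            refine Finset.sum_le_sum_of_subset_of_nonneg ?_ fun l _ _ =>
              mul_nonneg hκ.le (mul_nonneg (by positivity) (nrm_nonneg _))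
            exact Finset.range_subset_range.2 (by omega)
    calc κ ^ m * nrm ((pos i)^[m] (f - (τ : ℂ) • S f))
        ≤ κ ^ m * (ρ * nrm ((pos i)^[m] f) +
          τ * (K * ∑ l ∈ Finset.range m, nrm ((pos i)^[l] f))) := by gcongr
      _ = ρ * (κ ^ m * nrm ((pos i)^[m] f)) +
          τ * K * (κ ^ m * ∑ l ∈ Finset.range m, nrm ((pos i)^[l] f)) := by ring
      _ ≤ ρ * (κ ^ m * nrm ((pos i)^[m] f)) + τ * K * (κ * W) := by gcongr
      _ = _ := by ring
  refine (Finset.sum_le_sum step).trans ?_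
  rw [Finset.sum_add_distrib, ← Finset.mul_sum, ← hW, Finset.sum_const, Finset.card_range,
    nsmul_eq_mul]
  push_cast
  nlinarith

/-- Unrolling f = τ S f + (f - τ S f) n times: each step leaves one term controlled by D, and the
last remainder has contracted by ρ^n. The band grows by w per step, so the iteration must stop
before `r₀`. -/
theorem le_of_richardson {S : 𝓢(E d, ℂ) → 𝓢(E d, ℂ)} {L : 𝓢(E d, ℂ) → ℝ} {ξ : E d}
    {r₀ w τ ρ κ D H : ℝ} {M : ℕ} (hτ : 0 ≤ τ) (hw : 0 ≤ w) (hρ : 0 ≤ ρ) (hρ1 : ρ ≤ 1)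
    (hD : 0 ≤ D) (hκ : 0 < κ)
    (hL : ∀ f, L f ≤ τ * L (S f) + L (f - (τ : ℂ) • S f))
    (hband : ∀ r ≤ r₀, ∀ f, Band ξ r f → Band ξ (r + w) (S f))
    (hcontr : ∀ f, Band ξ r₀ f → wnrm κ M (f - (τ : ℂ) • S f) ≤ ρ * wnrm κ M f)
    (hLS : ∀ f, Band ξ r₀ f → L (S f) ≤ D * wnrm κ M f)
    (hLH : ∀ f, Band ξ r₀ f → L f ≤ H * wnrm κ M f) (hH : 0 ≤ H) (n : ℕ) :
    ∀ (r : ℝ) (f : 𝓢(E d, ℂ)), Band ξ r f → r + n * w ≤ r₀ →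
      L f ≤ (n * (τ * D) + H * ρ ^ n) * wnrm κ M f := by
  have hN : ∀ f : 𝓢(E d, ℂ), 0 ≤ wnrm κ M f := fun f => Finset.sum_nonneg fun i _ =>
    Finset.sum_nonneg fun m _ => mul_nonneg (by positivity) (nrm_nonneg _)
  induction n with
  | zero =>
    intro r f hf hr
    simpa using hLH f (hf.mono (by simpa using hr))
  | succ n ih =>
    intro r f hf hr
    push_cast at hr ⊢
    have hnw : 0 ≤ n * w := by positivity
    have hr0 : r ≤ r₀ := by nlinarith
    have h1 := ih (r + w) (f - (τ : ℂ) • S f)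
      ((hf.mono (by linarith)).sub ((hband r hr0 f hf).smul _)) (by nlinarith)
    have h2 := hcontr f (hf.mono hr0)
    have h3 := hLS f (hf.mono hr0)
    have h4 := hL f
    have h5 := hN f
    have h6 : (n * (τ * D) + H * ρ ^ n) * wnrm κ M (f - (τ : ℂ) • S f) ≤
        (n * (τ * D) + H * ρ ^ n) * (ρ * wnrm κ M f) := by gcongr
    -- Contraction is discarded in these terms: a factor n instead of a geometric sum is harmless,
    -- as n will be polynomial in the frequency.
    have h7 : n * (τ * D) * (ρ * wnrm κ M f) ≤ n * (τ * D) * (1 * wnrm κ M f) := by gcongr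
    have h8 : τ * L (S f) ≤ τ * (D * wnrm κ M f) := by gcongr
    calc L f ≤ τ * (D * wnrm κ M f) + (n * (τ * D) + H * ρ ^ n) * (ρ * wnrm κ M f) := by linarith
      _ ≤ _ := by rw [pow_succ]; linarith

/-! ## Wave packets: spectrum and decay -/

/-- Only the location of the spectrum matters later, so phase and normalisation are hidden in an
unspecified constant. -/
theorem fourier_packet (α : ℝ) (φ : 𝓢(E d, ℂ)) (x ξ : E d) (hξ : ξ ≠ 0) (ζ : E d) :
    ∃ c : ℂ, 𝓕 (packet α φ x ξ) ζ =
      c * 𝓕 φ ((‖ξ‖ ^ (1 - α))⁻¹ • (ζ - (2 * Real.pi)⁻¹ • ξ)) := by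
  set l : ℝ := ‖ξ‖ ^ (1 - α) with hl
  have hl0 : 0 < l := Real.rpow_pos_of_pos (norm_pos_iff.2 hξ) _
  set ζ' := ζ - (2 * Real.pi)⁻¹ • ξ with hζ'
  set a : ℂ := ((‖ξ‖ ^ ((d : ℝ) / 2 * (1 - α)) : ℝ) : ℂ) *
    Complex.exp (((-2 * Real.pi * inner ℝ x ζ' : ℝ) : ℂ) * Complex.I) with ha
  set G : E d → ℂ := fun s => a * (Complex.exp (((-2 * Real.pi * inner ℝ s (l⁻¹ • ζ') : ℝ) : ℂ)
    * Complex.I) • φ s) with hG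
  refine ⟨a * ((|(l ^ d)⁻¹| : ℝ) : ℂ), ?_⟩
  have h1 : 𝓕 (packet α φ x ξ) ζ = ∫ t, G (l • (t - x)) := by
    rw [SchwartzMap.fourier_coe, Real.fourier_eq']
    refine integral_congr_ae (Eventually.of_forall fun t => ?_)
    simp only [hG, smul_eq_mul]
    rw [packet_apply α φ x ξ hξ t, ← hl, ha]
    have hin : (-2 * Real.pi * inner ℝ x ζ' : ℝ) + (-2 * Real.pi * inner ℝ (l • (t - x)) (l⁻¹ • ζ'))
        = -2 * Real.pi * inner ℝ t ζ + inner ℝ t ξ := by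
      have hpi := Real.pi_ne_zero
      have : inner ℝ (l • (t - x)) (l⁻¹ • ζ') = inner ℝ (t - x) ζ' := by
        rw [real_inner_smul_left, real_inner_smul_right, ← mul_assoc, mul_inv_cancel₀ hl0.ne',
          one_mul]
      rw [this, inner_sub_left, hζ', inner_sub_right, inner_sub_right, real_inner_smul_right,
        real_inner_smul_right]
      field_simp
      ring
    have hexp : Complex.exp (((-2 * Real.pi * inner ℝ t ζ : ℝ) : ℂ) * Complex.I) *
        Complex.exp (Complex.I * ((inner ℝ t ξ : ℝ) : ℂ)) =
        Complex.exp (((-2 * Real.pi * inner ℝ x ζ' : ℝ) : ℂ) * Complex.I) *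
        Complex.exp (((-2 * Real.pi * inner ℝ (l • (t - x)) (l⁻¹ • ζ') : ℝ) : ℂ)
          * Complex.I) := by
      rw [← Complex.exp_add, ← Complex.exp_add, ← add_mul, ← Complex.ofReal_add, hin,
        mul_comm Complex.I, ← add_mul, ← Complex.ofReal_add]
    linear_combination ((‖ξ‖ ^ ((d : ℝ) / 2 * (1 - α)) : ℝ) : ℂ) * φ (l • (t - x)) * hexp
  rw [h1, integral_sub_right_eq_self (fun t => G (l • t)) x, Measure.integral_comp_smul,
    finrank_euclideanSpace_fin, hG, integral_const_mul, SchwartzMap.fourier_coe, Real.fourier_eq',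
    Complex.real_smul]
  ring

theorem HasAnnularSpectrum.exists_band {φ : 𝓢(E d, ℂ)} (hφ : HasAnnularSpectrum φ) (α : ℝ) :
    ∃ c : ℝ, 0 < c ∧ ∀ x ξ : E d, ξ ≠ 0 → Band ξ (c * ‖ξ‖ ^ (1 - α)) (packet α φ x ξ) := by
  obtain ⟨c₁, c₂, h1, h2, h⟩ := hφ
  have hpi := Real.pi_pos
  refine ⟨2 * Real.pi * c₂, by have := h1.trans h2; positivity, fun x ξ hξ ζ hζ => ?_⟩
  obtain ⟨c, hc⟩ := fourier_packet α φ x ξ hξ ζ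
  rw [hc] at hζ
  have hl0 : 0 < ‖ξ‖ ^ (1 - α) := Real.rpow_pos_of_pos (norm_pos_iff.2 hξ) _
  have h3 := (h _ (right_ne_zero_of_mul hζ)).2
  rw [norm_smul, norm_inv, Real.norm_of_nonneg hl0.le, inv_mul_le_iff₀ hl0] at h3
  have e : (2 * Real.pi) • ζ - ξ = (2 * Real.pi) • (ζ - (2 * Real.pi)⁻¹ • ξ) := by
    rw [smul_sub, smul_smul, mul_inv_cancel₀ (by positivity), one_smul]
  rw [e, norm_smul, Real.norm_of_nonneg (by positivity)]
  calc 2 * Real.pi * ‖ζ - (2 * Real.pi)⁻¹ • ξ‖ ≤ 2 * Real.pi * (‖ξ‖ ^ (1 - α) * c₂) := by gcongr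
    _ = _ := by ring

theorem exists_schwartz_decay (φ : 𝓢(E d, ℂ)) (m : ℕ) :
    ∃ C, 0 ≤ C ∧ ∀ t, ‖φ t‖ * (1 + ‖t‖) ^ m ≤ C := by
  refine ⟨2 ^ m * ((Finset.Iic (m, 0)).sup fun m => SchwartzMap.seminorm ℝ m.1 m.2) φ,
    mul_nonneg (by positivity) (apply_nonneg _ _), fun t => ?_⟩
  have := SchwartzMap.one_add_le_sup_seminorm_apply (𝕜 := ℝ) (m := (m, 0)) (k := m) (n := 0)
    le_rfl le_rfl φ t
  rw [norm_iteratedFDeriv_zero] at this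
  rw [mul_comm]
  exact this

theorem rpow_le_pow_of_le {a s : ℝ} (ha : 1 ≤ a) {n : ℕ} (hs : s ≤ n) : a ^ s ≤ a ^ n := by
  rw [← Real.rpow_natCast]
  exact Real.rpow_le_rpow_of_exponent_le ha hs

/-- The natural scale |ξ|^{α-1} is replaced by unit scale at the cost of a power of |ξ|. Such losses
are affordable throughout, and rounding exponents up to naturals treats α < 1 and α > 1 together. -/
theorem exists_packet_decay (α : ℝ) (φ : 𝓢(E d, ℂ)) (m : ℕ) :
    ∃ (C : ℝ) (K : ℕ), 0 ≤ C ∧ ∀ x ξ : E d, 1 ≤ ‖ξ‖ → ∀ t,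
      ‖packet α φ x ξ t‖ * (1 + ‖t - x‖) ^ m ≤ C * ‖ξ‖ ^ K := by
  obtain ⟨C, hC0, hC⟩ := exists_schwartz_decay φ m
  obtain ⟨a, ha⟩ := exists_nat_ge ((d : ℝ) / 2 * (1 - α))
  obtain ⟨b, hb⟩ := exists_nat_ge (α - 1)
  refine ⟨C, a + b * m, hC0, fun x ξ hξ t => ?_⟩
  have hξ0 : ξ ≠ 0 := norm_pos_iff.1 (by linarith)
  have hp : 0 < ‖ξ‖ := by linarith
  set l := ‖ξ‖ ^ (1 - α) with hl
  have hl0 : 0 < l := Real.rpow_pos_of_pos hp _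
  have h1 : 1 + ‖t - x‖ ≤ ‖ξ‖ ^ b * (1 + ‖l • (t - x)‖) := by
    rw [norm_smul, Real.norm_of_nonneg hl0.le]
    have h2 : 1 ≤ ‖ξ‖ ^ b * l := by
      have h3 : l⁻¹ ≤ ‖ξ‖ ^ b := by
        rw [hl, ← Real.rpow_neg hp.le]
        exact rpow_le_pow_of_le hξ (by linarith)
      calc 1 = l⁻¹ * l := (inv_mul_cancel₀ hl0.ne').symm
        _ ≤ _ := by gcongr
    have h4 : 1 ≤ ‖ξ‖ ^ b := one_le_pow₀ hξ
    nlinarith [norm_nonneg (t - x)]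
  rw [packet_apply α φ x ξ hξ0 t, norm_mul, norm_mul, Complex.norm_real,
    Real.norm_of_nonneg (by positivity), mul_comm Complex.I, Complex.norm_exp_ofReal_mul_I, mul_one]
  calc ‖ξ‖ ^ ((d : ℝ) / 2 * (1 - α)) * ‖φ (l • (t - x))‖ * (1 + ‖t - x‖) ^ m
      ≤ ‖ξ‖ ^ a * ‖φ (l • (t - x))‖ * (‖ξ‖ ^ b * (1 + ‖l • (t - x)‖)) ^ m := by
        gcongr
        exact rpow_le_pow_of_le hξ ha
    _ = ‖ξ‖ ^ (a + b * m) * (‖φ (l • (t - x))‖ * (1 + ‖l • (t - x)‖) ^ m) := by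
        rw [mul_pow, pow_add, pow_mul]; ring
    _ ≤ ‖ξ‖ ^ (a + b * m) * C := by gcongr; exact hC _
    _ = _ := by ring

/-! ## The lattice points at frequencies comparable to a given one -/

/-- The indices whose frequency centres are comparable to `ξ`. -/
def Near (Ω : Lattice d) (ξ : E d) : Type :=
  {z : (Fin d → ℤ) × ℕ // ‖ξ‖ / 2 ≤ ‖Ω.freq z.2‖ ∧ ‖Ω.freq z.2‖ ≤ 2 * ‖ξ‖}

/-- The two radii of a block have product C², so its phase-space volume does not depend on the
centre; `wt` varies over it by a factor of at most (1 + C')^{d+1}. -/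
theorem setLIntegral_block_ge {C : ℝ} (hC : 0 < C) {α ρ : ℝ} {x ξ : E d} (hξ : ξ ≠ 0) {C' : ℝ}
    (hC' : C * ‖ξ‖ ^ (α - 1) ≤ C') (hρ : ‖ξ‖ + C * ‖ξ‖ ^ (1 - α) ≤ ρ) (t : E d) :
    ENNReal.ofReal (wt (t - x) / (1 + C') ^ (d + 1)) *
        (ENNReal.ofReal (C ^ (2 * d)) * volume (Metric.ball (0 : E d) 1) ^ 2) ≤
      ∫⁻ w in block α C x ξ, ENNReal.ofReal (wt (t - w.1)) *
        (Metric.closedBall (0 : E d) ρ).indicator 1 w.2 := by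
  have hp : 0 < ‖ξ‖ := norm_pos_iff.2 hξ
  have hr1 : 0 < ‖ξ‖ ^ (α - 1) := Real.rpow_pos_of_pos hp _
  have hr2 : 0 < ‖ξ‖ ^ (1 - α) := Real.rpow_pos_of_pos hp _
  have hC'0 : 0 ≤ C' := le_trans (by positivity) hC'
  have hblock : block α C x ξ = Metric.closedBall x (C * ‖ξ‖ ^ (α - 1)) ×ˢ
      Metric.closedBall ξ (C * ‖ξ‖ ^ (1 - α)) := by
    ext w
    simp [block, dist_eq_norm]
  have hvol : volume (block α C x ξ) =
      ENNReal.ofReal (C ^ (2 * d)) * volume (Metric.ball (0 : E d) 1) ^ 2 := by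
    rw [hblock, Measure.volume_eq_prod, Measure.prod_prod,
      Measure.addHaar_closedBall _ _ (by positivity), Measure.addHaar_closedBall _ _ (by positivity),
      finrank_euclideanSpace_fin]
    have : C ^ (2 * d) = (C * ‖ξ‖ ^ (α - 1)) ^ d * (C * ‖ξ‖ ^ (1 - α)) ^ d := by
      rw [← mul_pow, mul_mul_mul_comm, ← Real.rpow_add hp]
      simp [pow_mul, sq]
    rw [this, ENNReal.ofReal_mul (by positivity)]
    ring
  have hmeas : MeasurableSet (block α C x ξ) := by
    rw [hblock]
    exact Metric.isClosed_closedBall.measurableSet.prod Metric.isClosed_closedBall.measurableSet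
  rw [← hvol, ← setLIntegral_const]
  refine setLIntegral_mono' hmeas fun w hw => ?_
  have hw2 : w.2 ∈ Metric.closedBall (0 : E d) ρ := by
    rw [mem_closedBall_zero_iff]
    calc ‖w.2‖ = ‖ξ + (w.2 - ξ)‖ := by congr 1; abel
      _ ≤ _ := (norm_add_le _ _).trans ((add_le_add_right hw.2 _).trans hρ)
  rw [Set.indicator_of_mem hw2, Pi.one_apply, mul_one]
  apply ENNReal.ofReal_le_ofReal
  rw [div_le_iff₀ (by positivity), wt, wt, inv_mul_eq_div, le_div_iff₀ (by positivity),
    inv_mul_le_iff₀ (by positivity), ← mul_pow]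
  gcongr
  have h1 : ‖t - w.1‖ ≤ ‖t - x‖ + ‖w.1 - x‖ := by
    calc ‖t - w.1‖ = ‖(t - x) - (w.1 - x)‖ := by congr 1; abel
      _ ≤ _ := norm_sub_le _ _
  have h2 := hw.1.trans hC'
  nlinarith [norm_nonneg (t - x)]

/-- Volume counting: each centre contributes at least a fixed multiple of its weight to the integral
over its block, and finite overlap bounds the total by N₀ times the integral over phase space with
frequencies in the ball of radius ρ. -/
theorem sum_wt_le {α C : ℝ} (hC : 0 < C) {Ω : Lattice d} {N₀ : ℕ}
    (hov : ∀ w : E d × E d,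
      {z : (Fin d → ℤ) × ℕ | w ∈ block α C (Ω.node z.1 z.2) (Ω.freq z.2)}.encard ≤ N₀)
    {C' ρ : ℝ} (hC'0 : 0 ≤ C') (hρ0 : 0 ≤ ρ) (s : Finset ((Fin d → ℤ) × ℕ))
    (h1 : ∀ z ∈ s, C * ‖Ω.freq z.2‖ ^ (α - 1) ≤ C')
    (h2 : ∀ z ∈ s, ‖Ω.freq z.2‖ + C * ‖Ω.freq z.2‖ ^ (1 - α) ≤ ρ) (t : E d) :
    ∑ z ∈ s, wt (t - Ω.node z.1 z.2) ≤
      (C ^ (2 * d) * volume.real (Metric.ball (0 : E d) 1))⁻¹ *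
        (N₀ * wtMass d * ρ ^ d * (1 + C') ^ (d + 1)) := by
  classical
  set V : ℝ := volume.real (Metric.ball (0 : E d) 1) with hV
  have hVe : volume (Metric.ball (0 : E d) 1) = ENNReal.ofReal V :=
    (ENNReal.ofReal_toReal measure_ball_lt_top.ne).symm
  have hV0 : 0 < V := by
    rw [hV, measureReal_def]
    exact ENNReal.toReal_pos (Metric.measure_ball_pos _ _ one_pos).ne' measure_ball_lt_top.ne
  set F : E d × E d → ℝ≥0∞ := fun w => ENNReal.ofReal (wt (t - w.1)) *
        (Metric.closedBall (0 : E d) ρ).indicator 1 w.2 with hF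
  have hwm : Measurable fun y : E d => ENNReal.ofReal (wt (t - y)) :=
    (continuous_wt.comp (by fun_prop : Continuous fun y : E d => t - y)).measurable.ennreal_ofReal
  have him : Measurable ((Metric.closedBall (0 : E d) ρ).indicator (1 : E d → ℝ≥0∞)) :=
    measurable_one.indicator Metric.isClosed_closedBall.measurableSet
  have hFm : Measurable F := (hwm.comp measurable_fst).mul (him.comp measurable_snd)
  have hFint : ∫⁻ w, F w = ENNReal.ofReal (wtMass d * (ρ ^ d * V)) := by
    rw [hF, Measure.volume_eq_prod, lintegral_prod_mul hwm.aemeasurable him.aemeasurable,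
      lintegral_indicator_one Metric.isClosed_closedBall.measurableSet,
      Measure.addHaar_closedBall _ _ hρ0, finrank_euclideanSpace_fin, hVe,
      ← ENNReal.ofReal_mul (by positivity), ENNReal.ofReal_mul wtMass_nonneg]
    congr 1
    have hi : Integrable fun y : E d => wt (t - y) := integrable_wt.comp_sub_left t
    rw [← ofReal_integral_eq_lintegral_ofReal hi (Eventually.of_forall fun y => (wt_pos _).le)]
    congr 1
    exact integral_sub_left_eq_self (wt : E d → ℝ) volume t
  have hbm : ∀ z : (Fin d → ℤ) × ℕ, MeasurableSet (block α C (Ω.node z.1 z.2) (Ω.freq z.2)) := by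
    intro z
    have c1 : Continuous fun w : E d × E d => ‖w.1 - Ω.node z.1 z.2‖ := by fun_prop
    have c2 : Continuous fun w : E d × E d => ‖w.2 - Ω.freq z.2‖ := by fun_prop
    exact ((isClosed_le c1 continuous_const).inter (isClosed_le c2 continuous_const)).measurableSet
  have hcount : ∀ w, ∑ z ∈ s, (block α C (Ω.node z.1 z.2) (Ω.freq z.2)).indicator F w ≤
      N₀ * F w := by
    intro w
    have : ∑ z ∈ s, (block α C (Ω.node z.1 z.2) (Ω.freq z.2)).indicator F w =
        (s.filter fun z => w ∈ block α C (Ω.node z.1 z.2) (Ω.freq z.2)).card * F w := by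
      rw [← nsmul_eq_mul, ← Finset.sum_const, Finset.sum_filter]
      rfl
    rw [this]
    gcongr
    have h3 : ((s.filter fun z => w ∈ block α C (Ω.node z.1 z.2) (Ω.freq z.2) :
        Finset ((Fin d → ℤ) × ℕ)) : Set ((Fin d → ℤ) × ℕ)).encard ≤ N₀ :=
      (Set.encard_le_encard fun z hz => (Finset.mem_filter.1 hz).2).trans (hov w)
    rw [Set.encard_coe_eq_coe_finsetCard] at h3
    exact_mod_cast h3
  have key : ENNReal.ofReal (∑ z ∈ s, wt (t - Ω.node z.1 z.2) / (1 + C') ^ (d + 1)) *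
      ENNReal.ofReal (C ^ (2 * d) * V ^ 2) ≤ ENNReal.ofReal (N₀ * (wtMass d * (ρ ^ d * V))) := by
    rw [ENNReal.ofReal_sum_of_nonneg fun z _ => div_nonneg (wt_pos _).le (by positivity),
      Finset.sum_mul]
    calc _ ≤ ∑ z ∈ s, ∫⁻ w in block α C (Ω.node z.1 z.2) (Ω.freq z.2), F w := by
          refine Finset.sum_le_sum fun z hz => ?_
          have h4 := setLIntegral_block_ge hC (x := Ω.node z.1 z.2) (Ω.freq_ne_zero z.2)
            (h1 z hz) (h2 z hz) t
          rw [hVe, ← ENNReal.ofReal_pow hV0.le, ← ENNReal.ofReal_mul (by positivity)] at h4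
          exact h4
      _ = ∫⁻ w, ∑ z ∈ s, (block α C (Ω.node z.1 z.2) (Ω.freq z.2)).indicator F w := by
          rw [lintegral_finsetSum _ fun z _ => hFm.indicator (hbm z)]
          exact Finset.sum_congr rfl fun z _ => (lintegral_indicator (hbm z) F).symm
      _ ≤ ∫⁻ w, N₀ * F w := lintegral_mono hcount
      _ = _ := by
          rw [lintegral_const_mul _ hFm, hFint, ENNReal.ofReal_mul N₀.cast_nonneg,
            ENNReal.ofReal_natCast]
  rw [← ENNReal.ofReal_mul (Finset.sum_nonneg fun z _ => div_nonneg (wt_pos _).le (by positivity)),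
    ENNReal.ofReal_le_ofReal_iff (by have := wtMass_nonneg (d := d); positivity),
    ← Finset.sum_div] at key
  have hA : 0 < (1 + C') ^ (d + 1) := by positivity
  have hB : 0 < C ^ (2 * d) * V := by positivity
  rw [le_inv_mul_iff₀ hB]
  have : C ^ (2 * d) * V * ∑ z ∈ s, wt (t - Ω.node z.1 z.2) = (∑ z ∈ s, wt (t - Ω.node z.1 z.2)) /
      (1 + C') ^ (d + 1) * (C ^ (2 * d) * V ^ 2) * ((1 + C') ^ (d + 1) / V) := by
    field_simp
  rw [this]
  calc _ ≤ N₀ * (wtMass d * (ρ ^ d * V)) * ((1 + C') ^ (d + 1) / V) := by gcongr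
    _ = _ := by field_simp

/-- The inclusion of the indices near `ξ`. -/
def nearEmb (Ω : Lattice d) (ξ : E d) : Near Ω ξ ↪ (Fin d → ℤ) × ℕ :=
  ⟨fun z => z.1, Subtype.val_injective⟩

theorem Near.one_le {Ω : Lattice d} {ξ : E d} (hξ : 4 ≤ ‖ξ‖) (z : Near Ω ξ) :
    1 ≤ ‖Ω.freq z.1.2‖ := by linarith [z.2.1]

/-- The factor 2 is absorbed into a square so that later bounds are pure powers of |ξ|. -/
theorem Near.le_sq {Ω : Lattice d} {ξ : E d} (hξ : 4 ≤ ‖ξ‖) (z : Near Ω ξ) :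
    ‖Ω.freq z.1.2‖ ≤ ‖ξ‖ ^ 2 := by nlinarith [z.2.2]

theorem Near.pow_le {Ω : Lattice d} {ξ : E d} (hξ : 4 ≤ ‖ξ‖) (z : Near Ω ξ) (n : ℕ) :
    ‖Ω.freq z.1.2‖ ^ n ≤ ‖ξ‖ ^ (2 * n) := by
  rw [pow_mul]
  exact pow_le_pow_left₀ (norm_nonneg _) (z.le_sq hξ) n

/-- At frequencies comparable to ξ, block radii and frequencies are at most powers of |ξ|, so the
volume count is polynomial. -/
theorem exists_sparse_near {α : ℝ} {Ω : Lattice d} (hΩ : IsAdmissibleLattice α Ω) :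
    ∃ (P : ℝ) (K : ℕ), 0 ≤ P ∧ ∀ ξ : E d, 4 ≤ ‖ξ‖ →
      Sparse (fun z : Near Ω ξ => Ω.node z.1.1 z.1.2) (P * ‖ξ‖ ^ K) := by
  obtain ⟨-, C, hC, ⟨N₀, hov⟩, -⟩ := hΩ
  obtain ⟨a, ha⟩ := exists_nat_ge (α - 1)
  obtain ⟨b, hb⟩ := exists_nat_ge (1 - α)
  have hw := wtMass_nonneg (d := d)
  refine ⟨(C ^ (2 * d) * volume.real (Metric.ball (0 : E d) 1))⁻¹ *
        (N₀ * wtMass d * (1 + C) ^ d * (1 + C) ^ (d + 1)),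
      (2 * (b + 1)) * d + (2 * a) * (d + 1), by positivity, fun ξ hξ t s => ?_⟩
  have hξ1 : 1 ≤ ‖ξ‖ := by linarith
  have h1 : ∀ z : Near Ω ξ, C * ‖Ω.freq z.1.2‖ ^ (α - 1) ≤ C * ‖ξ‖ ^ (2 * a) := fun z =>
    mul_le_mul_of_nonneg_left ((rpow_le_pow_of_le (z.one_le hξ) ha).trans (z.pow_le hξ a)) hC.le
  have h2 : ∀ z : Near Ω ξ, ‖Ω.freq z.1.2‖ + C * ‖Ω.freq z.1.2‖ ^ (1 - α) ≤
      (1 + C) * ‖ξ‖ ^ (2 * (b + 1)) := by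
    intro z
    have e1 : ‖Ω.freq z.1.2‖ ≤ ‖ξ‖ ^ (2 * (b + 1)) :=
      (z.le_sq hξ).trans (pow_le_pow_right₀ hξ1 (by omega))
    have e2 : ‖Ω.freq z.1.2‖ ^ (1 - α) ≤ ‖ξ‖ ^ (2 * (b + 1)) :=
      ((rpow_le_pow_of_le (z.one_le hξ) hb).trans (z.pow_le hξ b)).trans
        (pow_le_pow_right₀ hξ1 (by omega))
    nlinarith
  have h3 := sum_wt_le hC hov (C' := C * ‖ξ‖ ^ (2 * a)) (ρ := (1 + C) * ‖ξ‖ ^ (2 * (b + 1)))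
    (by positivity) (by positivity) (s.map (nearEmb Ω ξ))
    (fun z hz => by
      obtain ⟨y, -, rfl⟩ := Finset.mem_map.1 hz
      exact h1 y)
    (fun z hz => by
      obtain ⟨y, -, rfl⟩ := Finset.mem_map.1 hz
      exact h2 y) t
  rw [Finset.sum_map] at h3
  refine h3.trans ?_
  have hc : 0 ≤ (C ^ (2 * d) * volume.real (Metric.ball (0 : E d) 1))⁻¹ := by positivity
  generalize (C ^ (2 * d) * volume.real (Metric.ball (0 : E d) 1))⁻¹ = c at hc
  rw [mul_assoc c]
  refine mul_le_mul_of_nonneg_left ?_ hc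
  have h4 : 1 + C * ‖ξ‖ ^ (2 * a) ≤ (1 + C) * ‖ξ‖ ^ (2 * a) := by
    have : 1 ≤ ‖ξ‖ ^ (2 * a) := one_le_pow₀ hξ1
    linarith
  calc N₀ * wtMass d * ((1 + C) * ‖ξ‖ ^ (2 * (b + 1))) ^ d * (1 + C * ‖ξ‖ ^ (2 * a)) ^ (d + 1)
      ≤ N₀ * wtMass d * ((1 + C) * ‖ξ‖ ^ (2 * (b + 1))) ^ d *
        ((1 + C) * ‖ξ‖ ^ (2 * a)) ^ (d + 1) := by gcongr
    _ = _ := by rw [mul_pow, mul_pow, pow_add, ← pow_mul, ← pow_mul]; ring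

/-- The packets at the lattice points near `ξ`. -/
noncomputable def nearPacket (α : ℝ) (φ : 𝓢(E d, ℂ)) (Ω : Lattice d) (ξ : E d) (z : Near Ω ξ) :
    𝓢(E d, ℂ) := packet α φ (Ω.node z.1.1 z.1.2) (Ω.freq z.1.2)

/-- The lattice nodes near `ξ`. -/
def nearNode (Ω : Lattice d) (ξ : E d) (z : Near Ω ξ) : E d := Ω.node z.1.1 z.1.2

theorem exists_locBound_near (α : ℝ) (φ : 𝓢(E d, ℂ)) (Ω : Lattice d) (m : ℕ) :
    ∃ (C : ℝ) (K : ℕ), 0 ≤ C ∧ ∀ ξ : E d, 4 ≤ ‖ξ‖ →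
      LocBound (nearNode Ω ξ) m (C * ‖ξ‖ ^ K) (nearPacket α φ Ω ξ) := by
  obtain ⟨C, K, hC, h⟩ := exists_packet_decay α φ m
  refine ⟨C, 2 * K, hC, fun ξ hξ z t => (h _ _ (z.one_le hξ) t).trans ?_⟩
  exact mul_le_mul_of_nonneg_left (z.pow_le hξ K) hC

/-- Positivity of α makes |ξ_k|^{1-α} = o(|ξ_k|) at high frequency. The finitely many low
frequencies, where this power may be large if α > 1, go into the constant. -/
theorem exists_rpow_le_add {α : ℝ} (hα : 0 < α) {Ω : Lattice d}
    (hΩ : {k | ‖Ω.freq k‖ ^ α < 1}.Finite) (c ε : ℝ) (hc : 0 < c) (hε : 0 < ε) :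
    ∃ C₀, 0 ≤ C₀ ∧ ∀ k, c * ‖Ω.freq k‖ ^ (1 - α) ≤ ε * ‖Ω.freq k‖ + C₀ := by
  have ht : Tendsto (fun r : ℝ => r ^ (-α)) atTop (𝓝 0) := tendsto_rpow_neg_atTop hα
  obtain ⟨R, hR⟩ := eventually_atTop.1 (ht.eventually (gt_mem_nhds (div_pos hε hc)))
  set S := ∑ k ∈ hΩ.toFinset, c * ‖Ω.freq k‖ ^ (1 - α)
  have hS0 : 0 ≤ S := Finset.sum_nonneg fun k _ => by positivity
  refine ⟨S + c * max R 1, by positivity, fun k => ?_⟩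
  have hp : 0 < ‖Ω.freq k‖ := norm_pos_iff.2 (Ω.freq_ne_zero k)
  have hm : 0 < c * max R 1 := by positivity
  by_cases hk : ‖Ω.freq k‖ ^ α < 1
  · have : c * ‖Ω.freq k‖ ^ (1 - α) ≤ S :=
      Finset.single_le_sum (f := fun k => c * ‖Ω.freq k‖ ^ (1 - α)) (fun k _ => by positivity)
        (hΩ.mem_toFinset.2 hk)
    nlinarith
  · have h1 : 1 ≤ ‖Ω.freq k‖ := by
      by_contra h
      exact hk (Real.rpow_lt_one hp.le (not_le.1 h) hα)
    have e : ‖Ω.freq k‖ ^ (1 - α) = ‖Ω.freq k‖ * ‖Ω.freq k‖ ^ (-α) := by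
      rw [sub_eq_add_neg, Real.rpow_add hp, Real.rpow_one]
    by_cases hRk : R ≤ ‖Ω.freq k‖
    · have h2 := hR _ hRk
      rw [lt_div_iff₀ hc] at h2
      have h3 : c * ‖Ω.freq k‖ ^ (1 - α) ≤ ε * ‖Ω.freq k‖ := by
        rw [e]; nlinarith
      linarith
    · have h2 : ‖Ω.freq k‖ ^ (1 - α) ≤ max R 1 := by
        calc ‖Ω.freq k‖ ^ (1 - α) ≤ ‖Ω.freq k‖ ^ (1 : ℝ) :=
              Real.rpow_le_rpow_of_exponent_le h1 (by linarith)
          _ = ‖Ω.freq k‖ := Real.rpow_one _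
          _ ≤ _ := (not_le.1 hRk).le.trans (le_max_left _ _)
      have h3 : c * ‖Ω.freq k‖ ^ (1 - α) ≤ c * max R 1 := by gcongr
      have : 0 ≤ ε * ‖Ω.freq k‖ := by positivity
      linarith

/-- Band-limited functions only interact with the packets at comparable frequencies. -/
theorem exists_near_of_ip_ne_zero {α : ℝ} (hα : 0 < α) {Ω : Lattice d}
    (hΩ : IsAdmissibleLattice α Ω) {φ : 𝓢(E d, ℂ)} {c : ℝ} (hc : 0 < c)
    (hφ : ∀ x ξ : E d, ξ ≠ 0 → Band ξ (c * ‖ξ‖ ^ (1 - α)) (packet α φ x ξ)) :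
    ∃ R, 4 ≤ R ∧ ∀ ξ : E d, R ≤ ‖ξ‖ → ∀ f, Band ξ (‖ξ‖ / 4) f → ∀ z : (Fin d → ℤ) × ℕ,
      ip (packet α φ (Ω.node z.1 z.2) (Ω.freq z.2)) f ≠ 0 →
      ‖ξ‖ / 2 ≤ ‖Ω.freq z.2‖ ∧ ‖Ω.freq z.2‖ ≤ 2 * ‖ξ‖ := by
  obtain ⟨C₀, hC₀, h⟩ := exists_rpow_le_add hα hΩ.1 c (1 / 8) hc (by norm_num)
  -- With X = |ξ| and y = |ξ_k|, meeting spectra force |y - X| ≤ y/8 + C₀ + X/4; once C₀ ≤ X/6 this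
  -- gives X/2 ≤ y ≤ 2X.
  refine ⟨max 4 (6 * C₀), le_max_left _ _, fun ξ hξ f hf z hz => ?_⟩
  have h1 : ‖Ω.freq z.2 - ξ‖ ≤ c * ‖Ω.freq z.2‖ ^ (1 - α) + ‖ξ‖ / 4 := by
    by_contra hlt
    exact hz ((hφ _ _ (Ω.freq_ne_zero z.2)).ip_eq_zero hf (not_le.1 hlt))
  have h2 := h z.2
  have h3 := abs_le.1 (abs_norm_sub_norm_le (Ω.freq z.2) ξ)
  have h4 := (le_max_right 4 (6 * C₀)).trans hξ
  constructor <;> linarith [h3.1, h3.2]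

theorem Near.rpow_le {Ω : Lattice d} {ξ : E d} (hξ : 4 ≤ ‖ξ‖) (z : Near Ω ξ) (s : ℝ) :
    ‖Ω.freq z.1.2‖ ^ s ≤ 2 ^ |s| * ‖ξ‖ ^ s := by
  have hp : 0 < ‖ξ‖ := by linarith
  rcases le_total 0 s with hs | hs
  · rw [abs_of_nonneg hs, ← Real.mul_rpow (by norm_num) hp.le]
    exact Real.rpow_le_rpow (norm_nonneg _) z.2.2 hs
  · rw [abs_of_nonpos hs, Real.rpow_neg (by norm_num), ← Real.inv_rpow (by norm_num),
      ← Real.mul_rpow (by norm_num) hp.le, inv_mul_eq_div]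
    exact Real.rpow_le_rpow_of_nonpos (by positivity) z.2.1 hs

/-- A surviving packet is centred within r plus its own radius of ξ and extends one more radius
beyond, hence the factor 2. The growth is only |ξ|^{1-α} per application, leaving room for about
|ξ|^α applications below |ξ|. -/
theorem Band.frameOp_near {α : ℝ} {Ω : Lattice d} {φ : 𝓢(E d, ℂ)} {c : ℝ} (hc : 0 < c)
    (hφ : ∀ x ξ : E d, ξ ≠ 0 → Band ξ (c * ‖ξ‖ ^ (1 - α)) (packet α φ x ξ)) {ξ : E d}
    (hξ : 4 ≤ ‖ξ‖) {r : ℝ} {f : 𝓢(E d, ℂ)} (hf : Band ξ r f) :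
    Band ξ (r + 2 * c * 2 ^ |1 - α| * ‖ξ‖ ^ (1 - α))
      (frameOp (nearPacket α φ Ω ξ) (nearPacket α φ Ω ξ) f) := by
  refine Band.tsum fun z => ?_
  by_cases hz : ip (nearPacket α φ Ω ξ z) f = 0
  · intro ζ hζ
    rw [hz, fourier_smul', zero_smul] at hζ
    exact absurd rfl hζ
  refine Band.smul _ ?_
  have hb := hφ (Ω.node z.1.1 z.1.2) (Ω.freq z.1.2) (Ω.freq_ne_zero z.1.2)
  have h1 : ‖Ω.freq z.1.2 - ξ‖ ≤ c * ‖Ω.freq z.1.2‖ ^ (1 - α) + r := by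
    by_contra hlt
    exact hz (hb.ip_eq_zero hf (not_le.1 hlt))
  refine (hb.recenter (η := ξ)).mono ?_
  have h2 := mul_le_mul_of_nonneg_left (z.rpow_le hξ (1 - α)) hc.le
  linarith

theorem localizedFamily_near {α : ℝ} {Ω : Lattice d} {φ : 𝓢(E d, ℂ)} {c : ℝ} (hc : 0 < c)
    (hφ : ∀ x ξ : E d, ξ ≠ 0 → Band ξ (c * ‖ξ‖ ^ (1 - α)) (packet α φ x ξ)) {ξ : E d}
    (hξ : 4 ≤ ‖ξ‖) :
    LocalizedFamily (nearNode Ω ξ) (c * (2 ^ |1 - α| * ‖ξ‖ ^ (1 - α)) + 2 * ‖ξ‖)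
      (nearPacket α φ Ω ξ) := by
  refine ⟨fun m => ?_, fun z => ?_⟩
  · obtain ⟨C, K, -, h⟩ := exists_locBound_near α φ Ω m
    exact ⟨_, h ξ hξ⟩
  · refine ((hφ _ _ (Ω.freq_ne_zero z.1.2)).recenter (η := 0)).mono ?_
    rw [sub_zero]
    have h2 := mul_le_mul_of_nonneg_left (z.rpow_le hξ (1 - α)) hc.le
    linarith [z.2.2]

/-- The frame inequalities, in terms of real sums over the lattice points near `ξ`. -/
theorem exists_frame_near {α : ℝ} {Ω : Lattice d} {φ : 𝓢(E d, ℂ)} (hF : IsGaborFrame α φ Ω) :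
    ∃ A B : ℝ, 0 < A ∧ A ≤ B ∧ ∀ ξ : E d,
      (∀ (g : 𝓢(E d, ℂ)) (s : Finset (Near Ω ξ)),
        ∑ z ∈ s, ‖ip (nearPacket α φ Ω ξ z) g‖ ^ 2 ≤ B * nrm g ^ 2) ∧
      ∀ f : 𝓢(E d, ℂ), (∀ z : (Fin d → ℤ) × ℕ,
        ip (packet α φ (Ω.node z.1 z.2) (Ω.freq z.2)) f ≠ 0 →
          ‖ξ‖ / 2 ≤ ‖Ω.freq z.2‖ ∧ ‖Ω.freq z.2‖ ≤ 2 * ‖ξ‖) →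
        A * nrm f ^ 2 ≤ ∑' z, ‖ip (nearPacket α φ Ω ξ z) f‖ ^ 2 := by
  obtain ⟨A, B, hA, h⟩ := hF
  have key : ∀ g : 𝓢(E d, ℂ),
      ∑' z : (Fin d → ℤ) × ℕ, ‖inner ℂ ((packet α φ (Ω.node z.1 z.2) (Ω.freq z.2)).toLp 2 volume)
        (g.toLp 2 (volume : Measure (E d)))‖ₑ ^ 2 =
      ∑' z : (Fin d → ℤ) × ℕ,
        ENNReal.ofReal (‖ip (packet α φ (Ω.node z.1 z.2) (Ω.freq z.2)) g‖ ^ 2) := by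
    intro g
    refine tsum_congr fun z => ?_
    rw [ENNReal.ofReal_pow (norm_nonneg _), ofReal_norm]
    rfl
  have hup : ∀ (ξ : E d) (g : 𝓢(E d, ℂ)) (s : Finset (Near Ω ξ)),
      ∑ z ∈ s, ‖ip (nearPacket α φ Ω ξ z) g‖ ^ 2 ≤ max A B * nrm g ^ 2 := by
    intro ξ g s
    have h2 := (h (g.toLp 2 volume)).2
    rw [key] at h2
    have h3 := (ENNReal.sum_le_tsum (s.map (nearEmb Ω ξ))).trans h2
    rw [Finset.sum_map, ← ENNReal.ofReal_sum_of_nonneg fun z _ => sq_nonneg _] at h3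
    have h4 : B * ‖g.toLp 2 (volume : Measure (E d))‖ ^ 2 ≤ max A B * nrm g ^ 2 :=
      mul_le_mul_of_nonneg_right (le_max_right _ _) (sq_nonneg _)
    have h5 := h3.trans (ENNReal.ofReal_le_ofReal h4)
    exact (ENNReal.ofReal_le_ofReal_iff (by positivity)).1 h5
  -- The frame definition does not order its constants; enlarging B to the maximum gives A ≤ B and
  -- keeps the upper bound.
  refine ⟨A, max A B, hA, le_max_left _ _, fun ξ => ⟨hup ξ, fun f hf => ?_⟩⟩
  have h2 := (h (f.toLp 2 volume)).1
  rw [key] at h2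
  have hs : Summable fun z => ‖ip (nearPacket α φ Ω ξ z) f‖ ^ 2 :=
    summable_of_sum_le (fun z => sq_nonneg _) (hup ξ f)
  have h3 : ∑' z : (Fin d → ℤ) × ℕ,
        ENNReal.ofReal (‖ip (packet α φ (Ω.node z.1 z.2) (Ω.freq z.2)) f‖ ^ 2) =
      ENNReal.ofReal (∑' z, ‖ip (nearPacket α φ Ω ξ z) f‖ ^ 2) := by
    rw [ENNReal.ofReal_tsum_of_nonneg (fun z => sq_nonneg _) hs]
    refine (tsum_subtype_eq_of_support_subset (f := fun z : (Fin d → ℤ) × ℕ =>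
      ENNReal.ofReal (‖ip (packet α φ (Ω.node z.1 z.2) (Ω.freq z.2)) f‖ ^ 2))
      (s := {z | ‖ξ‖ / 2 ≤ ‖Ω.freq z.2‖ ∧ ‖Ω.freq z.2‖ ≤ 2 * ‖ξ‖}) fun z hz => hf z ?_).symm
    intro h0
    exact hz (by simp [h0])
  rw [h3] at h2
  exact (ENNReal.ofReal_le_ofReal_iff (tsum_nonneg fun z => sq_nonneg _)).1 h2

/-! ## The antilinear pairing with a tempered distribution -/

/-- The pairing `f ↦ u (conj f)`. -/
noncomputable def conjPair (u : 𝓢'(E d, ℂ)) : 𝓢(E d, ℂ) →L[ℝ] ℂ :=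
  (ContinuousLinearMap.restrictScalars ℝ (show 𝓢(E d, ℂ) →L[ℂ] ℂ from u)).comp
    (SchwartzMap.postcompCLM (𝕜 := ℝ) (Complex.conjCLE : ℂ →L[ℝ] ℂ))

theorem conjPair_apply (u : 𝓢'(E d, ℂ)) (f : 𝓢(E d, ℂ)) : conjPair u f = u (conjSchwartz f) := rfl

theorem stft_eq_conjPair (α : ℝ) (φ : 𝓢(E d, ℂ)) (u : 𝓢'(E d, ℂ)) (x ξ : E d) :
    stft α φ u x ξ = conjPair u (packet α φ x ξ) := rfl

theorem conjPair_smul (u : 𝓢'(E d, ℂ)) (c : ℂ) (f : 𝓢(E d, ℂ)) :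
    conjPair u (c • f) = (starRingEnd ℂ) c * conjPair u f := by
  have : conjSchwartz (c • f) = (starRingEnd ℂ) c • conjSchwartz f := by
    ext t
    simp [conjSchwartz_apply]
  rw [conjPair_apply, conjPair_apply, this]
  exact map_smul (show 𝓢(E d, ℂ) →L[ℂ] ℂ from u) _ _

theorem exists_seminorm_bound {V F : Type*} [NormedAddCommGroup V] [NormedSpace ℝ V]
    [NormedAddCommGroup F] [NormedSpace ℝ F] {G : Type*} [NormedAddCommGroup G] [NormedSpace ℝ G]
    (T : 𝓢(V, F) →L[ℝ] G) :
    ∃ (s : Finset (ℕ × ℕ)) (C : ℝ), 0 ≤ C ∧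
      ∀ f, ‖T f‖ ≤ C * ∑ p ∈ s, SchwartzMap.seminorm ℝ p.1 p.2 f := by
  obtain ⟨s, C, -, h⟩ := Seminorm.bound_of_continuous (schwartz_withSeminorms ℝ V F)
    ((normSeminorm ℝ G).comp T.toLinearMap) (continuous_norm.comp T.continuous)
  refine ⟨s, C, C.2, fun f => ?_⟩
  have h1 := h f
  refine h1.trans ?_
  change (C : ℝ) * (s.sup (schwartzSeminormFamily ℝ V F)) f ≤ _
  refine mul_le_mul_of_nonneg_left ?_ C.2
  have h2 := Seminorm.finset_sup_le_sum (schwartzSeminormFamily ℝ V F) s f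
  refine h2.trans (le_of_eq ?_)
  rw [← FunLike.coeAddMonoidHom_apply, map_sum, Finset.sum_apply]
  rfl

/-- Continuity of the pairing is expressed through seminorms of 𝓕 f, which a band turns into one
weighted L¹ norm with a power of ρ. -/
theorem exists_conjPair_band_bound (u : 𝓢'(E d, ℂ)) :
    ∃ (C : ℝ) (n K : ℕ), 0 ≤ C ∧ ∀ ρ : ℝ, 1 ≤ ρ → ∀ f, Band 0 ρ f →
      ‖conjPair u f‖ ≤ C * ρ ^ K * ∫ t, (1 + ‖t‖) ^ n * ‖f t‖ := by
  obtain ⟨s, C, hC, h⟩ := exists_seminorm_bound ((conjPair u).comp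
    ((FourierTransform.fourierInvCLM ℂ 𝓢(E d, ℂ) :
      𝓢(E d, ℂ) →L[ℂ] 𝓢(E d, ℂ)).restrictScalars ℝ))
  have hpi := Real.pi_pos
  refine ⟨C * ∑ p ∈ s, (2 * Real.pi) ^ p.2 * (p.2 + 1 : ℕ), s.sup Prod.snd, s.sup Prod.fst,
    by positivity, fun ρ hρ f hf => ?_⟩
  have h1 := h (𝓕 f)
  have h2 : ((conjPair u).comp ((FourierTransform.fourierInvCLM ℂ 𝓢(E d, ℂ) :
      𝓢(E d, ℂ) →L[ℂ] 𝓢(E d, ℂ)).restrictScalars ℝ)) (𝓕 f) = conjPair u f := by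
    change conjPair u (𝓕⁻ (𝓕 f)) = _
    rw [FourierTransform.fourierInv_fourier_eq]
  rw [h2] at h1
  refine h1.trans ?_
  rw [mul_assoc, mul_assoc]
  refine mul_le_mul_of_nonneg_left ?_ hC
  rw [Finset.sum_mul]
  refine Finset.sum_le_sum fun p hp => ?_
  refine (hf.seminorm_fourier_le (by linarith) p.1 p.2).trans ?_
  have h3 : ρ ^ p.1 ≤ ρ ^ s.sup Prod.fst := pow_le_pow_right₀ hρ (Finset.le_sup (f := Prod.fst) hp)
  have h4 : ∫ t, (1 + ‖t‖) ^ p.2 * ‖f t‖ ≤ ∫ t, (1 + ‖t‖) ^ (s.sup Prod.snd) * ‖f t‖ := by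
    refine integral_mono (integrable_pow_mul_norm _ _) (integrable_pow_mul_norm _ _) fun t => ?_
    exact mul_le_mul_of_nonneg_right (pow_le_pow_right₀ (by linarith [norm_nonneg t])
      (Finset.le_sup (f := Prod.snd) hp)) (norm_nonneg _)
  have h5 : 0 ≤ ∫ t, (1 + ‖t‖) ^ p.2 * ‖f t‖ := integral_nonneg fun t => by positivity
  calc _ ≤ ρ ^ s.sup Prod.fst * ((2 * Real.pi) ^ p.2 * ((p.2 + 1 : ℕ) *
        ∫ t, (1 + ‖t‖) ^ (s.sup Prod.snd) * ‖f t‖)) := by gcongr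
    _ = _ := by ring

/-- The pairing passes through the series and meets only the numbers ⟨u, θ_z⟩, all at most D; the
rest is an ℓ¹ bound on the coefficients of f. -/
theorem norm_conjPair_frameOp_le {ι : Type*} {x : ι → E d} {P ρ Q D : ℝ} (hρ : 0 ≤ ρ)
    (hP : Sparse x P) {θ : ι → 𝓢(E d, ℂ)} (hθ : LocalizedFamily x ρ θ) (hQ0 : 0 ≤ Q)
    (hQ : LocBound x (d + 1) Q θ) (u : 𝓢'(E d, ℂ)) (hD0 : 0 ≤ D)
    (hD : ∀ z, ‖conjPair u (θ z)‖ ≤ D) (f : 𝓢(E d, ℂ)) :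
    ‖conjPair u (frameOp θ θ f)‖ ≤ D * (Q * P * ∫ t, ‖f t‖) := by
  have h1 := (hasSum_frameOp hρ hP hθ hθ f).mapL (conjPair u)
  refine le_of_tendsto h1.norm (Eventually.of_forall fun s => ?_)
  refine (norm_sum_le _ _).trans ?_
  have h2 := sum_norm_ip_mul_le hP (n := 0) hQ0 (by rwa [zero_add]) s f
  simp only [pow_zero, mul_one, one_mul] at h2
  calc ∑ z ∈ s, ‖conjPair u (ip (θ z) f • θ z)‖ ≤ ∑ z ∈ s, D * ‖ip (θ z) f‖ := by
        refine Finset.sum_le_sum fun z _ => ?_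
        rw [conjPair_smul, norm_mul, RCLike.norm_conj, mul_comm]
        exact mul_le_mul_of_nonneg_right (hD z) (norm_nonneg _)
    _ = D * ∑ z ∈ s, ‖ip (θ z) f‖ := (Finset.mul_sum _ _ _).symm
    _ ≤ _ := mul_le_mul_of_nonneg_left h2 hD0

/-! ### The Richardson iteration applied to a tempered distribution -/

theorem wnrm_mono {κ κ' : ℝ} (hκ : 0 ≤ κ) (h : κ ≤ κ') (M : ℕ) (f : 𝓢(E d, ℂ)) :
    wnrm κ M f ≤ wnrm κ' M f :=
  Finset.sum_le_sum fun _ _ => Finset.sum_le_sum fun _ _ =>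
    mul_le_mul_of_nonneg_right (pow_le_pow_left₀ hκ h _) (nrm_nonneg _)

theorem wnrm_nonneg {κ : ℝ} (hκ : 0 ≤ κ) (M : ℕ) (f : 𝓢(E d, ℂ)) : 0 ≤ wnrm κ M f :=
  Finset.sum_nonneg fun _ _ => Finset.sum_nonneg fun _ _ =>
    mul_nonneg (pow_nonneg hκ _) (nrm_nonneg _)

/-- Here S is the frame operator of the packets near ξ and the functional is |⟨u, f⟩|. Every
constant depends on ξ through a power of |ξ| except the contraction factor, which is uniform; hence
a long iteration eventually beats all losses. -/
theorem exists_richardson_estimate (hd : 0 < d) {α : ℝ} (hα : 0 < α) {φ : 𝓢(E d, ℂ)}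
    {Ω : Lattice d} (h : IsAdmissiblePair α φ Ω) (u : 𝓢'(E d, ℂ)) :
    ∃ (R C Cw ρ : ℝ) (K M : ℕ), 4 ≤ R ∧ 0 ≤ C ∧ 0 < Cw ∧ 0 ≤ ρ ∧ ρ < 1 ∧
      ∀ ξ : E d, R ≤ ‖ξ‖ → ∀ D, 0 ≤ D → (∀ z, ‖conjPair u (nearPacket α φ Ω ξ z)‖ ≤ D) →
      ∀ (n : ℕ) (r : ℝ) (f : 𝓢(E d, ℂ)), Band ξ r f →
        r + n * (Cw * ‖ξ‖ ^ (1 - α)) ≤ ‖ξ‖ / 4 →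
        ‖conjPair u f‖ ≤ C * ‖ξ‖ ^ K * (n * D + ρ ^ n) * wnrm 1 M f := by
  obtain ⟨hspec, hlat, hframe⟩ := h
  obtain ⟨c, hc, hφ⟩ := hspec.exists_band α
  obtain ⟨A, B, hA, hAB, hAB'⟩ := exists_frame_near hframe
  obtain ⟨R, hR4, hR⟩ := exists_near_of_ip_ne_zero hα hlat hc hφ
  obtain ⟨Cu, n₀, Ku, hCu, hu⟩ := exists_conjPair_band_bound u
  obtain ⟨Cp, Kp, hCp, hsparse⟩ := exists_sparse_near hlat
  set M := n₀ + (d + 1) with hM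
  -- Up to M commutators consume one order of decay each, and the Bessel bound needs d + 1 more.
  obtain ⟨Cq, Kq, hCq, hloc⟩ := exists_locBound_near α φ Ω (M + (d + 1))
  have hB : 0 < B := hA.trans_le hAB
  have hw := wtMass_nonneg (d := d)
  set ρ := √(1 - A / B) with hρ
  have hρ0 : 0 ≤ ρ := Real.sqrt_nonneg _
  have hρ1 : ρ < 1 := by
    rw [hρ, Real.sqrt_lt' one_pos]
    have : 0 < A / B := by positivity
    linarith
  set c₁ := 5 ^ M * (Cq ^ 2 * wtMass d * Cp) with hc₁
  have hc₁0 : 0 ≤ c₁ := by positivity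
  -- The ξ-independent part of the damping, small enough for the smallness condition of
  -- `wnrm_sub_smul_le`; `c₁ + 1` keeps the denominator positive.
  set κ₀ := min 1 ((1 - ρ) / 2 / ((M + 1) * (B⁻¹ * (c₁ + 1)))) with hκ₀
  have hκ₀0 : 0 < κ₀ := by
    refine lt_min one_pos (div_pos (by linarith) (by positivity))
  have hκ₀1 : κ₀ ≤ 1 := min_le_left _ _
  have hκ₀s : (M + 1) * (B⁻¹ * c₁ * κ₀) ≤ (1 - ρ) / 2 := by
    have h1 : κ₀ ≤ (1 - ρ) / 2 / ((M + 1) * (B⁻¹ * (c₁ + 1))) := min_le_right _ _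
    rw [le_div_iff₀ (by positivity)] at h1
    refine le_trans ?_ h1
    have : 0 ≤ (M + 1) * (B⁻¹ * κ₀) := by positivity
    nlinarith
  set k₁ := 2 * Kq + Kp with hk₁
  set c₂ := (1 + d : ℝ) ^ M * √(wtMass d) * 2 * (κ₀ ^ M)⁻¹ with hc₂
  have hc₂0 : 0 ≤ c₂ := by positivity
  refine ⟨R, Cu * 2 ^ Ku * c₂ + B⁻¹ * (Cq * Cp * c₂), 2 * c * 2 ^ |1 - α|, (1 + ρ) / 2,
    (Ku + k₁ * M) + (Kq + Kp + k₁ * M), M, hR4, by positivity, by positivity, by linarith,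
    by linarith, ?_⟩
  intro ξ hξ D hD0 hD n r f hf hr
  have hξ4 : 4 ≤ ‖ξ‖ := hR4.trans hξ
  have hξ1 : 1 ≤ ‖ξ‖ := by linarith
  have hp : 0 < ‖ξ‖ := by linarith
  set X := ‖ξ‖ with hX
  set θ := nearPacket α φ Ω ξ with hθdef
  have hθ := localizedFamily_near (Ω := Ω) hc hφ hξ4
  have hρθ : 0 ≤ c * (2 ^ |1 - α| * ‖ξ‖ ^ (1 - α)) + 2 * ‖ξ‖ := by positivity
  have hP : Sparse (nearNode Ω ξ) (Cp * X ^ Kp) := hsparse ξ hξ4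
  have hQ := hloc ξ hξ4
  have hQ0 : 0 ≤ Cq * X ^ Kq := by positivity
  -- The power cancels the growth X^{k₁} of the commutator bounds; the price is the factor X^{k₁ M}
  -- in `hint`.
  set κ := κ₀ * (X ^ k₁)⁻¹ with hκ
  have hκ0 : 0 < κ := by positivity
  have hκ1 : κ ≤ 1 := mul_le_one₀ hκ₀1 (by positivity) (inv_le_one_of_one_le₀ (one_le_pow₀ hξ1))
  have hint : ∀ g : 𝓢(E d, ℂ), ∫ t, (1 + ‖t‖) ^ n₀ * ‖g t‖ ≤
      c₂ * X ^ (k₁ * M) * wnrm κ M g := by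
    intro g
    refine (integral_one_add_norm_pow_mul_le hd n₀ M hM hκ0 hκ1 g).trans (le_of_eq ?_)
    rw [hκ, mul_pow, mul_inv, inv_pow, inv_inv, ← pow_mul, hc₂]
    ring
  have hint0 : ∀ g : 𝓢(E d, ℂ), ∫ t, ‖g t‖ ≤ c₂ * X ^ (k₁ * M) * wnrm κ M g := by
    intro g
    refine le_trans ?_ (hint g)
    refine integral_mono g.integrable.norm (integrable_pow_mul_norm _ _) fun t => ?_
    exact le_mul_of_one_le_left (norm_nonneg _) (one_le_pow₀ (by linarith [norm_nonneg t]))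
  have hcontr : ∀ g, Band ξ (X / 4) g →
      nrm (g - ((B⁻¹ : ℝ) : ℂ) • frameOp θ θ g) ≤ ρ * nrm g := fun g hg =>
    nrm_sub_smul_frameOp_le hA hAB (hAB' ξ).1 ((hAB' ξ).2 g (hR ξ hξ g hg))
      (hasSum_frameOp hρθ hP hθ hθ g)
  have hcomm : ∀ (i : Fin d) (m : ℕ), m ≤ M → ∀ g : 𝓢(E d, ℂ),
      nrm ((pos i)^[m] (frameOp θ θ g) - frameOp θ θ ((pos i)^[m] g)) ≤
        c₁ * X ^ k₁ * ∑ l ∈ Finset.range m, nrm ((pos i)^[l] g) := by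
    intro i m hm g
    have hQm : LocBound (nearNode Ω ξ) (m + (d + 1)) (Cq * X ^ Kq) θ := hQ.mono (by omega)
    refine (nrm_pos_iterate_frameOp_sub_le hρθ hP i m θ θ hθ hθ hQm hQm g).trans ?_
    refine mul_le_mul_of_nonneg_right ?_ (Finset.sum_nonneg fun l _ => nrm_nonneg _)
    calc 5 ^ m * ((Cq * X ^ Kq) ^ 2 * wtMass d * (Cp * X ^ Kp))
        ≤ 5 ^ M * ((Cq * X ^ Kq) ^ 2 * wtMass d * (Cp * X ^ Kp)) := by
          refine mul_le_mul_of_nonneg_right (pow_le_pow_right₀ (by norm_num) hm) (by positivity)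
      _ = c₁ * X ^ k₁ := by rw [hc₁, hk₁]; ring
  have hsmall : (M + 1) * (B⁻¹ * (c₁ * X ^ k₁) * κ) ≤ (1 - ρ) / 2 := by
    refine le_trans (le_of_eq ?_) hκ₀s
    rw [hκ]
    field_simp
  have hX2 : ∀ g, Band ξ (X / 4) g → ‖conjPair u g‖ ≤
      Cu * (2 * X) ^ Ku * (c₂ * X ^ (k₁ * M)) * wnrm κ M g := by
    intro g hg
    have hg0 : Band 0 (2 * X) g := (hg.recenter (η := 0)).mono (by rw [sub_zero]; linarith)
    refine (hu (2 * X) (by linarith) g hg0).trans ?_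
    rw [mul_assoc (Cu * (2 * X) ^ Ku)]
    exact mul_le_mul_of_nonneg_left (hint g) (by positivity)
  have hLS : ∀ g, Band ξ (X / 4) g → ‖conjPair u (frameOp θ θ g)‖ ≤
      D * (Cq * X ^ Kq * (Cp * X ^ Kp) * (c₂ * X ^ (k₁ * M))) * wnrm κ M g := by
    intro g _
    refine (norm_conjPair_frameOp_le hρθ hP hθ hQ0 (hQ.mono (by omega)) u hD0 hD g).trans ?_
    calc _ ≤ D * (Cq * X ^ Kq * (Cp * X ^ Kp) * (c₂ * X ^ (k₁ * M) * wnrm κ M g)) := by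
          gcongr
          exact hint0 g
      _ = _ := by ring
  have hmain := le_of_richardson (S := frameOp θ θ) (L := fun g => ‖conjPair u g‖) (ξ := ξ)
    (r₀ := X / 4) (w := 2 * c * 2 ^ |1 - α| * X ^ (1 - α)) (τ := B⁻¹) (ρ := (1 + ρ) / 2) (κ := κ)
    (D := D * (Cq * X ^ Kq * (Cp * X ^ Kp) * (c₂ * X ^ (k₁ * M))))
    (H := Cu * (2 * X) ^ Ku * (c₂ * X ^ (k₁ * M))) (M := M) (by positivity) (by positivity)
    (by linarith) (by linarith) (by positivity) hκ0
    (fun g => by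
      have e : g = ((B⁻¹ : ℝ) : ℂ) • frameOp θ θ g + (g - ((B⁻¹ : ℝ) : ℂ) • frameOp θ θ g) := by
        abel
      have e2 : conjPair u g = conjPair u (((B⁻¹ : ℝ) : ℂ) • frameOp θ θ g) +
          conjPair u (g - ((B⁻¹ : ℝ) : ℂ) • frameOp θ θ g) := by
        rw [← map_add, ← e]
      change ‖conjPair u g‖ ≤ _
      rw [e2]
      refine (norm_add_le _ _).trans (add_le_add_left (le_of_eq ?_) _)
      rw [conjPair_smul, norm_mul, RCLike.norm_conj, Complex.norm_real,
        Real.norm_of_nonneg (by positivity)])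
    (fun r _ g hg => hg.frameOp_near hc hφ hξ4)
    (fun g hg => wnrm_sub_smul_le (by positivity) (by positivity) hκ0 hκ1 hsmall hcontr hcomm hg)
    hLS hX2 (by positivity) n r f hf hr
  refine hmain.trans ?_
  -- The final bound uses the undamped norm, which does not depend on ξ.
  have hW : wnrm κ M f ≤ wnrm 1 M f := wnrm_mono hκ0.le hκ1 M f
  have hW0 := wnrm_nonneg hκ0.le M f
  have hρn : 0 ≤ ((1 + ρ) / 2) ^ n := by have : 0 ≤ (1 + ρ) / 2 := by linarith
                                         positivity
  have p1 : X ^ (Ku + k₁ * M) ≤ X ^ ((Ku + k₁ * M) + (Kq + Kp + k₁ * M)) :=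
    pow_le_pow_right₀ hξ1 (by omega)
  have p2 : X ^ (Kq + Kp + k₁ * M) ≤ X ^ ((Ku + k₁ * M) + (Kq + Kp + k₁ * M)) :=
    pow_le_pow_right₀ hξ1 (by omega)
  set Y := X ^ ((Ku + k₁ * M) + (Kq + Kp + k₁ * M))
  refine mul_le_mul ?_ hW hW0 (by positivity)
  calc n * (B⁻¹ * (D * (Cq * X ^ Kq * (Cp * X ^ Kp) * (c₂ * X ^ (k₁ * M))))) +
        Cu * (2 * X) ^ Ku * (c₂ * X ^ (k₁ * M)) * ((1 + ρ) / 2) ^ n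
      = B⁻¹ * (Cq * Cp * c₂) * X ^ (Kq + Kp + k₁ * M) * (n * D) +
        Cu * 2 ^ Ku * c₂ * X ^ (Ku + k₁ * M) * ((1 + ρ) / 2) ^ n := by
        rw [pow_add, pow_add, pow_add, mul_pow]; ring
    _ ≤ (Cu * 2 ^ Ku * c₂ + B⁻¹ * (Cq * Cp * c₂)) * Y * (n * D) +
        (Cu * 2 ^ Ku * c₂ + B⁻¹ * (Cq * Cp * c₂)) * Y * ((1 + ρ) / 2) ^ n := by
        have q1 : 0 ≤ Cu * 2 ^ Ku * c₂ := by positivity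
        have q2 : 0 ≤ B⁻¹ * (Cq * Cp * c₂) := by positivity
        gcongr
        · linarith
        · linarith
    _ = _ := by ring

/-! ## Decay of the frame coefficients -/

theorem le_ellNorm {ι : Type} {p : ℝ≥0∞} (hp : 1 ≤ p) (a : ι → ℝ≥0∞) (i : ι) :
    a i ≤ ellNorm p a := by
  unfold ellNorm
  split_ifs with h
  · exact le_iSup a i
  · have hp0 : 0 < p.toReal := ENNReal.toReal_pos (by positivity) h
    calc a i = (a i ^ p.toReal) ^ (1 / p.toReal) := by
          rw [← ENNReal.rpow_mul, mul_one_div_cancel hp0.ne', ENNReal.rpow_one]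
      _ ≤ _ := ENNReal.rpow_le_rpow (ENNReal.le_tsum (f := fun i => a i ^ p.toReal) i)
          (by positivity)

/-- A single entry is dominated by the mixed norm for any exponents p and q, so one β ≥ N suffices.
-/
theorem exists_coefficient_decay {α : ℝ} {φ : 𝓢(E d, ℂ)} {Ω : Lattice d} {p q : ℝ≥0∞}
    (hp : 1 ≤ p) (hq : 1 ≤ q) {u : 𝓢'(E d, ℂ)}
    (hu : ∀ᶠ β : ℝ in atTop, u ∈ modulationSpace α β p q φ Ω) (N : ℕ) :
    ∃ C, 0 ≤ C ∧ ∀ j k, ‖stft α φ u (Ω.node j k) (Ω.freq k)‖ * ‖Ω.freq k‖ ^ N ≤ C := by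
  obtain ⟨β, hβ, hN⟩ := (hu.and (eventually_ge_atTop (N : ℝ))).exists
  have hfin : modulationNorm α β p q φ Ω u < ⊤ := hβ
  refine ⟨(modulationNorm α β p q φ Ω u).toReal, ENNReal.toReal_nonneg, fun j k => ?_⟩
  have h1 : ‖stft α φ u (Ω.node j k) (Ω.freq k)‖ₑ * ENNReal.ofReal ((1 + ‖Ω.freq k‖) ^ β) ≤
      modulationNorm α β p q φ Ω u := by
    refine le_trans ?_ (le_ellNorm hq _ k)
    exact mul_le_mul_left (le_ellNorm hp
      (fun j : Fin d → ℤ => ‖stft α φ u (Ω.node j k) (Ω.freq k)‖ₑ) j) _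
  rw [← ofReal_norm, ← ENNReal.ofReal_mul (norm_nonneg _)] at h1
  have h2 := (ENNReal.ofReal_le_iff_le_toReal hfin.ne).1 h1
  refine le_trans (mul_le_mul_of_nonneg_left ?_ (norm_nonneg _)) h2
  calc ‖Ω.freq k‖ ^ N ≤ (1 + ‖Ω.freq k‖) ^ N := by gcongr; linarith
    _ ≤ _ := by
      rw [← Real.rpow_natCast]
      exact Real.rpow_le_rpow_of_exponent_le (by linarith [norm_nonneg (Ω.freq k)]) hN

/-- With n the integer part of c x^α, the power x^N is at most a constant times (n + 1)^j for j ≥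
N/α, and exponential decay in n absorbs it. -/
theorem exists_pow_floor_mul_le {ρ c α : ℝ} (hρ0 : 0 ≤ ρ) (hρ1 : ρ < 1) (hc : 0 < c) (hα : 0 < α)
    (N : ℕ) : ∃ C, 0 ≤ C ∧ ∀ x : ℝ, 1 ≤ x → ρ ^ ⌊c * x ^ α⌋₊ * x ^ N ≤ C := by
  obtain ⟨j, hj⟩ := exists_nat_ge (N / α)
  -- A positive base is needed to shift the exponent from n to n + 1.
  set r := max ρ (1 / 2) with hr
  have hr0 : 0 < r := lt_of_lt_of_le (by norm_num) (le_max_right _ _)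
  have hr1 : r < 1 := max_lt hρ1 (by norm_num)
  have ht := tendsto_pow_const_mul_const_pow_of_abs_lt_one j (by rwa [abs_of_pos hr0])
  obtain ⟨B, hB⟩ := ht.bddAbove_range
  have hB' : ∀ n : ℕ, (n : ℝ) ^ j * r ^ n ≤ B := fun n => hB ⟨n, rfl⟩
  have hB0 : 0 ≤ B := le_trans (by positivity) (hB' 1)
  refine ⟨(c ^ j)⁻¹ * (r⁻¹ * B), by positivity, fun x hx => ?_⟩
  have hx0 : 0 < x := by linarith
  set n := ⌊c * x ^ α⌋₊
  have h1 : c * x ^ α ≤ (n + 1 : ℕ) := by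
    push_cast
    exact (Nat.lt_floor_add_one _).le
  have h2 : x ^ N ≤ (c ^ j)⁻¹ * ((n + 1 : ℕ) : ℝ) ^ j := by
    rw [le_inv_mul_iff₀ (by positivity)]
    calc c ^ j * x ^ N ≤ c ^ j * (x ^ α) ^ j := by
          gcongr
          rw [← Real.rpow_natCast, ← Real.rpow_natCast, ← Real.rpow_mul hx0.le]
          refine Real.rpow_le_rpow_of_exponent_le hx ?_
          rw [div_le_iff₀ hα] at hj
          linarith
      _ = (c * x ^ α) ^ j := (mul_pow _ _ _).symm
      _ ≤ _ := by gcongr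
  calc ρ ^ n * x ^ N ≤ r ^ n * ((c ^ j)⁻¹ * ((n + 1 : ℕ) : ℝ) ^ j) := by
        gcongr
        exact le_max_left _ _
    _ = (c ^ j)⁻¹ * (r⁻¹ * (((n + 1 : ℕ) : ℝ) ^ j * r ^ (n + 1))) := by
        rw [pow_succ]
        field_simp
    _ ≤ _ := by gcongr; exact hB' (n + 1)

/-- The number of iterations is the integer part of |ξ|^α / (8 Cw), filling the room between |ξ|/8
and |ξ|/4. Then n D decays rapidly because n is polynomial in |ξ| and D is rapidly small, while ρ^n
decays exponentially in |ξ|^α. The moment order M is independent of N. -/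
theorem exists_band_decay (hd : 0 < d) {α : ℝ} (hα : 0 < α) {φ : 𝓢(E d, ℂ)}
    {Ω : Lattice d} (h : IsAdmissiblePair α φ Ω) {p q : ℝ≥0∞}
    (hp : 1 ≤ p) (hq : 1 ≤ q) {u : 𝓢'(E d, ℂ)}
    (hu : ∀ᶠ β : ℝ in atTop, u ∈ modulationSpace α β p q φ Ω) :
    ∃ (R : ℝ) (M : ℕ), 4 ≤ R ∧ ∀ N : ℕ, ∃ C, 0 ≤ C ∧ ∀ ξ : E d, R ≤ ‖ξ‖ →
      ∀ f, Band ξ (‖ξ‖ / 8) f → ‖conjPair u f‖ * ‖ξ‖ ^ N ≤ C * wnrm 1 M f := by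
  obtain ⟨R, C, Cw, ρ, K, M, hR, hC, hCw, hρ0, hρ1, hmain⟩ := exists_richardson_estimate hd hα h u
  refine ⟨R, M, hR, fun N => ?_⟩
  obtain ⟨a, ha⟩ := exists_nat_ge α
  -- Here a pays for the number of iterations, K for the polynomial loss, and N is the decay that
  -- remains.
  obtain ⟨Cd, hCd, hdecay⟩ := exists_coefficient_decay hp hq hu (a + (K + N))
  set c := (8 * Cw)⁻¹ with hc
  have hc0 : 0 < c := by positivity
  obtain ⟨Cρ, hCρ, hfloor⟩ := exists_pow_floor_mul_le hρ0 hρ1 hc0 hα (K + N)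
  refine ⟨C * (c * (Cd * 2 ^ (a + (K + N))) + Cρ), by positivity, fun ξ hξ f hf => ?_⟩
  have hξ4 : 4 ≤ ‖ξ‖ := hR.trans hξ
  have hξ1 : 1 ≤ ‖ξ‖ := by linarith
  have hp' : 0 < ‖ξ‖ := by linarith
  set n := ⌊c * ‖ξ‖ ^ α⌋₊ with hn
  have hn1 : (n : ℝ) ≤ c * ‖ξ‖ ^ α := Nat.floor_le (by positivity)
  set D := Cd * 2 ^ (a + (K + N)) / ‖ξ‖ ^ (a + (K + N)) with hD
  have hD0 : 0 ≤ D := by positivity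
  have hband : ‖ξ‖ / 8 + n * (Cw * ‖ξ‖ ^ (1 - α)) ≤ ‖ξ‖ / 4 := by
    have h1 : n * (Cw * ‖ξ‖ ^ (1 - α)) ≤ c * ‖ξ‖ ^ α * (Cw * ‖ξ‖ ^ (1 - α)) := by gcongr
    have h2 : c * ‖ξ‖ ^ α * (Cw * ‖ξ‖ ^ (1 - α)) = ‖ξ‖ / 8 := by
      calc _ = c * Cw * (‖ξ‖ ^ α * ‖ξ‖ ^ (1 - α)) := by ring
        _ = _ := by
          rw [← Real.rpow_add hp', add_sub_cancel, Real.rpow_one, hc]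
          field_simp
    linarith
  have hcoef : ∀ z, ‖conjPair u (nearPacket α φ Ω ξ z)‖ ≤ D := by
    intro z
    have h1 := hdecay z.1.1 z.1.2
    rw [hD, le_div_iff₀ (by positivity)]
    have h2 : ‖ξ‖ ≤ 2 * ‖Ω.freq z.1.2‖ := by linarith [z.2.1]
    calc ‖conjPair u (nearPacket α φ Ω ξ z)‖ * ‖ξ‖ ^ (a + (K + N))
        ≤ ‖conjPair u (nearPacket α φ Ω ξ z)‖ * (2 * ‖Ω.freq z.1.2‖) ^ (a + (K + N)) := by gcongr
      _ = (‖stft α φ u (Ω.node z.1.1 z.1.2) (Ω.freq z.1.2)‖ * ‖Ω.freq z.1.2‖ ^ (a + (K + N))) *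
          2 ^ (a + (K + N)) := by rw [stft_eq_conjPair, mul_pow]; unfold nearPacket; ring
      _ ≤ _ := by gcongr
  have h1 := hmain ξ hξ D hD0 hcoef n (‖ξ‖ / 8) f hf hband
  have hW := wnrm_nonneg zero_le_one M f
  have h2 : n * D * ‖ξ‖ ^ (K + N) ≤ c * (Cd * 2 ^ (a + (K + N))) := by
    have h3 : (n : ℝ) ≤ c * ‖ξ‖ ^ a := hn1.trans (by gcongr; exact rpow_le_pow_of_le hξ1 ha)
    calc n * D * ‖ξ‖ ^ (K + N) ≤ c * ‖ξ‖ ^ a * D * ‖ξ‖ ^ (K + N) := by gcongr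
      _ = _ := by rw [hD, pow_add ‖ξ‖ a]; field_simp
  calc ‖conjPair u f‖ * ‖ξ‖ ^ N ≤ C * ‖ξ‖ ^ K * (n * D + ρ ^ n) * wnrm 1 M f * ‖ξ‖ ^ N := by gcongr
    _ = C * (n * D * ‖ξ‖ ^ (K + N) + ρ ^ n * ‖ξ‖ ^ (K + N)) * wnrm 1 M f := by
        rw [pow_add]; ring
    _ ≤ _ := by
        gcongr
        exact hfloor _ hξ1

/-! ## Seminorm estimates for localized windows -/

/-- Dilation `f ↦ f (l ·)`. -/
noncomputable def dil (l : ℝ) (hl : l ≠ 0) : 𝓢(E d, ℂ) →L[ℂ] 𝓢(E d, ℂ) :=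
  SchwartzMap.compCLMOfContinuousLinearEquiv ℂ
    (ContinuousLinearEquiv.smulLeft (R₁ := ℝ) (M₁ := E d) (Units.mk0 l hl))

theorem dil_apply (l : ℝ) (hl : l ≠ 0) (f : 𝓢(E d, ℂ)) (t : E d) : dil l hl f t = f (l • t) := rfl

theorem norm_iteratedFDeriv_dil_le {l : ℝ} (hl : 0 < l) (f : 𝓢(E d, ℂ)) (n : ℕ) (t : E d) :
    ‖iteratedFDeriv ℝ n (dil l hl.ne' f) t‖ ≤ l ^ n * SchwartzMap.seminorm ℝ 0 n f := by
  have e : (dil l hl.ne' f : E d → ℂ) = f ∘ (l • ContinuousLinearMap.id ℝ (E d)) := rfl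
  rw [e, ContinuousLinearMap.iteratedFDeriv_comp_right (n := ∞) _ (f.smooth _) t
    (by exact_mod_cast le_top)]
  refine (ContinuousMultilinearMap.norm_compContinuousLinearMap_le _ _).trans ?_
  rw [Finset.prod_const, Finset.card_univ, Fintype.card_fin, mul_comm]
  have h1 : ‖l • ContinuousLinearMap.id ℝ (E d)‖ ≤ l := by
    rw [norm_smul, Real.norm_of_nonneg hl.le]
    exact mul_le_of_le_one_right hl.le ContinuousLinearMap.norm_id_le
  gcongr
  exact SchwartzMap.norm_iteratedFDeriv_le_seminorm ℝ f n _

/-- Multiplication of Schwartz functions. -/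
noncomputable def smul' (m f : 𝓢(E d, ℂ)) : 𝓢(E d, ℂ) := SchwartzMap.smulLeftCLM ℂ m f

theorem smul'_apply (m f : 𝓢(E d, ℂ)) (t : E d) : smul' m f t = m t * f t := by
  rw [smul', SchwartzMap.smulLeftCLM_apply_apply m.hasTemperateGrowth, smul_eq_mul]

theorem norm_iteratedFDeriv_smul'_le (m f : 𝓢(E d, ℂ)) (n : ℕ) (t : E d) :
    ‖iteratedFDeriv ℝ n (smul' m f) t‖ ≤ ∑ i ∈ Finset.range (n + 1),
      (n.choose i : ℝ) * ‖iteratedFDeriv ℝ i m t‖ * ‖iteratedFDeriv ℝ (n - i) f t‖ := by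
  have e : (smul' m f : E d → ℂ) = fun t => m t * f t := funext (smul'_apply m f)
  rw [e]
  exact norm_iteratedFDeriv_mul_le (N := ∞) (m.smooth _) (f.smooth _) t (by exact_mod_cast le_top)

/-- The product of `χ` with a rescaled and translated window. -/
noncomputable def cutWindow (χ ψ : 𝓢(E d, ℂ)) (l : ℝ) (hl : l ≠ 0) (x : E d) : 𝓢(E d, ℂ) :=
  smul' χ (SchwartzMap.compSubConstCLM ℂ x (dil l hl ψ))

theorem cutWindow_apply (χ ψ : 𝓢(E d, ℂ)) (l : ℝ) (hl : l ≠ 0) (x t : E d) :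
    cutWindow χ ψ l hl x t = χ t * ψ (l • (t - x)) := by
  rw [cutWindow, smul'_apply, SchwartzMap.compSubConstCLM_apply, dil_apply]

/-- Each derivative costs at most max(1, l). The translate of ψ enters only through sup norms, so
the bound is uniform in x and spatial decay comes from χ. -/
theorem norm_iteratedFDeriv_cutWindow_le (χ ψ : 𝓢(E d, ℂ)) {l : ℝ} (hl : 0 < l) (x : E d)
    (n : ℕ) (t : E d) :
    ‖iteratedFDeriv ℝ n (cutWindow χ ψ l hl.ne' x) t‖ ≤ max 1 l ^ n *
      ∑ i ∈ Finset.range (n + 1), (n.choose i : ℝ) * SchwartzMap.seminorm ℝ 0 (n - i) ψ *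
        ‖iteratedFDeriv ℝ i χ t‖ := by
  refine (norm_iteratedFDeriv_smul'_le _ _ n t).trans ?_
  rw [Finset.mul_sum]
  refine Finset.sum_le_sum fun i _ => ?_
  have e : (SchwartzMap.compSubConstCLM ℂ x (dil l hl.ne' ψ) : E d → ℂ) =
    fun t => dil l hl.ne' ψ (t - x) := rfl
  rw [e, iteratedFDeriv_comp_sub]
  have h1 : ‖iteratedFDeriv ℝ (n - i) (dil l hl.ne' ψ) (t - x)‖ ≤
      max 1 l ^ n * SchwartzMap.seminorm ℝ 0 (n - i) ψ := by
    refine (norm_iteratedFDeriv_dil_le hl ψ (n - i) _).trans ?_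
    gcongr
    calc l ^ (n - i) ≤ max 1 l ^ (n - i) := by gcongr; exact le_max_right _ _
      _ ≤ _ := pow_le_pow_right₀ (le_max_left _ _) (Nat.sub_le _ _)
  calc _ ≤ (n.choose i : ℝ) * ‖iteratedFDeriv ℝ i χ t‖ *
        (max 1 l ^ n * SchwartzMap.seminorm ℝ 0 (n - i) ψ) := by gcongr
    _ = _ := by ring

/-- Powers of the frequency are derivatives of the cut window, costing max(1, l)^k; derivatives in
frequency are spatial moments, paid for by χ. -/
theorem exists_seminorm_fourier_cutWindow_le (χ ψ : 𝓢(E d, ℂ)) (k n : ℕ) :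
    ∃ C, 0 ≤ C ∧ ∀ (l : ℝ) (hl : 0 < l) (x : E d),
      SchwartzMap.seminorm ℝ k n (𝓕 (cutWindow χ ψ l hl.ne' x)) ≤ C * max 1 l ^ k := by
  have hpi := Real.pi_pos
  refine ⟨(2 * Real.pi) ^ n * (2 * n + 2) ^ k * ∑ p ∈ Finset.range (n + 1) ×ˢ Finset.range (k + 1),
    ∑ i ∈ Finset.range (p.2 + 1), (p.2.choose i : ℝ) * SchwartzMap.seminorm ℝ 0 (p.2 - i) ψ *
      ∫ v, ‖v‖ ^ p.1 * ‖iteratedFDeriv ℝ i χ v‖, ?_, fun l hl x => ?_⟩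
  · refine mul_nonneg (by positivity) (Finset.sum_nonneg fun p _ => Finset.sum_nonneg fun i _ => ?_)
    exact mul_nonneg (mul_nonneg (by positivity) (apply_nonneg _ _))
      (integral_nonneg fun v => by positivity)
  set h := cutWindow χ ψ l hl.ne' x
  have hm : 1 ≤ max 1 l := le_max_left _ _
  have hint : ∀ a b : ℕ, b ≤ k → ∫ v, ‖v‖ ^ a * ‖iteratedFDeriv ℝ b h v‖ ≤ max 1 l ^ k *
      ∑ i ∈ Finset.range (b + 1), (b.choose i : ℝ) * SchwartzMap.seminorm ℝ 0 (b - i) ψ *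
      ∫ v, ‖v‖ ^ a * ‖iteratedFDeriv ℝ i χ v‖ := by
    intro a b hb
    have e : max 1 l ^ b * ∑ i ∈ Finset.range (b + 1), (b.choose i : ℝ) *
        SchwartzMap.seminorm ℝ 0 (b - i) ψ * ∫ v, ‖v‖ ^ a * ‖iteratedFDeriv ℝ i χ v‖ =
        ∫ v, max 1 l ^ b * ∑ i ∈ Finset.range (b + 1), (b.choose i : ℝ) *
        SchwartzMap.seminorm ℝ 0 (b - i) ψ * (‖v‖ ^ a * ‖iteratedFDeriv ℝ i χ v‖) := by
      rw [integral_const_mul, integral_finsetSum _ fun i _ =>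
        (χ.integrable_pow_mul_iteratedFDeriv volume a i).const_mul _]
      simp only [integral_const_mul]
    have h1 : ∫ v, ‖v‖ ^ a * ‖iteratedFDeriv ℝ b h v‖ ≤ max 1 l ^ b *
      ∑ i ∈ Finset.range (b + 1), (b.choose i : ℝ) * SchwartzMap.seminorm ℝ 0 (b - i) ψ *
      ∫ v, ‖v‖ ^ a * ‖iteratedFDeriv ℝ i χ v‖ := by
      rw [e]
      refine integral_mono (h.integrable_pow_mul_iteratedFDeriv volume a b)
        ((integrable_finsetSum _ fun i _ =>
          (χ.integrable_pow_mul_iteratedFDeriv volume a i).const_mul _).const_mul _) fun v => ?_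
      change ‖v‖ ^ a * ‖iteratedFDeriv ℝ b h v‖ ≤ _
      refine (mul_le_mul_of_nonneg_left (norm_iteratedFDeriv_cutWindow_le χ ψ hl x b v)
        (by positivity)).trans (le_of_eq ?_)
      rw [mul_left_comm, Finset.mul_sum]
      congr 1
      exact Finset.sum_congr rfl fun i _ => by ring
    refine h1.trans (mul_le_mul_of_nonneg_right (pow_le_pow_right₀ hm hb) ?_)
    exact Finset.sum_nonneg fun i _ => mul_nonneg (mul_nonneg (by positivity) (apply_nonneg _ _))
      (integral_nonneg fun v => by positivity)
  refine SchwartzMap.seminorm_le_bound ℝ k n _ ?_ fun w => ?_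
  · refine mul_nonneg (mul_nonneg (by positivity)
      (Finset.sum_nonneg fun p _ => Finset.sum_nonneg fun i _ => ?_)) (by positivity)
    exact mul_nonneg (mul_nonneg (by positivity) (apply_nonneg _ _))
      (integral_nonneg fun v => by positivity)
  rw [SchwartzMap.fourier_coe]
  refine (Real.pow_mul_norm_iteratedFDeriv_fourier_le (f := (h : E d → ℂ)) (K := ⊤) (N := ⊤)
    (h.smooth _) (fun k n _ _ => h.integrable_pow_mul_iteratedFDeriv volume k n)
    (k := n) (n := k) le_top le_top w).trans ?_
  rw [mul_assoc ((2 * Real.pi) ^ n * (2 * n + 2) ^ k), Finset.sum_mul]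
  refine mul_le_mul_of_nonneg_left (Finset.sum_le_sum fun p hp => ?_) (by positivity)
  rw [mul_comm]
  refine hint p.1 p.2 ?_
  have := (Finset.mem_product.1 hp).2
  exact Nat.lt_succ_iff.1 (Finset.mem_range.1 this)

theorem seminorm_smul'_dil_le (m f : 𝓢(E d, ℂ)) {l : ℝ} (hl : 0 < l) (hl1 : l ≤ 1) (k n : ℕ) :
    SchwartzMap.seminorm ℝ k n (smul' (dil l hl.ne' m) f) ≤
      ∑ i ∈ Finset.range (n + 1), (n.choose i : ℝ) * SchwartzMap.seminorm ℝ 0 i m *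
        SchwartzMap.seminorm ℝ k (n - i) f := by
  refine SchwartzMap.seminorm_le_bound ℝ k n _ (Finset.sum_nonneg fun i _ =>
    mul_nonneg (mul_nonneg (by positivity) (apply_nonneg _ _)) (apply_nonneg _ _)) fun t => ?_
  refine (mul_le_mul_of_nonneg_left (norm_iteratedFDeriv_smul'_le _ f n t)
    (by positivity)).trans ?_
  rw [Finset.mul_sum]
  refine Finset.sum_le_sum fun i _ => ?_
  have h1 : ‖iteratedFDeriv ℝ i (dil l hl.ne' m) t‖ ≤ SchwartzMap.seminorm ℝ 0 i m :=
    (norm_iteratedFDeriv_dil_le hl m i t).trans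
      (mul_le_of_le_one_left (apply_nonneg _ _) (pow_le_one₀ hl.le hl1))
  have h2 := SchwartzMap.le_seminorm ℝ k (n - i) f t
  have h3 : 0 ≤ SchwartzMap.seminorm ℝ 0 i m := apply_nonneg _ _
  calc ‖t‖ ^ k * ((n.choose i : ℝ) * ‖iteratedFDeriv ℝ i (dil l hl.ne' m) t‖ *
        ‖iteratedFDeriv ℝ (n - i) f t‖)
      = (n.choose i : ℝ) * ‖iteratedFDeriv ℝ i (dil l hl.ne' m) t‖ *
        (‖t‖ ^ k * ‖iteratedFDeriv ℝ (n - i) f t‖) := by ring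
    _ ≤ _ := by gcongr

theorem exists_seminorm_smul'_fourier_cutWindow_le (m χ ψ : 𝓢(E d, ℂ)) (k n : ℕ) :
    ∃ C, 0 ≤ C ∧ ∀ (ε : ℝ) (hε : 0 < ε), ε ≤ 1 → ∀ (l : ℝ) (hl : 0 < l) (x : E d),
      SchwartzMap.seminorm ℝ k n (smul' (dil ε hε.ne' m) (𝓕 (cutWindow χ ψ l hl.ne' x))) ≤
        C * max 1 l ^ k := by
  choose C hC0 hC using fun i => exists_seminorm_fourier_cutWindow_le χ ψ k i
  refine ⟨∑ i ∈ Finset.range (n + 1), (n.choose i : ℝ) * SchwartzMap.seminorm ℝ 0 i m * C (n - i),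
    Finset.sum_nonneg fun i _ => mul_nonneg (mul_nonneg (by positivity) (apply_nonneg _ _))
      (hC0 _), fun ε hε hε1 l hl x => (seminorm_smul'_dil_le m _ hε hε1 k n).trans ?_⟩
  rw [Finset.sum_mul]
  refine Finset.sum_le_sum fun i _ => ?_
  rw [mul_assoc _ (C (n - i))]
  exact mul_le_mul_of_nonneg_left (hC (n - i) l hl x)
    (mul_nonneg (by positivity) (apply_nonneg _ _))

/-- The difference lives where ‖t‖ ≥ 1/(2ε), so each of N additional powers of ‖t‖ buys a factor 2ε
at the price of one factor max(1, l). -/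
theorem exists_seminorm_sub_smul'_fourier_cutWindow_le (m χ ψ : 𝓢(E d, ℂ))
    (hm : ∀ t, ‖t‖ ≤ 1 / 2 → m t = 1) (k n N : ℕ) :
    ∃ C, 0 ≤ C ∧ ∀ (ε : ℝ) (hε : 0 < ε), ε ≤ 1 → ∀ (l : ℝ) (hl : 0 < l) (x : E d),
      SchwartzMap.seminorm ℝ k n (𝓕 (cutWindow χ ψ l hl.ne' x) -
        smul' (dil ε hε.ne' m) (𝓕 (cutWindow χ ψ l hl.ne' x))) ≤
        C * ε ^ N * max 1 l ^ (k + N) := by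
  obtain ⟨C₁, hC₁, h1⟩ := exists_seminorm_fourier_cutWindow_le χ ψ (k + N) n
  obtain ⟨C₂, hC₂, h2⟩ := exists_seminorm_smul'_fourier_cutWindow_le m χ ψ (k + N) n
  refine ⟨2 ^ N * (C₁ + C₂), by positivity, fun ε hε hε1 l hl x => ?_⟩
  set f := 𝓕 (cutWindow χ ψ l hl.ne' x)
  set g := f - smul' (dil ε hε.ne' m) f with hg
  have hgN : SchwartzMap.seminorm ℝ (k + N) n g ≤ (C₁ + C₂) * max 1 l ^ (k + N) := by
    rw [add_mul]
    exact (map_sub_le_add (SchwartzMap.seminorm ℝ (k + N) n) _ _).trans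
      (add_le_add (h1 l hl x) (h2 ε hε hε1 l hl x))
  have hmax : 0 < max 1 l := lt_of_lt_of_le one_pos (le_max_left _ _)
  refine SchwartzMap.seminorm_le_bound ℝ k n _ (by positivity) fun t => ?_
  by_cases ht : iteratedFDeriv ℝ n g t = 0
  · rw [ht, norm_zero, mul_zero]; positivity
  have hsupp : tsupport (g : E d → ℂ) ⊆ {t | 1 / 2 ≤ ‖ε • t‖} := by
    refine closure_minimal (fun t ht => ?_) (isClosed_le continuous_const (by fun_prop))
    by_contra hlt
    refine ht ?_
    rw [hg, sub_apply, smul'_apply, dil_apply, hm _ (not_le.1 hlt).le, one_mul, sub_self]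
  have h3 : 1 / 2 ≤ ‖ε • t‖ := hsupp (support_iteratedFDeriv_subset n ht)
  rw [norm_smul, Real.norm_of_nonneg hε.le] at h3
  have h4 : 1 ≤ (2 * ε) ^ N * ‖t‖ ^ N := by
    rw [← mul_pow]
    exact one_le_pow₀ (by linarith)
  have h5 := SchwartzMap.le_seminorm ℝ (k + N) n g t
  calc ‖t‖ ^ k * ‖iteratedFDeriv ℝ n g t‖
      ≤ ((2 * ε) ^ N * ‖t‖ ^ N) * (‖t‖ ^ k * ‖iteratedFDeriv ℝ n g t‖) :=
        le_mul_of_one_le_left (by positivity) h4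
    _ = (2 * ε) ^ N * (‖t‖ ^ (k + N) * ‖iteratedFDeriv ℝ n g t‖) := by rw [pow_add]; ring
    _ ≤ (2 * ε) ^ N * ((C₁ + C₂) * max 1 l ^ (k + N)) := by
        exact mul_le_mul_of_nonneg_left (h5.trans hgN) (by positivity)
    _ = _ := by rw [mul_pow]; ring

theorem seminorm_compSubConst_le (a : E d) (f : 𝓢(E d, ℂ)) (k n : ℕ) :
    SchwartzMap.seminorm ℝ k n (SchwartzMap.compSubConstCLM ℂ a f) ≤
      2 ^ k * (SchwartzMap.seminorm ℝ k n f + ‖a‖ ^ k * SchwartzMap.seminorm ℝ 0 n f) := by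
  have hn : ∀ k, 0 ≤ SchwartzMap.seminorm ℝ k n f := fun k => apply_nonneg _ _
  have := hn 0
  have := hn k
  refine SchwartzMap.seminorm_le_bound ℝ k n _ (by positivity) fun t => ?_
  have e : (SchwartzMap.compSubConstCLM ℂ a f : E d → ℂ) = fun t => f (t - a) := rfl
  rw [e, iteratedFDeriv_comp_sub]
  have h1 : ‖t‖ ^ k ≤ 2 ^ k * (‖t - a‖ ^ k + ‖a‖ ^ k) := by
    have h2 : ‖t‖ ≤ ‖t - a‖ + ‖a‖ := by simpa using norm_add_le (t - a) a
    have h3 : ‖t‖ ≤ 2 * max ‖t - a‖ ‖a‖ := by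
      linarith [le_max_left ‖t - a‖ ‖a‖, le_max_right ‖t - a‖ ‖a‖]
    calc ‖t‖ ^ k ≤ (2 * max ‖t - a‖ ‖a‖) ^ k := by gcongr
      _ = 2 ^ k * max ‖t - a‖ ‖a‖ ^ k := mul_pow _ _ _
      _ ≤ _ := by
          gcongr
          rcases max_choice ‖t - a‖ ‖a‖ with h | h <;> rw [h] <;>
            linarith [pow_nonneg (norm_nonneg (t - a)) k, pow_nonneg (norm_nonneg a) k]
  have h4 := SchwartzMap.le_seminorm ℝ k n f (t - a)
  have h5 := SchwartzMap.norm_iteratedFDeriv_le_seminorm ℝ f n (t - a)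
  calc ‖t‖ ^ k * ‖iteratedFDeriv ℝ n f (t - a)‖
      ≤ 2 ^ k * (‖t - a‖ ^ k + ‖a‖ ^ k) * ‖iteratedFDeriv ℝ n f (t - a)‖ := by gcongr
    _ = 2 ^ k * (‖t - a‖ ^ k * ‖iteratedFDeriv ℝ n f (t - a)‖ +
        ‖a‖ ^ k * ‖iteratedFDeriv ℝ n f (t - a)‖) := by ring
    _ ≤ _ := by gcongr

/-! ## Decay of the short-time Fourier transform -/

theorem exists_bump (c : E d) :
    ∃ m : 𝓢(E d, ℂ), HasCompactSupport m ∧ (∀ t, (starRingEnd ℂ) (m t) = m t) ∧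
      (∀ t, ‖t - c‖ ≤ 1 / 2 → m t = 1) ∧ ∀ t, m t ≠ 0 → ‖t - c‖ ≤ 1 := by
  let b : ContDiffBump c := ⟨1 / 2, 1, by norm_num, by norm_num⟩
  have h1 : HasCompactSupport fun t => ((b t : ℝ) : ℂ) :=
    b.hasCompactSupport.comp_left Complex.ofReal_zero
  refine ⟨h1.toSchwartzMap (Complex.ofRealCLM.contDiff.comp b.contDiff), h1, fun t => ?_,
    fun t ht => ?_, fun t ht => ?_⟩
  · exact Complex.conj_ofReal _
  · change ((b t : ℝ) : ℂ) = 1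
    rw [b.one_of_mem_closedBall (by rwa [Metric.mem_closedBall, dist_eq_norm]), Complex.ofReal_one]
  · by_contra hlt
    refine ht ?_
    change ((b t : ℝ) : ℂ) = 0
    rw [b.zero_of_le_dist (by rw [dist_eq_norm]; exact (not_le.1 hlt).le), Complex.ofReal_zero]

/-- The sum of the Schwartz seminorms of index below `J`. -/
noncomputable def tot (J : ℕ) (f : 𝓢(E d, ℂ)) : ℝ :=
  ∑ p ∈ Finset.range J ×ˢ Finset.range J, SchwartzMap.seminorm ℝ p.1 p.2 f

theorem tot_mono {J J' : ℕ} (h : J ≤ J') (f : 𝓢(E d, ℂ)) : tot J f ≤ tot J' f :=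
  Finset.sum_le_sum_of_subset_of_nonneg
    (Finset.product_subset_product (Finset.range_mono h) (Finset.range_mono h))
    fun _ _ _ => apply_nonneg _ _

theorem exists_tot_bound {G : Type*} [NormedAddCommGroup G] [NormedSpace ℝ G]
    (T : 𝓢(E d, ℂ) →L[ℝ] G) : ∃ (J : ℕ) (C : ℝ), 0 ≤ C ∧ ∀ f, ‖T f‖ ≤ C * tot J f := by
  obtain ⟨s, C, hC, h⟩ := exists_seminorm_bound T
  refine ⟨max (s.sup Prod.fst) (s.sup Prod.snd) + 1, C, hC, fun f => (h f).trans ?_⟩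
  refine mul_le_mul_of_nonneg_left ?_ hC
  refine Finset.sum_le_sum_of_subset_of_nonneg (fun p hp => ?_) fun _ _ _ => apply_nonneg _ _
  rw [Finset.mem_product, Finset.mem_range, Finset.mem_range]
  have h1 : p.1 ≤ s.sup Prod.fst := Finset.le_sup (f := Prod.fst) hp
  have h2 : p.2 ≤ s.sup Prod.snd := Finset.le_sup (f := Prod.snd) hp
  omega

theorem exists_conjPair_fourierInv_le (u : 𝓢'(E d, ℂ)) :
    ∃ (J : ℕ) (C : ℝ), 0 ≤ C ∧ ∀ f : 𝓢(E d, ℂ), ‖conjPair u (𝓕⁻ f)‖ ≤ C * tot J f :=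
  exists_tot_bound ((conjPair u).comp ((FourierTransform.fourierInvCLM ℂ 𝓢(E d, ℂ) :
    𝓢(E d, ℂ) →L[ℂ] 𝓢(E d, ℂ)).restrictScalars ℝ))

theorem exists_wnrm_fourierInv_le (M : ℕ) :
    ∃ (J : ℕ) (C : ℝ), 0 ≤ C ∧ ∀ f : 𝓢(E d, ℂ), wnrm 1 M (𝓕⁻ f) ≤ C * tot J f := by
  have h : ∀ (i : Fin d) (m : ℕ), ∃ (J : ℕ) (C : ℝ), 0 ≤ C ∧ ∀ f : 𝓢(E d, ℂ),
      nrm ((pos i)^[m] (𝓕⁻ f)) ≤ C * tot J f := fun i m => by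
    obtain ⟨J, C, hC, h⟩ := exists_tot_bound (((SchwartzMap.toLpCLM ℂ ℂ 2
      (volume : Measure (E d))).comp (((pos i) ^ m).comp (FourierTransform.fourierInvCLM ℂ
        𝓢(E d, ℂ) : 𝓢(E d, ℂ) →L[ℂ] 𝓢(E d, ℂ)))).restrictScalars ℝ)
    refine ⟨J, C, hC, fun f => ?_⟩
    rw [nrm_eq_norm_toLpCLM, ← FunLike.coe_pow_eq_iterate]
    exact h f
  choose J C hC0 hC using h
  let J' := Finset.univ.sup fun i => (Finset.range (M + 1)).sup (J i)
  refine ⟨J', ∑ i, ∑ m ∈ Finset.range (M + 1), C i m,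
    Finset.sum_nonneg fun i _ => Finset.sum_nonneg fun m _ => hC0 i m, fun f => ?_⟩
  rw [wnrm, Finset.sum_mul]
  refine Finset.sum_le_sum fun i _ => ?_
  rw [Finset.sum_mul]
  refine Finset.sum_le_sum fun m hm => ?_
  rw [one_pow, one_mul]
  refine (hC i m f).trans (mul_le_mul_of_nonneg_left (tot_mono ?_ f) (hC0 i m))
  exact (Finset.le_sup (f := J i) hm).trans
    (Finset.le_sup (f := fun i => (Finset.range (M + 1)).sup (J i)) (Finset.mem_univ i))

/-- The frequency shift by `ξ`, with the normalisation of the packets. -/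
noncomputable def shiftSpec (α : ℝ) (ξ : E d) : 𝓢(E d, ℂ) →L[ℂ] 𝓢(E d, ℂ) :=
  ((‖ξ‖ ^ ((d : ℝ) / 2 * (1 - α)) : ℝ) : ℂ) • SchwartzMap.compSubConstCLM ℂ ((2 * Real.pi)⁻¹ • ξ)

theorem shiftSpec_apply (α : ℝ) (ξ : E d) (f : 𝓢(E d, ℂ)) (t : E d) :
    shiftSpec α ξ f t =
      ((‖ξ‖ ^ ((d : ℝ) / 2 * (1 - α)) : ℝ) : ℂ) * f (t - (2 * Real.pi)⁻¹ • ξ) := rfl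

theorem fourier_smul'_packet (α : ℝ) (χ ψ : 𝓢(E d, ℂ)) (x ξ : E d) (hξ : ξ ≠ 0)
    (hl : ‖ξ‖ ^ (1 - α) ≠ 0) :
    𝓕 (smul' χ (packet α ψ x ξ)) = shiftSpec α ξ (𝓕 (cutWindow χ ψ (‖ξ‖ ^ (1 - α)) hl x)) := by
  ext ζ
  rw [shiftSpec_apply, SchwartzMap.fourier_coe, SchwartzMap.fourier_coe, Real.fourier_eq',
    Real.fourier_eq', ← integral_const_mul]
  refine integral_congr_ae (Eventually.of_forall fun t => ?_)
  simp only [smul_eq_mul]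
  rw [smul'_apply, packet_apply α ψ x ξ hξ t, cutWindow_apply]
  have hexp : Complex.exp (((-2 * Real.pi * inner ℝ t ζ : ℝ) : ℂ) * Complex.I) *
      Complex.exp (Complex.I * ((inner ℝ t ξ : ℝ) : ℂ)) =
      Complex.exp (((-2 * Real.pi * inner ℝ t (ζ - (2 * Real.pi)⁻¹ • ξ) : ℝ) : ℂ)
        * Complex.I) := by
    have hin : (-2 * Real.pi * inner ℝ t (ζ - (2 * Real.pi)⁻¹ • ξ) : ℝ)
        = -2 * Real.pi * inner ℝ t ζ + inner ℝ t ξ := by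
      have hpi := Real.pi_ne_zero
      rw [inner_sub_right, real_inner_smul_right]
      field_simp
      ring
    rw [hin, ← Complex.exp_add, mul_comm Complex.I, ← add_mul, ← Complex.ofReal_add]
  linear_combination ((‖ξ‖ ^ ((d : ℝ) / 2 * (1 - α)) : ℝ) : ℂ) * χ t *
    ψ (‖ξ‖ ^ (1 - α) • (t - x)) * hexp

theorem exists_seminorm_shiftSpec_le (d : ℕ) (α : ℝ) : ∃ b : ℕ, ∀ (ξ : E d), 1 ≤ ‖ξ‖ →
    ∀ (f : 𝓢(E d, ℂ)) (k n : ℕ) (B : ℝ), SchwartzMap.seminorm ℝ k n f ≤ B →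
      SchwartzMap.seminorm ℝ 0 n f ≤ B →
      SchwartzMap.seminorm ℝ k n (shiftSpec α ξ f) ≤ 2 ^ (k + 1) * ‖ξ‖ ^ (b + k) * B := by
  obtain ⟨b, hb⟩ := exists_nat_ge ((d : ℝ) / 2 * (1 - α))
  refine ⟨b, fun ξ hξ f k n B h1 h2 => ?_⟩
  have hB : 0 ≤ B := (apply_nonneg _ _).trans h1
  have h3 : ‖ξ‖ ^ ((d : ℝ) / 2 * (1 - α)) ≤ ‖ξ‖ ^ b := rpow_le_pow_of_le hξ hb
  have h4 : ‖(2 * Real.pi)⁻¹ • ξ‖ ≤ ‖ξ‖ := by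
    rw [norm_smul, norm_inv, Real.norm_of_nonneg (by positivity)]
    refine mul_le_of_le_one_left (norm_nonneg _) (inv_le_one_of_one_le₀ ?_)
    linarith [Real.two_le_pi]
  have h5 := seminorm_compSubConst_le ((2 * Real.pi)⁻¹ • ξ) f k n
  have h6 : SchwartzMap.seminorm ℝ k n (shiftSpec α ξ f) = ‖ξ‖ ^ ((d : ℝ) / 2 * (1 - α)) *
      SchwartzMap.seminorm ℝ k n (SchwartzMap.compSubConstCLM ℂ ((2 * Real.pi)⁻¹ • ξ) f) := by
    have h7 : shiftSpec α ξ f = (‖ξ‖ ^ ((d : ℝ) / 2 * (1 - α)) : ℝ) •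
        SchwartzMap.compSubConstCLM ℂ ((2 * Real.pi)⁻¹ • ξ) f := by
      ext t
      rw [shiftSpec_apply, smul_apply, Complex.real_smul, SchwartzMap.compSubConstCLM_apply]
    rw [h7, map_smul_eq_mul, Real.norm_of_nonneg (by positivity)]
  rw [h6]
  have h8 : 1 ≤ ‖ξ‖ ^ k := one_le_pow₀ hξ
  have h9 : ‖(2 * Real.pi)⁻¹ • ξ‖ ^ k ≤ ‖ξ‖ ^ k := pow_le_pow_left₀ (norm_nonneg _) h4 k
  calc _ ≤ ‖ξ‖ ^ b * (2 ^ k * (‖ξ‖ ^ k * B + ‖ξ‖ ^ k * B)) := by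
        refine mul_le_mul h3 (h5.trans ?_) (apply_nonneg _ _) (by positivity)
        refine mul_le_mul_of_nonneg_left (add_le_add ?_ ?_) (by positivity)
        · exact h1.trans (le_mul_of_one_le_left hB h8)
        · exact mul_le_mul h9 h2 (apply_nonneg _ _) (by positivity)
    _ = _ := by rw [pow_add, pow_succ]; ring

theorem max_one_rpow_le {α a : ℝ} (ha : 1 ≤ a) : max 1 (a ^ (1 - α)) ≤ a ^ max 0 (1 - α) := by
  refine max_le (Real.one_le_rpow ha (le_max_left _ _)) ?_
  exact Real.rpow_le_rpow_of_exponent_le ha (le_max_right _ _)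

/-- The part of the spectrum of a localized packet close to its frequency. -/
noncomputable def mainSpec (α : ℝ) (m χ ψ : 𝓢(E d, ℂ)) (x ξ : E d) (hξ : 0 < ‖ξ‖) : 𝓢(E d, ℂ) :=
  smul' (dil (16 * Real.pi / ‖ξ‖) (by positivity) m)
    (𝓕 (cutWindow χ ψ (‖ξ‖ ^ (1 - α)) (Real.rpow_pos_of_pos hξ _).ne' x))

/-- The part of the spectrum of a localized packet away from its frequency. -/
noncomputable def tailSpec (α : ℝ) (m χ ψ : 𝓢(E d, ℂ)) (x ξ : E d) (hξ : 0 < ‖ξ‖) : 𝓢(E d, ℂ) :=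
  𝓕 (cutWindow χ ψ (‖ξ‖ ^ (1 - α)) (Real.rpow_pos_of_pos hξ _).ne' x) - mainSpec α m χ ψ x ξ hξ

theorem sixteen_pi_div_le_one {a : ℝ} (ha : 64 ≤ a) : 16 * Real.pi / a ≤ 1 := by
  rw [div_le_one (by linarith)]
  linarith [Real.pi_le_four]

theorem smul'_packet_eq (α : ℝ) (m χ ψ : 𝓢(E d, ℂ)) (x ξ : E d) (hξ : 0 < ‖ξ‖) :
    smul' χ (packet α ψ x ξ) = 𝓕⁻ (shiftSpec α ξ (mainSpec α m χ ψ x ξ hξ)) +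
      𝓕⁻ (shiftSpec α ξ (tailSpec α m χ ψ x ξ hξ)) := by
  have h1 : smul' χ (packet α ψ x ξ) = 𝓕⁻ (𝓕 (smul' χ (packet α ψ x ξ))) :=
    (FourierTransform.fourierInv_fourier_eq _).symm
  rw [h1, fourier_smul'_packet α χ ψ x ξ (norm_pos_iff.1 hξ) (Real.rpow_pos_of_pos hξ _).ne',
    ← FourierTransform.fourierInv_add, ← map_add, tailSpec, add_sub_cancel]

/-- The cutoff restricts the displacement in ζ to |ξ|/(16π); passing to angular frequency multiplies
by 2π and gives |ξ|/8. -/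
theorem band_mainSpec (α : ℝ) (m χ ψ : 𝓢(E d, ℂ)) (hm : ∀ t, m t ≠ 0 → ‖t‖ ≤ 1) (x ξ : E d)
    (hξ : 0 < ‖ξ‖) : Band ξ (‖ξ‖ / 8) (𝓕⁻ (shiftSpec α ξ (mainSpec α m χ ψ x ξ hξ))) := by
  intro ζ hζ
  have hpi := Real.pi_pos
  rw [FourierTransform.fourier_fourierInv_eq, shiftSpec_apply, mainSpec, smul'_apply,
    dil_apply] at hζ
  have h1 := hm _ (left_ne_zero_of_mul (right_ne_zero_of_mul hζ))
  rw [norm_smul, Real.norm_of_nonneg (by positivity), div_mul_eq_mul_div,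
    div_le_one hξ] at h1
  have e : (2 * Real.pi) • ζ - ξ = (2 * Real.pi) • (ζ - (2 * Real.pi)⁻¹ • ξ) := by
    rw [smul_sub, smul_smul, mul_inv_cancel₀ (by positivity), one_smul]
  rw [e, norm_smul, Real.norm_of_nonneg (by positivity)]
  linarith

theorem exists_tot_shiftSpec_mainSpec_le {α : ℝ} (hα : 0 < α) (m χ ψ : 𝓢(E d, ℂ)) (J : ℕ) :
    ∃ (C : ℝ) (K : ℕ), 0 ≤ C ∧ ∀ (x ξ : E d) (hξ : 0 < ‖ξ‖), 64 ≤ ‖ξ‖ →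
      tot J (shiftSpec α ξ (mainSpec α m χ ψ x ξ hξ)) ≤ C * ‖ξ‖ ^ K := by
  obtain ⟨b, hb⟩ := exists_seminorm_shiftSpec_le d α
  choose C hC0 hC using exists_seminorm_smul'_fourier_cutWindow_le m χ ψ
  refine ⟨∑ p ∈ Finset.range J ×ˢ Finset.range J, 2 ^ (p.1 + 1) * (C p.1 p.2 + C 0 p.2),
    b + J + J, Finset.sum_nonneg fun p _ => mul_nonneg (by positivity)
      (add_nonneg (hC0 _ _) (hC0 _ _)), fun x ξ hξ h64 => ?_⟩
  have h1 : 1 ≤ ‖ξ‖ := by linarith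
  rw [tot, Finset.sum_mul]
  refine Finset.sum_le_sum fun p hp => ?_
  have hpJ : p.1 ≤ J := (Finset.mem_range.1 (Finset.mem_product.1 hp).1).le
  have hmax : max 1 (‖ξ‖ ^ (1 - α)) ≤ ‖ξ‖ :=
    max_le h1 ((Real.rpow_le_rpow_of_exponent_le h1 (by linarith)).trans_eq (Real.rpow_one _))
  have hmax0 : 0 ≤ max 1 (‖ξ‖ ^ (1 - α)) := zero_le_one.trans (le_max_left _ _)
  have hk : ∀ k ≤ J, SchwartzMap.seminorm ℝ k p.2 (mainSpec α m χ ψ x ξ hξ) ≤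
      C k p.2 * ‖ξ‖ ^ J := fun k hk => by
    refine (hC k p.2 _ (by positivity) (sixteen_pi_div_le_one h64) _
      (Real.rpow_pos_of_pos hξ _) x).trans (mul_le_mul_of_nonneg_left ?_ (hC0 _ _))
    exact (pow_le_pow_left₀ hmax0 hmax k).trans (pow_le_pow_right₀ h1 hk)
  have hJ : 0 ≤ ‖ξ‖ ^ J := by positivity
  have hC1 := hC0 p.1 p.2
  have hC2 := hC0 0 p.2
  refine (hb ξ h1 _ p.1 p.2 ((C p.1 p.2 + C 0 p.2) * ‖ξ‖ ^ J) ?_ ?_).trans ?_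
  · exact (hk _ hpJ).trans (mul_le_mul_of_nonneg_right (by linarith) hJ)
  · exact (hk 0 (Nat.zero_le _)).trans (mul_le_mul_of_nonneg_right (by linarith) hJ)
  · calc _ ≤ 2 ^ (p.1 + 1) * ‖ξ‖ ^ (b + J) * ((C p.1 p.2 + C 0 p.2) * ‖ξ‖ ^ J) := by gcongr
      _ = _ := by rw [pow_add _ (b + J)]; ring

/-- The cut occurs at distance of order |ξ| while the spectral scale is at most |ξ|^σ with σ < 1, so
every extra power gains |ξ|^{σ-1}. -/
theorem exists_seminorm_tailSpec_le {α : ℝ} (hα : 0 < α) (m χ ψ : 𝓢(E d, ℂ))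
    (hm : ∀ t, ‖t‖ ≤ 1 / 2 → m t = 1) (k n N : ℕ) :
    ∃ C, 0 ≤ C ∧ ∀ (x ξ : E d) (hξ : 0 < ‖ξ‖), 64 ≤ ‖ξ‖ →
      SchwartzMap.seminorm ℝ k n (tailSpec α m χ ψ x ξ hξ) * ‖ξ‖ ^ N ≤ C := by
  set σ := max 0 (1 - α) with hσ
  have hσ1 : σ < 1 := max_lt one_pos (by linarith)
  -- Chosen so that N'(1 - σ) ≥ N + k, hence σ(k + N') + N ≤ N'.
  obtain ⟨N', hN'⟩ := exists_nat_ge ((N + k) / (1 - σ))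
  rw [div_le_iff₀ (by linarith)] at hN'
  obtain ⟨C, hC0, hC⟩ := exists_seminorm_sub_smul'_fourier_cutWindow_le m χ ψ hm k n N'
  refine ⟨C * (16 * Real.pi) ^ N', by positivity, fun x ξ hξ h64 => ?_⟩
  have h1 : 1 ≤ ‖ξ‖ := by linarith
  have h2 := hC (16 * Real.pi / ‖ξ‖) (by positivity) (sixteen_pi_div_le_one h64) _
    (Real.rpow_pos_of_pos hξ (1 - α)) x
  have h3 : max 1 (‖ξ‖ ^ (1 - α)) ^ (k + N') ≤ ‖ξ‖ ^ (σ * (k + N' : ℕ)) := by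
    rw [Real.rpow_mul hξ.le, Real.rpow_natCast]
    exact pow_le_pow_left₀ (zero_le_one.trans (le_max_left _ _)) (max_one_rpow_le h1) _
  have h4 : ‖ξ‖ ^ (σ * (k + N' : ℕ)) * ‖ξ‖ ^ N ≤ ‖ξ‖ ^ N' := by
    rw [← Real.rpow_natCast, ← Real.rpow_natCast, ← Real.rpow_add hξ]
    refine Real.rpow_le_rpow_of_exponent_le h1 ?_
    push_cast
    have : σ * k ≤ k := mul_le_of_le_one_left (Nat.cast_nonneg k) hσ1.le
    linarith
  calc _ ≤ C * (16 * Real.pi / ‖ξ‖) ^ N' * max 1 (‖ξ‖ ^ (1 - α)) ^ (k + N') * ‖ξ‖ ^ N :=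
        mul_le_mul_of_nonneg_right h2 (by positivity)
    _ ≤ C * (16 * Real.pi / ‖ξ‖) ^ N' * ‖ξ‖ ^ (σ * (k + N' : ℕ)) * ‖ξ‖ ^ N := by gcongr
    _ ≤ C * (16 * Real.pi / ‖ξ‖) ^ N' * ‖ξ‖ ^ N' := by
        rw [mul_assoc _ (‖ξ‖ ^ (σ * _))]
        exact mul_le_mul_of_nonneg_left h4 (by positivity)
    _ = _ := by rw [div_pow, mul_assoc, div_mul_cancel₀ _ (by positivity)]

theorem exists_tot_shiftSpec_tailSpec_le {α : ℝ} (hα : 0 < α) (m χ ψ : 𝓢(E d, ℂ))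
    (hm : ∀ t, ‖t‖ ≤ 1 / 2 → m t = 1) (J N : ℕ) :
    ∃ C, 0 ≤ C ∧ ∀ (x ξ : E d) (hξ : 0 < ‖ξ‖), 64 ≤ ‖ξ‖ →
      tot J (shiftSpec α ξ (tailSpec α m χ ψ x ξ hξ)) * ‖ξ‖ ^ N ≤ C := by
  obtain ⟨b, hb⟩ := exists_seminorm_shiftSpec_le d α
  choose C hC0 hC using fun k n => exists_seminorm_tailSpec_le hα m χ ψ hm k n (b + J + N)
  refine ⟨∑ p ∈ Finset.range J ×ˢ Finset.range J, 2 ^ (p.1 + 1) * (C p.1 p.2 + C 0 p.2),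
    Finset.sum_nonneg fun p _ => mul_nonneg (by positivity)
      (add_nonneg (hC0 _ _) (hC0 _ _)), fun x ξ hξ h64 => ?_⟩
  have h1 : 1 ≤ ‖ξ‖ := by linarith
  rw [tot, Finset.sum_mul]
  refine Finset.sum_le_sum fun p hp => ?_
  have hpJ : p.1 ≤ J := (Finset.mem_range.1 (Finset.mem_product.1 hp).1).le
  set B := (C p.1 p.2 + C 0 p.2) / ‖ξ‖ ^ (b + J + N) with hB
  have hC1 := hC0 p.1 p.2
  have hC2 := hC0 0 p.2
  have h2 := hb ξ h1 (tailSpec α m χ ψ x ξ hξ) p.1 p.2 B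
    ((le_div_iff₀ (by positivity)).2 ((hC p.1 p.2 x ξ hξ h64).trans (by linarith)))
    ((le_div_iff₀ (by positivity)).2 ((hC 0 p.2 x ξ hξ h64).trans (by linarith)))
  have hB0 : 0 ≤ B := by positivity
  calc _ ≤ 2 ^ (p.1 + 1) * ‖ξ‖ ^ (b + J) * B * ‖ξ‖ ^ N := by
        refine mul_le_mul_of_nonneg_right (h2.trans ?_) (by positivity)
        gcongr
    _ = 2 ^ (p.1 + 1) * (B * ‖ξ‖ ^ (b + J + N)) := by rw [pow_add _ (b + J)]; ring
    _ = _ := by rw [hB, div_mul_cancel₀ _ (by positivity)]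

/-- Reality of χ lets it move onto the packet unconjugated. -/
theorem stft_smulLeftCLM (α : ℝ) (χ ψ : 𝓢(E d, ℂ)) (hχ : ∀ t, (starRingEnd ℂ) (χ t) = χ t)
    (u : 𝓢'(E d, ℂ)) (x ξ : E d) :
    stft α ψ (TemperedDistribution.smulLeftCLM ℂ χ u) x ξ =
      conjPair u (smul' χ (packet α ψ x ξ)) := by
  rw [stft, TemperedDistribution.smulLeftCLM_apply_apply, conjPair_apply]
  congr 1
  ext t
  rw [conjSchwartz_apply, smul'_apply, map_mul, hχ,
    SchwartzMap.smulLeftCLM_apply_apply χ.hasTemperateGrowth, smul_eq_mul, conjSchwartz_apply]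

/-- The main part combines rapid decay on bands with polynomial growth of its weighted norm; the
tail needs only the continuity of u. All estimates are uniform in x and in the direction of ξ. -/
theorem exists_stft_decay (hd : 0 < d) {α : ℝ} (hα : 0 < α) {φ : 𝓢(E d, ℂ)}
    {Ω : Lattice d} (h : IsAdmissiblePair α φ Ω) {p q : ℝ≥0∞}
    (hp : 1 ≤ p) (hq : 1 ≤ q) {u : 𝓢'(E d, ℂ)}
    (hu : ∀ᶠ β : ℝ in atTop, u ∈ modulationSpace α β p q φ Ω) (χ ψ : 𝓢(E d, ℂ))
    (hχ : ∀ t, (starRingEnd ℂ) (χ t) = χ t) :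
    ∃ R, 0 < R ∧ ∀ N : ℕ, ∃ C, ∀ x ξ : E d, R ≤ ‖ξ‖ →
      ‖stft α ψ (TemperedDistribution.smulLeftCLM ℂ χ u) x ξ‖ ≤ C * (1 + ‖ξ‖) ^ (-(N : ℝ)) := by
  obtain ⟨R, M, -, hband⟩ := exists_band_decay hd hα h hp hq hu
  obtain ⟨m, -, -, hm1, hm2⟩ := exists_bump (0 : E d)
  simp only [sub_zero] at hm1 hm2
  obtain ⟨J₁, C₁, hC₁, hw⟩ := exists_wnrm_fourierInv_le (d := d) M
  obtain ⟨J₂, C₂, hC₂, ht⟩ := exists_conjPair_fourierInv_le u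
  obtain ⟨C₃, K, hC₃, hmain⟩ := exists_tot_shiftSpec_mainSpec_le hα m χ ψ J₁
  refine ⟨max R 64, lt_of_lt_of_le (by norm_num) (le_max_right _ _), fun N => ?_⟩
  obtain ⟨C₄, hC₄, htail⟩ := exists_tot_shiftSpec_tailSpec_le hα m χ ψ hm1 J₂ N
  -- The extra K compensates the growth |ξ|^K of the main part.
  obtain ⟨C₅, hC₅, hdec⟩ := hband (N + K)
  refine ⟨2 ^ N * (C₅ * (C₁ * C₃) + C₂ * C₄), fun x ξ hR => ?_⟩
  have h64 : 64 ≤ ‖ξ‖ := (le_max_right _ _).trans hR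
  have hξ : 0 < ‖ξ‖ := by linarith
  rw [stft_smulLeftCLM α χ ψ hχ, smul'_packet_eq α m χ ψ x ξ hξ, map_add,
    Real.rpow_neg (by positivity), Real.rpow_natCast, ← div_eq_mul_inv,
    le_div_iff₀ (by positivity)]
  have h1 := (hdec ξ ((le_max_left _ _).trans hR) _ (band_mainSpec α m χ ψ hm2 x ξ hξ)).trans
    (mul_le_mul_of_nonneg_left ((hw _).trans
      (mul_le_mul_of_nonneg_left (hmain x ξ hξ h64) hC₁)) hC₅)
  set X := ‖conjPair u (𝓕⁻ (shiftSpec α ξ (mainSpec α m χ ψ x ξ hξ)))‖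
  have h2 : X * ‖ξ‖ ^ N ≤ C₅ * (C₁ * C₃) := by
    refine le_of_mul_le_mul_right ?_ (show 0 < ‖ξ‖ ^ K by positivity)
    calc _ = X * ‖ξ‖ ^ (N + K) := by rw [pow_add]; ring
      _ ≤ _ := h1
      _ = _ := by ring
  have h3 : ‖conjPair u (𝓕⁻ (shiftSpec α ξ (tailSpec α m χ ψ x ξ hξ)))‖ * ‖ξ‖ ^ N ≤ C₂ * C₄ := by
    calc _ ≤ C₂ * tot J₂ (shiftSpec α ξ (tailSpec α m χ ψ x ξ hξ)) * ‖ξ‖ ^ N :=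
          mul_le_mul_of_nonneg_right (ht _) (by positivity)
      _ ≤ _ := by
          rw [mul_assoc]
          exact mul_le_mul_of_nonneg_left (htail x ξ hξ h64) hC₂
  have h4 : (1 + ‖ξ‖) ^ N ≤ 2 ^ N * ‖ξ‖ ^ N := by
    rw [← mul_pow]
    exact pow_le_pow_left₀ (by positivity) (by linarith) N
  refine (mul_le_mul (norm_add_le _ _) h4 (by positivity) (by positivity)).trans ?_
  rw [mul_left_comm]
  refine mul_le_mul_of_nonneg_left ?_ (by positivity)
  rw [add_mul]
  exact add_le_add h2 h3

end Subdyadic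

/-! ### The proposition -/

theorem proposition6p6 {d : ℕ} {α : ℝ} (hα : 0 < α)
    (φ : 𝓢(Subdyadic.E d, ℂ)) (Ω : Subdyadic.Lattice d)
    (hφΩ : Subdyadic.IsAdmissiblePair α φ Ω)
    (ψ : 𝓢(Subdyadic.E d, ℂ)) (hψ : Subdyadic.IsAdmissibleWindow α ψ)
    {p q : ℝ≥0∞} (hp : 1 ≤ p) (hq : 1 ≤ q)
    (u : 𝓢'(Subdyadic.E d, ℂ))
    (hu : ∀ᶠ β : ℝ in atTop, u ∈ Subdyadic.modulationSpace α β p q φ Ω) :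
    Subdyadic.gaborWF α ψ u = ∅ := by
  refine Set.eq_empty_iff_forall_notMem.2 fun w hw => hw.2 ?_
  -- In dimension zero there is no nonzero ξ₀, so the wavefront set is empty for trivial reasons.
  have hd : 0 < d := by
    rcases Nat.eq_zero_or_pos d with rfl | hd
    · exact absurd (Subsingleton.elim _ _) hw.1
    · exact hd
  obtain ⟨χ, hχc, hχr, hχ1, -⟩ := Subdyadic.exists_bump w.1
  obtain ⟨R, hR, hdecay⟩ := Subdyadic.exists_stft_decay hd hα hφΩ hp hq hu χ ψ hχr
  -- Decay is uniform in position and direction, so U is the whole space and Γ the whole punctured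
  -- space; χ is a real bump equal to 1 near x₀.
  refine ⟨χ, χ.smooth', hχc, ?_, Set.univ, isOpen_univ, Set.mem_univ _, {ξ | ξ ≠ 0}, isOpen_ne,
    fun h => h rfl, fun ξ hξ c hc => smul_ne_zero hc.ne' hξ, hw.1,
    ⟨1, fun ξ _ h1 => Real.one_le_rpow h1 hα.le⟩, R, hR, fun N => ?_⟩
  · rw [hχ1 _ (by simp)]
    exact one_ne_zero
  · obtain ⟨C, hC⟩ := hdecay N
    exact ⟨C, fun x _ ξ _ h => hC x ξ h⟩
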